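/- Let $(\bar M,\bar\varphi,\bar\xi_\alpha,\bar\eta^\alpha,\bar g)$, $1\le\alpha\le r$, $r\ge 1$, be an indefinite $\mathcal S$-manifold. That is: $\bar g$ is a semi-Riemannian metric of index $\nu$ with $0<\nu<\dim\bar M$; $\bar\varphi$ is a nonzero $(1,1)$-tensor field of constant rank whose kernel is spanned by the vector fields $\bar\xi_\alpha$, with dual $1$-forms $\bar\eta^\alpha$, so that $\bar\varphi^2=-I+\sum_\alpha\bar\eta^\alpha\otimes\bar\xi_\alpha$ and $\bar\eta^\alpha(\bar\xi_\beta)=\delta^\alpha_\beta$; $\bar g(\bar\varphi X,\bar\varphi Y)=\bar g(X,Y)-\sum_\alpha\varepsilon_\alpha\bar\eta^\alpha(X)\bar\eta^\alpha(Y)$, where $\varepsilon_\alpha=1$ or $-1$ according to whether $\bar\xi_\alpha$ is spacelike or timelike; $N_{\bar\varphi}+2\sum_\alpha d\bar\eta^\alpha\otimes\bar\xi_\alpha=0$, where $N_{\bar\varphi}$ is the Nijenhuis torsion; and $d\bar\eta^\alpha(X,Y)=\bar g(X,\bar\varphi Y)$ for every $\alpha$, with the convention $2\,d\eta(X,Y)=X\eta(Y)-Y\eta(X)-\eta([X,Y])$.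 Put $\bar\xi=\sum_\alpha\bar\xi_\alpha$ and $\bar\eta=\sum_\alpha\varepsilon_\alpha\bar\eta^\alpha$, and let $\bar\nabla$ be the Levi-Civita connection of $\bar g$. Let $M$ be a characteristic lightlike hypersurface of $\bar M$, i.e. an immersed hypersurface on which the induced form $g$ is degenerate at every point and to which all $\bar\xi_\alpha$ are tangent. Let $S(TM)$ be a characteristic screen distribution on $M$, i.e. $TM=\mathrm{Rad}(TM)\oplus S(TM)$, $\ker\bar\varphi\subset S(TM)$ and $\bar\varphi(\mathrm{Rad}(TM))\subset S(TM)$. Let $\mathrm{ltr}(M)$ be the corresponding lightlike transversal line bundle: each local nowhere zero section $E$ of $\mathrm{Rad}(TM)$ determines a unique section $N$ of $\mathrm{ltr}(M)$ with $\bar g(N,E)=1$, $\bar g(N,N)=0$ and $\bar g(N,W)=0$ for all $W\in S(TM)$. Fix a family of such pairs $(E,N)$ whose domains cover $M$ (for instance one global pair), and put $U=-\bar\varphi N$. Let $\nabla_XY$ and $-A_NX$ be the components along $TM$ of $\bar\nabla_XY$ and $\bar\nabla_XN$ in the decomposition $T\bar M|_M=TM\oplus\mathrm{ltr}(M)$.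 Let $D_0$ be the orthogonal complement of $\bar\varphi(\mathrm{Rad}(TM))\oplus\bar\varphi(\mathrm{ltr}(M))$ in $S(TM)$, let $D=D_0\oplus\bar\varphi(\mathrm{Rad}(TM))\oplus\mathrm{Rad}(TM)$, so that $TM=D\oplus\bar\varphi(\mathrm{ltr}(M))$, and let $\varphi X=\bar\varphi(SX)$ for $X\in TM$, where $S:TM\to D$ is the projection along $\bar\varphi(\mathrm{ltr}(M))$. Then $M$ is totally geodesic, i.e. every geodesic of $(M,\nabla)$ is a geodesic of $(\bar M,\bar\nabla)$, if and only if both of the following hold: 1. $(\nabla_X\varphi)Y=\bar g(\bar\varphi X,\bar\varphi Y)\,\bar\xi+\bar\eta(Y)\,\bar\varphi^2X$ for all $X\in TM$ and all $Y\in\Gamma(D)$; 2. for each pair $(E,N)$ of the family, $A_NX=-\varphi(\nabla_XU)-g(X,U)\,\bar\xi$ for all $X\in TM$ over its domain. -/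

import Mathlib

open scoped Manifold ContDiff Topology
open Bundle

noncomputable section

/-! ### Semi-Riemannian metrics and the Levi-Civita connection -/

section Ambient

/-- A smooth semi-Riemannian metric on a manifold modelled on the finite-dimensional space `F`:
a smooth field of symmetric nondegenerate bilinear forms of constant index. -/
structure SemiRiemannianMetric (F : Type*) [NormedAddCommGroup F] [NormedSpace ℝ F]
    (Mb : Type*) [TopologicalSpace Mb] [ChartedSpace F Mb] [IsManifold 𝓘(ℝ, F) ∞ Mb] where
  /-- the scalar product on each tangent space -/
  inner (x : Mb) : TangentSpace 𝓘(ℝ, F) x →L[ℝ] TangentSpace 𝓘(ℝ, F) x →L[ℝ] ℝ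
  /-- the index -/
  index : ℕ
  symm (x : Mb) (v w : TangentSpace 𝓘(ℝ, F) x) : inner x v w = inner x w v
  nondegenerate (x : Mb) (v : TangentSpace 𝓘(ℝ, F) x) (hv : ∀ w, inner x v w = 0) : v = 0
  contMDiff : ContMDiff 𝓘(ℝ, F) (𝓘(ℝ, F).prod 𝓘(ℝ, F →L[ℝ] F →L[ℝ] ℝ)) ∞
    (fun x ↦ TotalSpace.mk' (F →L[ℝ] F →L[ℝ] ℝ)
      (E := fun x : Mb ↦ TangentSpace 𝓘(ℝ, F) x →L[ℝ] TangentSpace 𝓘(ℝ, F) x →L[ℝ] ℝ) x (inner x))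
  index_eq (x : Mb) :
    sigNeg (LinearMap.BilinMap.toQuadraticMap (inner x).toLinearMap₁₂) = index

variable {F : Type*} [NormedAddCommGroup F] [NormedSpace ℝ F] [FiniteDimensional ℝ F]
  {Mb : Type*} [TopologicalSpace Mb] [ChartedSpace F Mb] [IsManifold 𝓘(ℝ, F) ∞ Mb]

/-- A vector field on a manifold, smooth on the set `s`. -/
def SmoothFieldOn (X : Π x : Mb, TangentSpace 𝓘(ℝ, F) x) (s : Set Mb) : Prop :=
  ContMDiffOn 𝓘(ℝ, F) 𝓘(ℝ, F).tangent ∞ (fun x ↦ (⟨x, X x⟩ : TangentBundle 𝓘(ℝ, F) Mb)) s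

/-- A vector field on a manifold, differentiable at the point `x`. -/
def DiffFieldAt (X : Π x : Mb, TangentSpace 𝓘(ℝ, F) x) (x : Mb) : Prop :=
  MDifferentiableAt 𝓘(ℝ, F) 𝓘(ℝ, F).tangent (fun x ↦ (⟨x, X x⟩ : TangentBundle 𝓘(ℝ, F) Mb)) x

/-- `nabla` is the Levi-Civita connection of the metric `g`: it has no torsion and
`v (g (Y, Z)) = g (∇_v Y, Z) + g (Y, ∇_v Z)`. Recall that Mathlib writes `nabla Y x v` for
`∇_v Y` at `x`. -/
def IsLeviCivita (g : SemiRiemannianMetric F Mb)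
    (nabla : CovariantDerivative 𝓘(ℝ, F) F (TangentSpace 𝓘(ℝ, F) : Mb → Type _)) : Prop :=
  nabla.torsion = 0 ∧
  ∀ (x : Mb) (v : TangentSpace 𝓘(ℝ, F) x) (Y Z : Π x : Mb, TangentSpace 𝓘(ℝ, F) x),
    DiffFieldAt Y x → DiffFieldAt Z x →
    mvfderiv 𝓘(ℝ, F) (fun y ↦ g.inner y (Y y) (Z y)) x v
      = g.inner x (nabla Y x v) (Z x) + g.inner x (Y x) (nabla Z x v)

/-! ### Covariant derivatives along maps, geodesics -/

/-- The covariant derivative along a map `f : P → Mb` of a vector field `V` along `f`, in the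
direction `v`, for the connection `cov` (`cov Y x w` stands for `∇_w Y` at `x`). With `(e_k)` the
coordinate frame of the chart at `f p` and `V = ∑ V^k (e_k ∘ f)` it is
`∑ dV^k(v) e_k + ∑ V^k(p) ∇_{df(v)} e_k`; the second sum is the covariant derivative of
`FiberBundle.extend F (V p)`, the field with constant components `V^k(p)`. -/
def covAlong (cov : (Π x : Mb, TangentSpace 𝓘(ℝ, F) x) →
      Π x : Mb, TangentSpace 𝓘(ℝ, F) x → TangentSpace 𝓘(ℝ, F) x)
    {E : Type*} [NormedAddCommGroup E] [NormedSpace ℝ E]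
    {P : Type*} [TopologicalSpace P] [ChartedSpace E P]
    (f : P → Mb) (V : Π q : P, TangentSpace 𝓘(ℝ, F) (f q)) (p : P) (v : TangentSpace 𝓘(ℝ, E) p) :
    TangentSpace 𝓘(ℝ, F) (f p) :=
  (trivializationAt F (TangentSpace 𝓘(ℝ, F) : Mb → Type _) (f p)).symm (f p)
    (mvfderiv 𝓘(ℝ, E) (fun q ↦ (trivializationAt F (TangentSpace 𝓘(ℝ, F) : Mb → Type _) (f p)
      ⟨f q, V q⟩).2) p v)
  + cov (FiberBundle.extend F (V p)) (f p) (mfderiv 𝓘(ℝ, E) 𝓘(ℝ, F) f p v)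

/-- The velocity of a curve. -/
def velocity (c : ℝ → Mb) (t : ℝ) : TangentSpace 𝓘(ℝ, F) (c t) :=
  mfderiv 𝓘(ℝ, ℝ) 𝓘(ℝ, F) c t (1 : ℝ)

/-- `c` is a geodesic of the connection `cov` on the open interval `J`: `c` is smooth on `J` and
`∇_{c'} c' = 0` there. -/
def IsGeodesicCurveOn (cov : (Π x : Mb, TangentSpace 𝓘(ℝ, F) x) →
      Π x : Mb, TangentSpace 𝓘(ℝ, F) x → TangentSpace 𝓘(ℝ, F) x)
    (c : ℝ → Mb) (J : Set ℝ) : Prop :=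
  ContMDiffOn 𝓘(ℝ, ℝ) 𝓘(ℝ, F) ∞ c J ∧
  ∀ t ∈ J, covAlong cov c (velocity (F := F) c) t (1 : ℝ) = 0

/-! ### Indefinite `S`-manifolds -/

variable (F Mb) in
/-- An indefinite metric globally framed `f`-structure with `r` characteristic vector fields. -/
structure IndefiniteGFF (r : ℕ) where
  /-- the semi-Riemannian metric -/
  metric : SemiRiemannianMetric F Mb
  /-- the `(1,1)`-tensor field -/
  phi (x : Mb) : TangentSpace 𝓘(ℝ, F) x →L[ℝ] TangentSpace 𝓘(ℝ, F) x
  /-- the characteristic vector fields -/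
  xi (α : Fin r) (x : Mb) : TangentSpace 𝓘(ℝ, F) x
  /-- the dual one-forms -/
  eta (α : Fin r) (x : Mb) : TangentSpace 𝓘(ℝ, F) x →L[ℝ] ℝ
  /-- the causal signs of the characteristic vector fields -/
  eps (α : Fin r) : ℝ
  phi_smooth : ContMDiff 𝓘(ℝ, F) (𝓘(ℝ, F).prod 𝓘(ℝ, F →L[ℝ] F)) ∞
    (fun x ↦ TotalSpace.mk' (F →L[ℝ] F)
      (E := fun x : Mb ↦ TangentSpace 𝓘(ℝ, F) x →L[ℝ] TangentSpace 𝓘(ℝ, F) x) x (phi x))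
  xi_smooth (α : Fin r) : SmoothFieldOn (xi α) Set.univ
  eta_smooth (α : Fin r) : ContMDiff 𝓘(ℝ, F) (𝓘(ℝ, F).prod 𝓘(ℝ, F →L[ℝ] ℝ)) ∞
    (fun x ↦ TotalSpace.mk' (F →L[ℝ] ℝ)
      (E := fun x : Mb ↦ TangentSpace 𝓘(ℝ, F) x →L[ℝ] Bundle.Trivial Mb ℝ x) x (eta α x))
  phi_rank : ∃ k : ℕ, 0 < k ∧ ∀ x, Module.finrank ℝ (phi x).range = k
  ker_phi (x : Mb) : (phi x).ker = Submodule.span ℝ (Set.range fun α ↦ xi α x)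
  phi_sq (x : Mb) (v : TangentSpace 𝓘(ℝ, F) x) :
    phi x (phi x v) = -v + ∑ α, eta α x v • xi α x
  eta_xi (α β : Fin r) (x : Mb) : eta α x (xi β x) = if α = β then 1 else 0
  index_pos : 0 < metric.index
  index_lt : metric.index < Module.finrank ℝ F
  eps_spec (α : Fin r) : (eps α = 1 ∧ ∀ x, 0 < metric.inner x (xi α x) (xi α x)) ∨
    (eps α = -1 ∧ ∀ x, metric.inner x (xi α x) (xi α x) < 0)
  compat (x : Mb) (v w : TangentSpace 𝓘(ℝ, F) x) : metric.inner x (phi x v) (phi x w)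
    = metric.inner x v w - ∑ α, eps α * eta α x v * eta α x w

namespace IndefiniteGFF

variable {r : ℕ} (A : IndefiniteGFF F Mb r)

/-- `phi` applied to a vector field. -/
def phiField (X : Π x : Mb, TangentSpace 𝓘(ℝ, F) x) (x : Mb) : TangentSpace 𝓘(ℝ, F) x :=
  A.phi x (X x)

/-- The Nijenhuis torsion of `phi`:
`[φX, φY] + φ²[X, Y] - φ[φX, Y] - φ[X, φY]`. -/
def nijenhuis (X Y : Π x : Mb, TangentSpace 𝓘(ℝ, F) x) (x : Mb) : TangentSpace 𝓘(ℝ, F) x :=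
  VectorField.mlieBracket 𝓘(ℝ, F) (A.phiField X) (A.phiField Y) x
    + A.phi x (A.phi x (VectorField.mlieBracket 𝓘(ℝ, F) X Y x))
    - A.phi x (VectorField.mlieBracket 𝓘(ℝ, F) (A.phiField X) Y x)
    - A.phi x (VectorField.mlieBracket 𝓘(ℝ, F) X (A.phiField Y) x)

/-- The exterior derivative of `eta α`, with the convention
`2 dη(X, Y) = X(η(Y)) - Y(η(X)) - η([X, Y])`. -/
def dEta (α : Fin r) (X Y : Π x : Mb, TangentSpace 𝓘(ℝ, F) x) (x : Mb) : ℝ :=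
  (mvfderiv 𝓘(ℝ, F) (fun y ↦ A.eta α y (Y y)) x (X x)
    - mvfderiv 𝓘(ℝ, F) (fun y ↦ A.eta α y (X y)) x (Y x)
    - A.eta α x (VectorField.mlieBracket 𝓘(ℝ, F) X Y x)) / 2

/-- The structure is normal (`N_φ + 2 dη^α ⊗ ξ_α = 0`) and `dη^α = Φ` for every `α`, where
`Φ(X, Y) = g(X, φY)`. -/
def IsSManifold : Prop :=
  ∀ X Y : Π x : Mb, TangentSpace 𝓘(ℝ, F) x, ∀ x : Mb,
    DiffFieldAt X x → DiffFieldAt Y x →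
    A.nijenhuis X Y x + ∑ α, (2 * A.dEta α X Y x) • A.xi α x = 0 ∧
    ∀ α, A.dEta α X Y x = A.metric.inner x (X x) (A.phi x (Y x))

/-- `ξ = ∑ ξ_α`. -/
def xiSum (x : Mb) : TangentSpace 𝓘(ℝ, F) x := ∑ α, A.xi α x

/-- `η = ∑ ε_α η^α`. -/
def etaSum (x : Mb) (v : TangentSpace 𝓘(ℝ, F) x) : ℝ := ∑ α, A.eps α * A.eta α x v

end IndefiniteGFF

end Ambient

/-! ### Lightlike hypersurfaces -/

/-- The component in `p` of `x` for the decomposition of the space as `p ⊕ q` (the value is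
meaningful when `p` and `q` are complementary). -/
def projAlong {V : Type*} [AddCommGroup V] [Module ℝ V] (p q : Submodule ℝ V) (x : V) : V :=
  open Classical in if h : IsCompl p q then p.projection q h x else 0

section Hypersurface

variable {F : Type*} [NormedAddCommGroup F] [NormedSpace ℝ F] [FiniteDimensional ℝ F]
  {Mb : Type*} [TopologicalSpace Mb] [ChartedSpace F Mb] [IsManifold 𝓘(ℝ, F) ∞ Mb]
  {E : Type*} [NormedAddCommGroup E] [NormedSpace ℝ E] [FiniteDimensional ℝ E]
  {M : Type*} [TopologicalSpace M] [ChartedSpace E M] [IsManifold 𝓘(ℝ, E) ∞ M]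

/-- The bilinear form induced on `T_p M` by the metric `g` and the map `i`. -/
def inducedForm (g : SemiRiemannianMetric F Mb) (i : M → Mb) (p : M) :
    LinearMap.BilinForm ℝ (TangentSpace 𝓘(ℝ, E) p) :=
  (g.inner (i p)).toLinearMap₁₂.compl₁₂
    (mfderiv 𝓘(ℝ, E) 𝓘(ℝ, F) i p).toLinearMap (mfderiv 𝓘(ℝ, E) 𝓘(ℝ, F) i p).toLinearMap

/-- The radical of the induced form on `T_p M`. -/
def radicalSpace (g : SemiRiemannianMetric F Mb) (i : M → Mb) (p : M) :
    Submodule ℝ (TangentSpace 𝓘(ℝ, E) p) :=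
  (inducedForm (E := E) g i p).orthogonal ⊤

variable (E M) in
/-- A lightlike hypersurface of `(Mb, g)` with a screen distribution: an immersed hypersurface
whose induced form is degenerate at each point, with a smooth distribution `screen`
complementary to the radical one. -/
structure LightlikeHypersurface (g : SemiRiemannianMetric F Mb) where
  /-- the immersion -/
  map : M → Mb
  immersion : Manifold.IsImmersion 𝓘(ℝ, E) 𝓘(ℝ, F) ∞ map
  codim_one : Module.finrank ℝ F = Module.finrank ℝ E + 1
  lightlike (p : M) : radicalSpace (E := E) g map p ≠ ⊥
  /-- the screen distribution -/
  screen (p : M) : Submodule ℝ (TangentSpace 𝓘(ℝ, E) p)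
  screen_compl (p : M) : IsCompl (radicalSpace (E := E) g map p) (screen p)
  screen_smooth (p : M) (v : TangentSpace 𝓘(ℝ, E) p) (hv : v ∈ screen p) :
    ∃ (O : Set M) (Z : Π q : M, TangentSpace 𝓘(ℝ, E) q), IsOpen O ∧ p ∈ O ∧
      SmoothFieldOn Z O ∧ (∀ q ∈ O, Z q ∈ screen q) ∧ Z p = v

namespace LightlikeHypersurface

variable {r : ℕ} (A : IndefiniteGFF F Mb r)
  {g : SemiRiemannianMetric F Mb} (L : LightlikeHypersurface E M g)
  (K : LightlikeHypersurface E M A.metric)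

/-- The differential of the immersion at `p`, which identifies `T_p M` with a hyperplane. -/
def di (p : M) : TangentSpace 𝓘(ℝ, E) p →L[ℝ] TangentSpace 𝓘(ℝ, F) (L.map p) :=
  mfderiv 𝓘(ℝ, E) 𝓘(ℝ, F) L.map p

/-- The radical distribution `Rad(TM)`. -/
def rad (p : M) : Submodule ℝ (TangentSpace 𝓘(ℝ, E) p) := radicalSpace g L.map p

/-- The fibre at `p` of the lightlike transversal bundle `ltr(M)`. -/
def ltr (p : M) : Submodule ℝ (TangentSpace 𝓘(ℝ, F) (L.map p)) :=
  Submodule.span ℝ {n | g.inner (L.map p) n n = 0 ∧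
    (∀ w ∈ L.screen p, g.inner (L.map p) n (L.di p w) = 0) ∧
    ∃ e ∈ L.rad p, g.inner (L.map p) n (L.di p e) = 1}

/-- The tangent vector to `M` whose image under the immersion is `w` (meaningful when `w` is
tangent to `M`; it is unique because the differential of an immersion is injective). -/
def lift (p : M) (w : TangentSpace 𝓘(ℝ, F) (L.map p)) : TangentSpace 𝓘(ℝ, E) p :=
  open Classical in if h : ∃ v, L.di p v = w then h.choose else 0

/-- The tangential part of a vector, for `T Mb = TM ⊕ ltr(M)`. -/
def tangentPart (p : M) (w : TangentSpace 𝓘(ℝ, F) (L.map p)) : TangentSpace 𝓘(ℝ, E) p :=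
  L.lift p (projAlong (L.di p).range (L.ltr p) w)

variable (nabla : CovariantDerivative 𝓘(ℝ, F) F (TangentSpace 𝓘(ℝ, F) : Mb → Type _))

/-- The connection of the ambient manifold, for vector fields along the immersion. -/
def ambientCov (V : Π q : M, TangentSpace 𝓘(ℝ, F) (L.map q)) (p : M)
    (v : TangentSpace 𝓘(ℝ, E) p) : TangentSpace 𝓘(ℝ, F) (L.map p) :=
  covAlong (fun Y x w ↦ nabla Y x w) L.map V p v

/-- The induced connection on `M`: `∇_v Y` is the tangential part of the ambient derivative. -/
def inducedCov (Y : Π q : M, TangentSpace 𝓘(ℝ, E) q) (p : M) (v : TangentSpace 𝓘(ℝ, E) p) :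
    TangentSpace 𝓘(ℝ, E) p :=
  L.tangentPart p (L.ambientCov nabla (fun q ↦ L.di q (Y q)) p v)

/-- The shape operator `A_N v`, minus the tangential part of the ambient derivative of `N`. -/
def shape (N : Π q : M, TangentSpace 𝓘(ℝ, F) (L.map q)) (p : M) (v : TangentSpace 𝓘(ℝ, E) p) :
    TangentSpace 𝓘(ℝ, E) p :=
  -L.tangentPart p (L.ambientCov nabla N p v)

/-- Every geodesic of `M` for the induced connection is a geodesic of the ambient manifold. -/
def IsTotallyGeodesic : Prop :=
  ∀ (c : ℝ → M) (J : Set ℝ), IsOpen J → J.OrdConnected →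
    IsGeodesicCurveOn (F := E) (L.inducedCov nabla) c J →
    IsGeodesicCurveOn (F := F) (fun Y x w ↦ nabla Y x w) (L.map ∘ c) J

/-- The characteristic vector fields are tangent to `M`, and the screen distribution is
characteristic: it contains `ker φ` and `φ(Rad(TM))`. -/
def IsCharacteristic : Prop :=
  (∀ p α, A.xi α (K.map p) ∈ (K.di p).range) ∧
  (∀ p, (A.phi (K.map p)).ker ≤ (K.screen p).map (K.di p).toLinearMap) ∧
  (∀ p, ∀ e ∈ K.rad p, A.phi (K.map p) (K.di p e) ∈ (K.screen p).map (K.di p).toLinearMap)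

/-- The distribution `φ(Rad(TM))` on `M`. -/
def phiRad (p : M) : Submodule ℝ (TangentSpace 𝓘(ℝ, E) p) :=
  (((K.rad p).map (K.di p).toLinearMap).map (A.phi (K.map p)).toLinearMap).comap
    (K.di p).toLinearMap

/-- The distribution `φ(ltr(M))` on `M`. -/
def phiLtr (p : M) : Submodule ℝ (TangentSpace 𝓘(ℝ, E) p) :=
  ((K.ltr p).map (A.phi (K.map p)).toLinearMap).comap (K.di p).toLinearMap

/-- The distribution `D₀`, the orthogonal complement of `φ(Rad(TM)) ⊕ φ(ltr(M))` in the screen. -/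
def distD0 (p : M) : Submodule ℝ (TangentSpace 𝓘(ℝ, E) p) :=
  K.screen p ⊓ (inducedForm A.metric K.map p).orthogonal (K.phiRad A p ⊔ K.phiLtr A p)

/-- The distribution `D = D₀ ⊕ φ(Rad(TM)) ⊕ Rad(TM)`. -/
def distD (p : M) : Submodule ℝ (TangentSpace 𝓘(ℝ, E) p) :=
  K.distD0 A p ⊔ K.phiRad A p ⊔ K.rad p

/-- The induced `(1,1)`-tensor field on `M`: the ambient one applied to the component in `D`, for
`TM = D ⊕ φ(ltr(M))`. -/
def phiM (p : M) (v : TangentSpace 𝓘(ℝ, E) p) : TangentSpace 𝓘(ℝ, E) p :=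
  K.lift p (A.phi (K.map p) (K.di p (projAlong (K.distD A p) (K.phiLtr A p) v)))

/-- `(∇_v φ) Y = ∇_v (φ Y) - φ (∇_v Y)` for the induced tensor field and connection on `M`. -/
def covPhiM (Y : Π q : M, TangentSpace 𝓘(ℝ, E) q) (p : M) (v : TangentSpace 𝓘(ℝ, E) p) :
    TangentSpace 𝓘(ℝ, E) p :=
  K.inducedCov nabla (fun q ↦ K.phiM A q (Y q)) p v - K.phiM A p (K.inducedCov nabla Y p v)

/-- A nowhere zero section `E` of `Rad(TM)` over an open subset of `M`, with the section `N` of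
`ltr(M)` that corresponds to it. -/
structure NullPair where
  /-- the open set where the sections live -/
  dom : Set M
  isOpen_dom : IsOpen dom
  /-- the section of the radical distribution -/
  secE (p : M) : TangentSpace 𝓘(ℝ, E) p
  /-- the section of the transversal bundle -/
  secN (p : M) : TangentSpace 𝓘(ℝ, F) (L.map p)
  smooth_E : SmoothFieldOn secE dom
  smooth_N : ContMDiffOn 𝓘(ℝ, E) 𝓘(ℝ, F).tangent ∞
    (fun p ↦ (⟨L.map p, secN p⟩ : TangentBundle 𝓘(ℝ, F) Mb)) dom
  E_mem (p : M) (hp : p ∈ dom) : secE p ∈ L.rad p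
  E_ne_zero (p : M) (hp : p ∈ dom) : secE p ≠ 0
  inner_N_E (p : M) (hp : p ∈ dom) : g.inner (L.map p) (secN p) (L.di p (secE p)) = 1
  inner_N_N (p : M) (hp : p ∈ dom) : g.inner (L.map p) (secN p) (secN p) = 0
  inner_N_screen (p : M) (hp : p ∈ dom) (w : TangentSpace 𝓘(ℝ, E) p) (hw : w ∈ L.screen p) :
    g.inner (L.map p) (secN p) (L.di p w) = 0

/-- The vector field `U = -φN` on `M`. -/
def fieldU (P : K.NullPair) (p : M) : TangentSpace 𝓘(ℝ, E) p :=
  K.lift p (-A.phi (K.map p) (P.secN p))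

end LightlikeHypersurface

end Hypersurface

end

/-! For a pair (E, N) put B(X, Y) = g(∇̄_X Y, E), the local second fundamental form, so that the
Gauss formula reads ∇̄_X Y = ∇_X Y + B(X, Y) N. Each side of the equivalence says that B = 0 for
every pair of the family.

Geodesics. The ambient acceleration of a curve c in M is its induced acceleration plus B(c', c') N
(`covAlong_velocity_eq`), so B = 0 makes M totally geodesic. Conversely a geodesic of ∇ with initial
velocity v gives B(v, v) = 0. Since ∇̄ has no torsion, B is symmetric (`mapHessian_symm`), and
polarization gives B = 0. This direction needs geodesics of ∇ with prescribed velocity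
(`exists_geodesic`). The connection ∇ need not be metric, so its geodesic equation is read off from
the ambient one: the acceleration is split into tangential and transversal parts by inverting the
isomorphism (a, l) ↦ g(df(a) + l N, ·), which yields a smooth second-order equation in a chart.

Conditions. On an indefinite S-manifold the ambient tensor satisfies (∇̄_X φ̄)Y = g(φ̄X, φ̄Y) ξ̄ +
η̄(Y) φ̄²X (`covPhi_eq`). Projecting the derivatives of φ̄Y, for Y in D, and of U = -φ̄N to TM shows
that the two stated formulas always hold up to the error terms B(X, Y) φ̄N (`di_covPhiM`) and -B(X,
U) φ̄N (`di_shape`). As φ̄N never vanishes, condition 1 says that B(X, ·) vanishes on D and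
condition 2 that B(X, U) = 0. Since TM is spanned by D and U, together they say B = 0
(`conditions_iff_sff_eq_zero`).

The ambient formula is linear algebra in T = ∇̄φ̄. Skewness of φ̄, closedness of the fundamental
form and normality determine T(φ̄X, Y); the behaviour of ∇̄ξ_α forces T(ξ_α, ·) = 0; and X = -φ̄²X +
∑ η^α(X) ξ_α combines the two. -/

noncomputable section

set_option linter.unusedSectionVars false

/-! ### Coordinates of tangent vectors and of fields along maps in a fixed chart -/

section ChartCoordinates

variable {F : Type*} [NormedAddCommGroup F] [NormedSpace ℝ F]
  {Mb : Type*} [TopologicalSpace Mb] [ChartedSpace F Mb] [IsManifold 𝓘(ℝ, F) ∞ Mb]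
  {E : Type*} [NormedAddCommGroup E] [NormedSpace ℝ E]
  {P : Type*} [TopologicalSpace P] [ChartedSpace E P]

/-- The coordinates of a tangent vector at `x` in the chart at `x₀`. -/
def chartCoord (x₀ x : Mb) : TangentSpace 𝓘(ℝ, F) x →L[ℝ] F :=
  (trivializationAt F (TangentSpace 𝓘(ℝ, F) : Mb → Type _) x₀).continuousLinearMapAt ℝ x

/-- The tangent vector at `x` with given coordinates in the chart at `x₀`. -/
def chartVec (x₀ x : Mb) : F →L[ℝ] TangentSpace 𝓘(ℝ, F) x :=
  (trivializationAt F (TangentSpace 𝓘(ℝ, F) : Mb → Type _) x₀).symmL ℝ x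

/-- The vector field with constant coordinates `a` in the chart at `x₀`. -/
def chartFrame (x₀ : Mb) (a : F) (x : Mb) : TangentSpace 𝓘(ℝ, F) x := chartVec x₀ x a

lemma mem_baseSet_iff_mem_source {x₀ x : Mb} :
    x ∈ (trivializationAt F (TangentSpace 𝓘(ℝ, F) : Mb → Type _) x₀).baseSet ↔
      x ∈ (chartAt F x₀).source := by
  rw [TangentBundle.trivializationAt_baseSet]

lemma chartVec_chartCoord {x₀ x : Mb} (hx : x ∈ (chartAt F x₀).source)
    (v : TangentSpace 𝓘(ℝ, F) x) : chartVec x₀ x (chartCoord x₀ x v) = v :=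
  (trivializationAt F (TangentSpace 𝓘(ℝ, F) : Mb → Type _) x₀).symmL_continuousLinearMapAt
    (mem_baseSet_iff_mem_source.2 hx) v

lemma chartCoord_chartVec {x₀ x : Mb} (hx : x ∈ (chartAt F x₀).source) (a : F) :
    chartCoord x₀ x (chartVec x₀ x a) = a :=
  (trivializationAt F (TangentSpace 𝓘(ℝ, F) : Mb → Type _) x₀).continuousLinearMapAt_symmL
    (mem_baseSet_iff_mem_source.2 hx) a

lemma trivializationAt_snd_eq_chartCoord {x₀ x : Mb} (hx : x ∈ (chartAt F x₀).source)
    (v : TangentSpace 𝓘(ℝ, F) x) :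
    (trivializationAt F (TangentSpace 𝓘(ℝ, F) : Mb → Type _) x₀ ⟨x, v⟩).2 = chartCoord x₀ x v := by
  rw [chartCoord, Trivialization.continuousLinearMapAt_apply,
    Trivialization.coe_linearMapAt_of_mem _ (mem_baseSet_iff_mem_source.2 hx)]

lemma extend_apply_eq_chartFrame {x y : Mb} (hy : y ∈ (chartAt F x).source)
    (v : TangentSpace 𝓘(ℝ, F) x) :
    FiberBundle.extend F v y = chartFrame x (chartCoord x x v) y := by
  rw [FiberBundle.extend, trivializationAt_snd_eq_chartCoord (mem_chart_source F x)]
  exact (Trivialization.symmL_apply _ (mem_baseSet_iff_mem_source.2 hy) _).symm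

lemma chartFrame_self {x : Mb} (v : TangentSpace 𝓘(ℝ, F) x) :
    chartFrame x (chartCoord x x v) x = v := chartVec_chartCoord (mem_chart_source F x) v

lemma eventually_mem_source {x₀ x : Mb} (hx : x ∈ (chartAt F x₀).source) :
    ∀ᶠ y in 𝓝 x, y ∈ (chartAt F x₀).source := (chartAt F x₀).open_source.mem_nhds hx

/-- A vector field along `f`, as a map to the tangent bundle, is `C^n` if and only if `f` and its
coordinates are. -/
lemma contMDiffAt_along_iff {n : ℕ∞ω} [IsManifold 𝓘(ℝ, F) (n + 1) Mb] {f : P → Mb}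
    {V : Π q : P, TangentSpace 𝓘(ℝ, F) (f q)}
    {p : P} {x₀ : Mb} (hp : f p ∈ (chartAt F x₀).source) :
    ContMDiffAt 𝓘(ℝ, E) 𝓘(ℝ, F).tangent n (fun q ↦ (⟨f q, V q⟩ : TangentBundle 𝓘(ℝ, F) Mb)) p ↔
      ContMDiffAt 𝓘(ℝ, E) 𝓘(ℝ, F) n f p ∧
      ContMDiffAt 𝓘(ℝ, E) 𝓘(ℝ, F) n (fun q ↦ chartCoord x₀ (f q) (V q)) p := by
  have : ContMDiffVectorBundle n F (TangentSpace 𝓘(ℝ, F) : Mb → Type _) 𝓘(ℝ, F) :=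
    TangentBundle.contMDiffVectorBundle
  rw [show (𝓘(ℝ, F).tangent) = 𝓘(ℝ, F).prod 𝓘(ℝ, F) from rfl]
  rw [(trivializationAt F (TangentSpace 𝓘(ℝ, F) : Mb → Type _) x₀).contMDiffAt_iff
    (Trivialization.mem_source _ |>.2 (mem_baseSet_iff_mem_source.2 hp))]
  refine and_congr_right fun hf ↦ ?_
  refine Filter.EventuallyEq.contMDiffAt_iff ?_
  filter_upwards [hf.continuousAt (eventually_mem_source hp)] with q hq
  exact trivializationAt_snd_eq_chartCoord hq _

lemma mdifferentiableAt_along_iff {f : P → Mb} {V : Π q : P, TangentSpace 𝓘(ℝ, F) (f q)}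
    {p : P} {x₀ : Mb} (hp : f p ∈ (chartAt F x₀).source) :
    MDifferentiableAt 𝓘(ℝ, E) 𝓘(ℝ, F).tangent
        (fun q ↦ (⟨f q, V q⟩ : TangentBundle 𝓘(ℝ, F) Mb)) p ↔
      MDifferentiableAt 𝓘(ℝ, E) 𝓘(ℝ, F) f p ∧
      MDifferentiableAt 𝓘(ℝ, E) 𝓘(ℝ, F) (fun q ↦ chartCoord x₀ (f q) (V q)) p := by
  rw [show (𝓘(ℝ, F).tangent) = 𝓘(ℝ, F).prod 𝓘(ℝ, F) from rfl]
  rw [(trivializationAt F (TangentSpace 𝓘(ℝ, F) : Mb → Type _) x₀).mdifferentiableAt_totalSpace_iff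
    𝓘(ℝ, F) _ (Trivialization.mem_source _ |>.2 (mem_baseSet_iff_mem_source.2 hp))]
  refine and_congr_right fun hf ↦ ?_
  refine Filter.EventuallyEq.mdifferentiableAt_iff ?_
  filter_upwards [hf.continuousAt (eventually_mem_source hp)] with q hq
  exact trivializationAt_snd_eq_chartCoord hq _

lemma contMDiffAt_chartFrame {x₀ x : Mb} (hx : x ∈ (chartAt F x₀).source) (a : F) :
    ContMDiffAt 𝓘(ℝ, F) 𝓘(ℝ, F).tangent ∞
      (fun y ↦ (⟨y, chartFrame x₀ a y⟩ : TangentBundle 𝓘(ℝ, F) Mb)) x := by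
  have : IsManifold 𝓘(ℝ, F) (∞ + 1) Mb := ‹IsManifold 𝓘(ℝ, F) ∞ Mb›
  refine (contMDiffAt_along_iff (f := id) hx).2 ⟨contMDiffAt_id, ?_⟩
  refine (contMDiffAt_const (c := a)).congr_of_eventuallyEq ?_
  filter_upwards [eventually_mem_source hx] with y hy
  exact chartCoord_chartVec hy a

lemma diffFieldAt_chartFrame {x₀ x : Mb} (hx : x ∈ (chartAt F x₀).source) (a : F) :
    DiffFieldAt (chartFrame x₀ a) x :=
  (contMDiffAt_chartFrame hx a).mdifferentiableAt (by simp)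

lemma mvfderiv_eq_fderiv {G : Type*} [NormedAddCommGroup G] [NormedSpace ℝ G] {u : P → G} {p : P}
    (hu : MDifferentiableAt 𝓘(ℝ, E) 𝓘(ℝ, G) u p) (v : TangentSpace 𝓘(ℝ, E) p) :
    mvfderiv 𝓘(ℝ, E) u p v
      = fderiv ℝ (fun y ↦ u ((extChartAt 𝓘(ℝ, E) p).symm y)) (extChartAt 𝓘(ℝ, E) p p) v := by
  rw [hu.mvfderiv, ModelWithCorners.range_eq_univ, fderivWithin_univ]
  rfl

lemma MDifferentiableAt.differentiableAt_comp_chart {G : Type*} [NormedAddCommGroup G]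
    [NormedSpace ℝ G] {u : P → G} {p : P} (hu : MDifferentiableAt 𝓘(ℝ, E) 𝓘(ℝ, G) u p) :
    DifferentiableAt ℝ (fun y ↦ u ((extChartAt 𝓘(ℝ, E) p).symm y)) (extChartAt 𝓘(ℝ, E) p p) := by
  have := hu.differentiableWithinAt_writtenInExtChartAt
  rw [ModelWithCorners.range_eq_univ, differentiableWithinAt_univ] at this
  exact this

lemma mvfderiv_clm_apply {G H : Type*} [NormedAddCommGroup G] [NormedSpace ℝ G]
    [NormedAddCommGroup H] [NormedSpace ℝ H] {A : P → G →L[ℝ] H} {u : P → G} {p : P}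
    (hA : MDifferentiableAt 𝓘(ℝ, E) 𝓘(ℝ, G →L[ℝ] H) A p)
    (hu : MDifferentiableAt 𝓘(ℝ, E) 𝓘(ℝ, G) u p) (v : TangentSpace 𝓘(ℝ, E) p) :
    mvfderiv 𝓘(ℝ, E) (fun q ↦ A q (u q)) p v
      = mvfderiv 𝓘(ℝ, E) A p v (u p) + A p (mvfderiv 𝓘(ℝ, E) u p v) := by
  rw [mvfderiv_eq_fderiv (hA.clm_apply hu), mvfderiv_eq_fderiv hA, mvfderiv_eq_fderiv hu,
    fderiv_clm_apply hA.differentiableAt_comp_chart hu.differentiableAt_comp_chart]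
  simp only [extChartAt_to_inv]
  exact add_comm ((A p) (fderiv ℝ _ _ v)) _

/-- A basis of the finite-dimensional space `G` identifies `G →L[ℝ] H` with a finite power of `H`,
whose components are evaluations at the basis vectors. It is used for Gram forms, transition maps
and differentials, whose smoothness is known one frame vector at a time. -/
lemma contMDiffAt_clm_of_apply {G H : Type*} [NormedAddCommGroup G] [NormedSpace ℝ G]
    [FiniteDimensional ℝ G] [NormedAddCommGroup H] [NormedSpace ℝ H] {n : ℕ∞ω}
    {A : P → G →L[ℝ] H} {p : P}
    (h : ∀ a, ContMDiffAt 𝓘(ℝ, E) 𝓘(ℝ, H) n (fun q ↦ A q a) p) :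
    ContMDiffAt 𝓘(ℝ, E) 𝓘(ℝ, G →L[ℝ] H) n A p := by
  let d := Module.finrank ℝ G
  have hd : d = Module.finrank ℝ (Fin d → ℝ) := (Module.finrank_fin_fun ℝ).symm
  let e₁ := ContinuousLinearEquiv.ofFinrankEq hd
  let e₂ := (e₁.arrowCongr (1 : H ≃L[ℝ] H)).trans (ContinuousLinearEquiv.piRing (Fin d))
  have h2 : ContMDiffAt 𝓘(ℝ, E) 𝓘(ℝ, Fin d → H) n (fun q ↦ e₂ (A q)) p :=
    contMDiffAt_pi_space.2 fun i ↦ h _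
  have := e₂.symm.contDiff.contMDiff.contMDiffAt.comp p h2
  simpa [Function.comp_def] using this

lemma mvfderiv_fun_comp_apply {f : P → Mb} {G : Type*} [NormedAddCommGroup G] [NormedSpace ℝ G]
    {u : Mb → G} {p : P} (hu : MDifferentiableAt 𝓘(ℝ, F) 𝓘(ℝ, G) u (f p))
    (hf : MDifferentiableAt 𝓘(ℝ, E) 𝓘(ℝ, F) f p) (v : TangentSpace 𝓘(ℝ, E) p) :
    mvfderiv 𝓘(ℝ, E) (fun q ↦ u (f q)) p v
      = mvfderiv 𝓘(ℝ, F) u (f p) (mfderiv 𝓘(ℝ, E) 𝓘(ℝ, F) f p v) :=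
  mfderiv_comp_apply p hu hf v

lemma Filter.EventuallyEq.mvfderiv_apply_eq {G : Type*} [NormedAddCommGroup G] [NormedSpace ℝ G]
    {u w : P → G} {p : P} (h : u =ᶠ[𝓝 p] w) (v : TangentSpace 𝓘(ℝ, E) p) :
    mvfderiv 𝓘(ℝ, E) u p v = mvfderiv 𝓘(ℝ, E) w p v := by
  have h2 := h.mfderiv_eq (I := 𝓘(ℝ, E)) (I' := 𝓘(ℝ, G))
  exact congrArg (fun L : E →L[ℝ] G ↦ L v) h2

end ChartCoordinates

/-! ### Covariant derivatives in coordinates -/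

section CovariantDerivativeCoordinates

variable {F : Type*} [NormedAddCommGroup F] [NormedSpace ℝ F] [FiniteDimensional ℝ F]
  {Mb : Type*} [TopologicalSpace Mb] [ChartedSpace F Mb] [IsManifold 𝓘(ℝ, F) ∞ Mb]
  {E : Type*} [NormedAddCommGroup E] [NormedSpace ℝ E]
  {P : Type*} [TopologicalSpace P] [ChartedSpace E P]
  (nabla : CovariantDerivative 𝓘(ℝ, F) F (TangentSpace 𝓘(ℝ, F) : Mb → Type _))

/-- `V` is a vector field along `f`, differentiable at `p`. -/
def DiffAlongAt (f : P → Mb) (V : Π q : P, TangentSpace 𝓘(ℝ, F) (f q)) (p : P) : Prop :=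
  MDifferentiableAt 𝓘(ℝ, E) 𝓘(ℝ, F).tangent (fun q ↦ (⟨f q, V q⟩ : TangentBundle 𝓘(ℝ, F) Mb)) p

lemma diffAlongAt_iff {f : P → Mb} {V : Π q : P, TangentSpace 𝓘(ℝ, F) (f q)} {p : P} {x₀ : Mb}
    (hp : f p ∈ (chartAt F x₀).source) :
    DiffAlongAt (E := E) f V p ↔ MDifferentiableAt 𝓘(ℝ, E) 𝓘(ℝ, F) f p ∧
      MDifferentiableAt 𝓘(ℝ, E) 𝓘(ℝ, F) (fun q ↦ chartCoord x₀ (f q) (V q)) p :=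
  mdifferentiableAt_along_iff hp

lemma DiffFieldAt.mdifferentiableAt_chartCoord {Y : Π x : Mb, TangentSpace 𝓘(ℝ, F) x} {x₀ x : Mb}
    (hx : x ∈ (chartAt F x₀).source) (hY : DiffFieldAt Y x) :
    MDifferentiableAt 𝓘(ℝ, F) 𝓘(ℝ, F) (fun y ↦ chartCoord x₀ y (Y y)) x :=
  ((mdifferentiableAt_along_iff (f := id) hx).1 hY).2

lemma mvfderiv_chartCoord_chartFrame {x₀ x : Mb} (hx : x ∈ (chartAt F x₀).source) (a : F)
    (w : TangentSpace 𝓘(ℝ, F) x) :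
    mvfderiv 𝓘(ℝ, F) (fun y ↦ chartCoord x₀ y (chartFrame x₀ a y)) x w = 0 := by
  have h : (fun y ↦ chartCoord x₀ y (chartFrame x₀ a y)) =ᶠ[𝓝 x] fun _ ↦ a := by
    filter_upwards [eventually_mem_source hx] with y hy
    exact chartCoord_chartVec hy a
  rw [h.mvfderiv_apply_eq, mvfderiv_const]; rfl

/-- The difference between `nabla` and the flat connection of the chart is tensorial, so it may be
evaluated on the frame field with constant coordinates and the same value at `x`, for which the flat
derivative is zero. -/
lemma CovariantDerivative.apply_eq_chart {x₀ x : Mb} (hx : x ∈ (chartAt F x₀).source)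
    {Y : Π x : Mb, TangentSpace 𝓘(ℝ, F) x} (hY : DiffFieldAt Y x) (w : TangentSpace 𝓘(ℝ, F) x) :
    nabla Y x w = chartVec x₀ x (mvfderiv 𝓘(ℝ, F) (fun y ↦ chartCoord x₀ y (Y y)) x w)
      + nabla (chartFrame x₀ (chartCoord x₀ x (Y x))) x w := by
  have hT : TensorialAt 𝓘(ℝ, F) F (fun σ : Π x : Mb, TangentSpace 𝓘(ℝ, F) x ↦ nabla σ x w
      - chartVec x₀ x (mvfderiv 𝓘(ℝ, F) (fun y ↦ chartCoord x₀ y (σ y)) x w)) x := by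
    constructor
    · intro f σ hf hσ
      have h2 := DiffFieldAt.mdifferentiableAt_chartCoord hx hσ
      have h3 : (fun y ↦ chartCoord x₀ y ((f • σ) y))
          = f • (fun y ↦ chartCoord x₀ y (σ y)) := by
        funext y; simp
      simp only [h3]
      rw [nabla.isCovariantDerivativeOnUniv.leibniz hσ hf, mvfderiv_smul hf h2]
      simp [chartVec_chartCoord hx, smul_sub]
    · intro σ τ hσ hτ
      have h2 := DiffFieldAt.mdifferentiableAt_chartCoord hx hσ
      have h2' := DiffFieldAt.mdifferentiableAt_chartCoord hx hτ
      have h3 : (fun y ↦ chartCoord x₀ y ((σ + τ) y))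
          = (fun y ↦ chartCoord x₀ y (σ y)) + (fun y ↦ chartCoord x₀ y (τ y)) := by
        funext y; simp
      simp only [h3]
      rw [nabla.isCovariantDerivativeOnUniv.add hσ hτ, mvfderiv_add h2 h2']
      simp only [add_apply, map_add]
      abel
  have h := hT.pointwise hY (diffFieldAt_chartFrame hx (chartCoord x₀ x (Y x)))
    (chartVec_chartCoord hx (Y x)).symm
  simp only [mvfderiv_chartCoord_chartFrame hx, map_zero, sub_zero] at h
  rw [← h]; abel

lemma covAlong_eq {cov : (Π x : Mb, TangentSpace 𝓘(ℝ, F) x) →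
      Π x : Mb, TangentSpace 𝓘(ℝ, F) x → TangentSpace 𝓘(ℝ, F) x}
    {f : P → Mb} (V : Π q : P, TangentSpace 𝓘(ℝ, F) (f q)) {p : P} (hf : ContinuousAt f p)
    (v : TangentSpace 𝓘(ℝ, E) p) :
    covAlong cov f V p v
      = chartVec (f p) (f p) (mvfderiv 𝓘(ℝ, E) (fun q ↦ chartCoord (f p) (f q) (V q)) p v)
        + cov (FiberBundle.extend F (V p)) (f p) (mfderiv 𝓘(ℝ, E) 𝓘(ℝ, F) f p v) := by
  have h : (fun q ↦ (trivializationAt F (TangentSpace 𝓘(ℝ, F) : Mb → Type _) (f p)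
      ⟨f q, V q⟩).2) =ᶠ[𝓝 p] fun q ↦ chartCoord (f p) (f q) (V q) := by
    filter_upwards [hf (eventually_mem_source (mem_chart_source F (f p)))] with q hq
    exact trivializationAt_snd_eq_chartCoord hq _
  rw [covAlong, h.mvfderiv_apply_eq, chartVec, Trivialization.symmL_apply]
  exact mem_baseSet_iff_mem_source.2 (mem_chart_source F (f p))

lemma CovariantDerivative.extend_apply {x : Mb} (y w : TangentSpace 𝓘(ℝ, F) x) :
    nabla (FiberBundle.extend F y) x w = nabla (chartFrame x (chartCoord x x y)) x w := by
  have h := nabla.apply_eq_chart (mem_chart_source F x) (Y := FiberBundle.extend F y)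
    (FiberBundle.mdifferentiableAt_extend 𝓘(ℝ, F) F y) w
  have h2 : (fun z ↦ chartCoord x z (FiberBundle.extend F y z)) =ᶠ[𝓝 x]
      fun z ↦ chartCoord x z (chartFrame x (chartCoord x x y) z) := by
    filter_upwards [eventually_mem_source (mem_chart_source F x)] with z hz
    rw [extend_apply_eq_chartFrame hz]
  rw [h2.mvfderiv_apply_eq, mvfderiv_chartCoord_chartFrame (mem_chart_source F x)] at h
  simpa using h

lemma mdifferentiableAt_chartCoord_chartVec {x₀ x₁ x : Mb} (h₀ : x ∈ (chartAt F x₀).source)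
    (h₁ : x ∈ (chartAt F x₁).source) :
    MDifferentiableAt 𝓘(ℝ, F) 𝓘(ℝ, F →L[ℝ] F)
      (fun y ↦ ((chartCoord x₀ y).comp (chartVec x₁ y) : F →L[ℝ] F)) x := by
  refine (contMDiffAt_clm_of_apply (n := 1) fun a ↦ ?_).mdifferentiableAt one_ne_zero
  have : IsManifold 𝓘(ℝ, F) (1 + 1) Mb := by
    rw [one_add_one_eq_two]; infer_instance
  exact ((contMDiffAt_along_iff (f := id) h₀).1
    ((contMDiffAt_chartFrame h₁ a).of_le (by exact_mod_cast le_top))).2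

/-- Independence of the chart: `covAlong` is defined with the chart at `f p`, but any chart around
`f p` gives the same vector. The derivative of the transition matrix appears once in the product
rule for the new components (`e1`) and once in the connection applied to the old frame (`e2`), and
the two contributions agree. -/
lemma covAlong_eq_chart {x₀ : Mb} {f : P → Mb} {V : Π q : P, TangentSpace 𝓘(ℝ, F) (f q)} {p : P}
    (hp : f p ∈ (chartAt F x₀).source) (hV : DiffAlongAt (E := E) f V p)
    (v : TangentSpace 𝓘(ℝ, E) p) :
    covAlong (fun Y x w ↦ nabla Y x w) f V p v
      = chartVec x₀ (f p) (mvfderiv 𝓘(ℝ, E) (fun q ↦ chartCoord x₀ (f q) (V q)) p v)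
        + nabla (chartFrame x₀ (chartCoord x₀ (f p) (V p))) (f p)
          (mfderiv 𝓘(ℝ, E) 𝓘(ℝ, F) f p v) := by
  have h1 := mem_chart_source F (f p)
  obtain ⟨hf, hV'⟩ := (diffAlongAt_iff h1).1 hV
  have hC := mdifferentiableAt_chartCoord_chartVec hp h1
  rw [covAlong_eq V hf.continuousAt, nabla.extend_apply,
    nabla.apply_eq_chart hp (diffFieldAt_chartFrame h1 _), chartFrame_self]
  have e1 : (fun q ↦ chartCoord x₀ (f q) (V q)) =ᶠ[𝓝 p] fun q ↦
      ((chartCoord x₀ (f q)).comp (chartVec (f p) (f q)) : F →L[ℝ] F) (chartCoord (f p) (f q) (V q)) := by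
    filter_upwards [hf.continuousAt (eventually_mem_source h1)] with q hq
    simp [chartVec_chartCoord hq]
  rw [e1.mvfderiv_apply_eq, mvfderiv_clm_apply (A := fun q ↦
    ((chartCoord x₀ (f q)).comp (chartVec (f p) (f q)) : F →L[ℝ] F)) (hC.comp p hf) hV',
    mvfderiv_fun_comp_apply hC hf]
  have e2 : mvfderiv 𝓘(ℝ, F) (fun y ↦ chartCoord x₀ y (chartFrame (f p)
      (chartCoord (f p) (f p) (V p)) y)) (f p) (mfderiv 𝓘(ℝ, E) 𝓘(ℝ, F) f p v) =
      mvfderiv 𝓘(ℝ, F) (fun y ↦ ((chartCoord x₀ y).comp (chartVec (f p) y) : F →L[ℝ] F)) (f p)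
        (mfderiv 𝓘(ℝ, E) 𝓘(ℝ, F) f p v) (chartCoord (f p) (f p) (V p)) := by
    have := mvfderiv_clm_apply hC (mdifferentiableAt_const (c := chartCoord (f p) (f p) (V p)))
      (mfderiv 𝓘(ℝ, E) 𝓘(ℝ, F) f p v)
    rw [mvfderiv_const] at this
    simpa [chartFrame] using this
  rw [e2]
  simp only [map_add, ContinuousLinearMap.comp_apply, chartVec_chartCoord hp]
  abel

lemma covAlong_congr {cov : (Π x : Mb, TangentSpace 𝓘(ℝ, F) x) →
      Π x : Mb, TangentSpace 𝓘(ℝ, F) x → TangentSpace 𝓘(ℝ, F) x}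
    {f : P → Mb} {V W : Π q : P, TangentSpace 𝓘(ℝ, F) (f q)} {p : P}
    (h : ∀ᶠ q in 𝓝 p, V q = W q) (v : TangentSpace 𝓘(ℝ, E) p) :
    covAlong cov f V p v = covAlong cov f W p v := by
  have h2 : (fun q ↦ (trivializationAt F (TangentSpace 𝓘(ℝ, F) : Mb → Type _) (f p)
      ⟨f q, V q⟩).2) =ᶠ[𝓝 p] fun q ↦ (trivializationAt F (TangentSpace 𝓘(ℝ, F) : Mb → Type _) (f p)
      ⟨f q, W q⟩).2 := by
    filter_upwards [h] with q hq; rw [hq]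
  rw [covAlong, covAlong, h2.mvfderiv_apply_eq, h.self_of_nhds]

lemma covAlong_comp_field {f : P → Mb} {Y : Π x : Mb, TangentSpace 𝓘(ℝ, F) x} {p : P}
    (hf : MDifferentiableAt 𝓘(ℝ, E) 𝓘(ℝ, F) f p) (hY : DiffFieldAt Y (f p))
    (v : TangentSpace 𝓘(ℝ, E) p) :
    covAlong (fun Y x w ↦ nabla Y x w) f (fun q ↦ Y (f q)) p v
      = nabla Y (f p) (mfderiv 𝓘(ℝ, E) 𝓘(ℝ, F) f p v) := by
  have h1 := mem_chart_source F (f p)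
  rw [covAlong_eq _ hf.continuousAt, nabla.apply_eq_chart h1 hY, nabla.extend_apply,
    mvfderiv_fun_comp_apply (hY.mdifferentiableAt_chartCoord h1) hf]

end CovariantDerivativeCoordinates

/-! ### Derivatives of the metric and of endomorphism fields along maps -/

section TensorsAlong

variable {F : Type*} [NormedAddCommGroup F] [NormedSpace ℝ F] [FiniteDimensional ℝ F]
  {Mb : Type*} [TopologicalSpace Mb] [ChartedSpace F Mb] [IsManifold 𝓘(ℝ, F) ∞ Mb]
  {E : Type*} [NormedAddCommGroup E] [NormedSpace ℝ E]
  {P : Type*} [TopologicalSpace P] [ChartedSpace E P]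
  (nabla : CovariantDerivative 𝓘(ℝ, F) F (TangentSpace 𝓘(ℝ, F) : Mb → Type _))
  (g : SemiRiemannianMetric F Mb)

/-- The Gram form of the metric in the chart at `x₀`. -/
def SemiRiemannianMetric.gram (x₀ x : Mb) : F →L[ℝ] F →L[ℝ] ℝ :=
  (ContinuousLinearMap.precomp ℝ (chartVec x₀ x)).comp ((g.inner x).comp (chartVec x₀ x))

lemma SemiRiemannianMetric.gram_apply (x₀ x : Mb) (a b : F) :
    g.gram x₀ x a b = g.inner x (chartVec x₀ x a) (chartVec x₀ x b) := rfl

lemma SemiRiemannianMetric.gram_chartCoord {x₀ x : Mb} (hx : x ∈ (chartAt F x₀).source)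
    (v w : TangentSpace 𝓘(ℝ, F) x) :
    g.gram x₀ x (chartCoord x₀ x v) (chartCoord x₀ x w) = g.inner x v w := by
  rw [g.gram_apply, chartVec_chartCoord hx, chartVec_chartCoord hx]

lemma SemiRiemannianMetric.contMDiffAt_inner {f : P → Mb}
    {V W : Π q : P, TangentSpace 𝓘(ℝ, F) (f q)} {p : P}
    (hV : ContMDiffAt 𝓘(ℝ, E) 𝓘(ℝ, F).tangent ∞
      (fun q ↦ (⟨f q, V q⟩ : TangentBundle 𝓘(ℝ, F) Mb)) p)
    (hW : ContMDiffAt 𝓘(ℝ, E) 𝓘(ℝ, F).tangent ∞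
      (fun q ↦ (⟨f q, W q⟩ : TangentBundle 𝓘(ℝ, F) Mb)) p) :
    ContMDiffAt 𝓘(ℝ, E) 𝓘(ℝ, ℝ) ∞ (fun q ↦ g.inner (f q) (V q) (W q)) p := by
  have hf := (contMDiffAt_totalSpace.1 hV).1
  have h := ContMDiffAt.clm_bundle_apply₂ (F₁ := F) (F₂ := F) (F₃ := ℝ)
    (E₁ := (TangentSpace 𝓘(ℝ, F) : Mb → Type _)) (E₂ := (TangentSpace 𝓘(ℝ, F) : Mb → Type _))
    (E₃ := Bundle.Trivial Mb ℝ) (b := f) (ψ := fun q ↦ g.inner (f q))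
    (g.contMDiff.contMDiffAt.comp p hf) hV hW
  exact (contMDiffAt_totalSpace.1 h).2

lemma SemiRiemannianMetric.contMDiffAt_gram {x₀ x : Mb} (hx : x ∈ (chartAt F x₀).source) :
    ContMDiffAt 𝓘(ℝ, F) 𝓘(ℝ, F →L[ℝ] F →L[ℝ] ℝ) ∞ (g.gram x₀) x :=
  contMDiffAt_clm_of_apply fun a ↦ contMDiffAt_clm_of_apply fun b ↦
    g.contMDiffAt_inner (f := fun y ↦ y) (contMDiffAt_chartFrame hx a) (contMDiffAt_chartFrame hx b)

lemma SemiRiemannianMetric.mdifferentiableAt_inner {f : P → Mb}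
    {V W : Π q : P, TangentSpace 𝓘(ℝ, F) (f q)} {p : P}
    (hV : DiffAlongAt (E := E) f V p) (hW : DiffAlongAt (E := E) f W p) :
    MDifferentiableAt 𝓘(ℝ, E) 𝓘(ℝ, ℝ) (fun q ↦ g.inner (f q) (V q) (W q)) p := by
  have h1 := mem_chart_source F (f p)
  obtain ⟨hf, hV'⟩ := (diffAlongAt_iff h1).1 hV
  obtain ⟨-, hW'⟩ := (diffAlongAt_iff h1).1 hW
  have hG := ((g.contMDiffAt_gram h1).mdifferentiableAt (by simp)).comp p hf
  refine ((hG.clm_apply hV').clm_apply hW').congr_of_eventuallyEq ?_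
  filter_upwards [hf.continuousAt (eventually_mem_source h1)] with q hq
  exact (g.gram_chartCoord hq _ _).symm

lemma SemiRiemannianMetric.mvfderiv_inner_chart {f : P → Mb}
    {V W : Π q : P, TangentSpace 𝓘(ℝ, F) (f q)} {p : P}
    (hV : DiffAlongAt (E := E) f V p) (hW : DiffAlongAt (E := E) f W p)
    (v : TangentSpace 𝓘(ℝ, E) p) :
    mvfderiv 𝓘(ℝ, E) (fun q ↦ g.inner (f q) (V q) (W q)) p v
      = mvfderiv 𝓘(ℝ, F) (g.gram (f p)) (f p) (mfderiv 𝓘(ℝ, E) 𝓘(ℝ, F) f p v)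
          (chartCoord (f p) (f p) (V p)) (chartCoord (f p) (f p) (W p))
        + g.gram (f p) (f p) (mvfderiv 𝓘(ℝ, E) (fun q ↦ chartCoord (f p) (f q) (V q)) p v)
          (chartCoord (f p) (f p) (W p))
        + g.gram (f p) (f p) (chartCoord (f p) (f p) (V p))
          (mvfderiv 𝓘(ℝ, E) (fun q ↦ chartCoord (f p) (f q) (W q)) p v) := by
  have h1 := mem_chart_source F (f p)
  obtain ⟨hf, hV'⟩ := (diffAlongAt_iff h1).1 hV
  obtain ⟨-, hW'⟩ := (diffAlongAt_iff h1).1 hW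
  have hG := ((g.contMDiffAt_gram h1).mdifferentiableAt (by simp))
  have e : (fun q ↦ g.inner (f q) (V q) (W q)) =ᶠ[𝓝 p] fun q ↦
      (g.gram (f p) (f q)) (chartCoord (f p) (f q) (V q)) (chartCoord (f p) (f q) (W q)) := by
    filter_upwards [hf.continuousAt (eventually_mem_source h1)] with q hq
    exact (g.gram_chartCoord hq _ _).symm
  have hG' := hG.comp p hf
  rw [e.mvfderiv_apply_eq, mvfderiv_clm_apply (A := fun q ↦
      (g.gram (f p) (f q)) (chartCoord (f p) (f q) (V q))) (hG'.clm_apply hV') hW',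
    mvfderiv_clm_apply (A := fun q ↦ g.gram (f p) (f q)) hG' hV', mvfderiv_fun_comp_apply hG hf]
  simp

variable {nabla g}

/-- The derivative of the Gram form in the direction `df(v)` is known from metric compatibility on
chart frames with the values of `V` and `W` frozen at `p`. The remaining terms of the product rule
differentiate the components, and these are the flat parts of the two covariant derivatives. -/
lemma IsLeviCivita.mvfderiv_inner_along (h : IsLeviCivita g nabla) {f : P → Mb}
    {V W : Π q : P, TangentSpace 𝓘(ℝ, F) (f q)} {p : P}
    (hV : DiffAlongAt (E := E) f V p) (hW : DiffAlongAt (E := E) f W p)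
    (v : TangentSpace 𝓘(ℝ, E) p) :
    mvfderiv 𝓘(ℝ, E) (fun q ↦ g.inner (f q) (V q) (W q)) p v
      = g.inner (f p) (covAlong (fun Y x w ↦ nabla Y x w) f V p v) (W p)
        + g.inner (f p) (V p) (covAlong (fun Y x w ↦ nabla Y x w) f W p v) := by
  have h1 := mem_chart_source F (f p)
  have hv := diffFieldAt_chartFrame h1 (chartCoord (f p) (f p) (V p))
  have hw := diffFieldAt_chartFrame h1 (chartCoord (f p) (f p) (W p))
  have h2 := h.2 (f p) (mfderiv 𝓘(ℝ, E) 𝓘(ℝ, F) f p v) _ _ hv hw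
  rw [g.mvfderiv_inner_chart (f := fun y ↦ y) hv hw] at h2
  simp only [mvfderiv_chartCoord_chartFrame h1, chartFrame_self, map_zero, zero_apply,
    add_zero] at h2
  have h3 : mfderiv 𝓘(ℝ, F) 𝓘(ℝ, F) (fun y : Mb ↦ y) (f p) = ContinuousLinearMap.id ℝ _ :=
    mfderiv_id
  rw [h3] at h2
  rw [g.mvfderiv_inner_chart hV hW, covAlong_eq_chart nabla h1 hV, covAlong_eq_chart nabla h1 hW]
  simp only [g.gram_apply, chartVec_chartCoord h1, map_add, add_apply]
  rw [ContinuousLinearMap.id_apply] at h2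
  rw [h2]
  ring

/-- `∇_w (T Y) - T (∇_w Y)` at `x`, for a field `T` of endomorphisms and `Y x = y`. -/
def covEndo (nabla : CovariantDerivative 𝓘(ℝ, F) F (TangentSpace 𝓘(ℝ, F) : Mb → Type _))
    (T : Π x : Mb, TangentSpace 𝓘(ℝ, F) x →L[ℝ] TangentSpace 𝓘(ℝ, F) x) (x : Mb)
    (w y : TangentSpace 𝓘(ℝ, F) x) : TangentSpace 𝓘(ℝ, F) x :=
  nabla (fun z ↦ T z (chartFrame x (chartCoord x x y) z)) x w
    - T x (nabla (chartFrame x (chartCoord x x y)) x w)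

lemma contMDiffAt_endo_along {T : Π x : Mb, TangentSpace 𝓘(ℝ, F) x →L[ℝ] TangentSpace 𝓘(ℝ, F) x}
    (hT : ContMDiff 𝓘(ℝ, F) (𝓘(ℝ, F).prod 𝓘(ℝ, F →L[ℝ] F)) ∞
      (fun x ↦ TotalSpace.mk' (F →L[ℝ] F)
        (E := fun x : Mb ↦ TangentSpace 𝓘(ℝ, F) x →L[ℝ] TangentSpace 𝓘(ℝ, F) x) x (T x)))
    {f : P → Mb} {V : Π q : P, TangentSpace 𝓘(ℝ, F) (f q)} {p : P}
    (hV : ContMDiffAt 𝓘(ℝ, E) 𝓘(ℝ, F).tangent ∞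
      (fun q ↦ (⟨f q, V q⟩ : TangentBundle 𝓘(ℝ, F) Mb)) p) :
    ContMDiffAt 𝓘(ℝ, E) 𝓘(ℝ, F).tangent ∞
      (fun q ↦ (⟨f q, T (f q) (V q)⟩ : TangentBundle 𝓘(ℝ, F) Mb)) p := by
  have hf := (contMDiffAt_totalSpace.1 hV).1
  exact ContMDiffAt.clm_bundle_apply (F₁ := F) (F₂ := F)
    (E₁ := (TangentSpace 𝓘(ℝ, F) : Mb → Type _)) (E₂ := (TangentSpace 𝓘(ℝ, F) : Mb → Type _))
    (b := f) (ϕ := fun q ↦ T (f q)) (hT.contMDiffAt.comp p hf) hV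

section

variable {T : Π x : Mb, TangentSpace 𝓘(ℝ, F) x →L[ℝ] TangentSpace 𝓘(ℝ, F) x}
    (hT : ContMDiff 𝓘(ℝ, F) (𝓘(ℝ, F).prod 𝓘(ℝ, F →L[ℝ] F)) ∞
      (fun x ↦ TotalSpace.mk' (F →L[ℝ] F)
        (E := fun x : Mb ↦ TangentSpace 𝓘(ℝ, F) x →L[ℝ] TangentSpace 𝓘(ℝ, F) x) x (T x)))
include hT

lemma mdifferentiableAt_endo_chart (x : Mb) :
    MDifferentiableAt 𝓘(ℝ, F) 𝓘(ℝ, F →L[ℝ] F)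
      (fun y ↦ ((chartCoord x y).comp ((T y).comp (chartVec x y)) : F →L[ℝ] F)) x := by
  refine (contMDiffAt_clm_of_apply (n := ∞) fun a ↦ ?_).mdifferentiableAt (by simp)
  have h1 := mem_chart_source F x
  have : IsManifold 𝓘(ℝ, F) (∞ + 1) Mb := ‹IsManifold 𝓘(ℝ, F) ∞ Mb›
  exact ((contMDiffAt_along_iff (f := fun y ↦ y) h1).1
    (contMDiffAt_endo_along (f := fun y ↦ y) hT (contMDiffAt_chartFrame h1 a))).2

lemma eventually_chartCoord_endo {f : P → Mb} (V : Π q : P, TangentSpace 𝓘(ℝ, F) (f q)) {p : P}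
    (hf : ContinuousAt f p) :
    (fun q ↦ chartCoord (f p) (f q) (T (f q) (V q))) =ᶠ[𝓝 p] fun q ↦
      ((chartCoord (f p) (f q)).comp ((T (f q)).comp (chartVec (f p) (f q))) : F →L[ℝ] F)
        (chartCoord (f p) (f q) (V q)) := by
  filter_upwards [hf (eventually_mem_source (mem_chart_source F (f p)))] with q hq
  simp [chartVec_chartCoord hq]

lemma diffAlongAt_endo {f : P → Mb} {V : Π q : P, TangentSpace 𝓘(ℝ, F) (f q)} {p : P}
    (hV : DiffAlongAt (E := E) f V p) :
    DiffAlongAt (E := E) f (fun q ↦ T (f q) (V q)) p := by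
  have h1 := mem_chart_source F (f p)
  obtain ⟨hf, hV'⟩ := (diffAlongAt_iff h1).1 hV
  refine (diffAlongAt_iff h1).2 ⟨hf, ?_⟩
  exact (((mdifferentiableAt_endo_chart hT (f p)).comp p hf).clm_apply hV').congr_of_eventuallyEq
    (eventually_chartCoord_endo hT V hf.continuousAt)

lemma mvfderiv_endo_chart {f : P → Mb} {V : Π q : P, TangentSpace 𝓘(ℝ, F) (f q)} {p : P}
    (hV : DiffAlongAt (E := E) f V p) (v : TangentSpace 𝓘(ℝ, E) p) :
    mvfderiv 𝓘(ℝ, E) (fun q ↦ chartCoord (f p) (f q) (T (f q) (V q))) p v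
      = mvfderiv 𝓘(ℝ, F) (fun y ↦ ((chartCoord (f p) y).comp ((T y).comp (chartVec (f p) y)) :
            F →L[ℝ] F)) (f p) (mfderiv 𝓘(ℝ, E) 𝓘(ℝ, F) f p v) (chartCoord (f p) (f p) (V p))
        + chartCoord (f p) (f p) (T (f p) (chartVec (f p) (f p)
            (mvfderiv 𝓘(ℝ, E) (fun q ↦ chartCoord (f p) (f q) (V q)) p v))) := by
  have h1 := mem_chart_source F (f p)
  obtain ⟨hf, hV'⟩ := (diffAlongAt_iff h1).1 hV
  have hA := mdifferentiableAt_endo_chart hT (f p)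
  rw [(eventually_chartCoord_endo hT V hf.continuousAt).mvfderiv_apply_eq,
    mvfderiv_clm_apply (A := fun q ↦ ((chartCoord (f p) (f q)).comp ((T (f q)).comp
      (chartVec (f p) (f q))) : F →L[ℝ] F)) (hA.comp p hf) hV', mvfderiv_fun_comp_apply hA hf]
  rfl

/-- In the chart at `f p` the derivative of the matrix of `T` occurs on both sides, and the
derivative of the components of `V` reappears under `T`. So the failure of `T` to commute with the
derivative depends only on the value of `V` at `p`, which justifies defining `covEndo` by a chart
frame. -/
lemma covAlong_endo {f : P → Mb} {V : Π q : P, TangentSpace 𝓘(ℝ, F) (f q)} {p : P}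
    (hV : DiffAlongAt (E := E) f V p) (v : TangentSpace 𝓘(ℝ, E) p) :
    covAlong (fun Y x w ↦ nabla Y x w) f (fun q ↦ T (f q) (V q)) p v
      = covEndo nabla T (f p) (mfderiv 𝓘(ℝ, E) 𝓘(ℝ, F) f p v) (V p)
        + T (f p) (covAlong (fun Y x w ↦ nabla Y x w) f V p v) := by
  have h1 := mem_chart_source F (f p)
  have hv := diffFieldAt_chartFrame h1 (chartCoord (f p) (f p) (V p))
  rw [covEndo, nabla.apply_eq_chart h1 (Y := fun z ↦ T z (chartFrame (f p)
      (chartCoord (f p) (f p) (V p)) z)) (diffAlongAt_endo (f := fun y ↦ y) hT hv),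
    mvfderiv_endo_chart (f := fun y ↦ y) hT hv, covAlong_eq_chart nabla h1 hV,
    covAlong_eq_chart nabla h1 (diffAlongAt_endo hT hV), mvfderiv_endo_chart hT hV]
  have h3 : mfderiv 𝓘(ℝ, F) 𝓘(ℝ, F) (fun y : Mb ↦ y) (f p) = ContinuousLinearMap.id ℝ _ :=
    mfderiv_id
  simp only [mvfderiv_chartCoord_chartFrame h1, chartFrame_self, map_zero, h3,
    ContinuousLinearMap.id_apply, map_add, add_zero, chartVec_chartCoord h1]
  abel

lemma CovariantDerivative.endo_apply {x : Mb} {Y : Π x : Mb, TangentSpace 𝓘(ℝ, F) x}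
    (hY : DiffFieldAt Y x) (w : TangentSpace 𝓘(ℝ, F) x) :
    nabla (fun z ↦ T z (Y z)) x w = covEndo nabla T x w (Y x) + T x (nabla Y x w) := by
  have h1 := mem_chart_source F x
  have h := covAlong_endo (nabla := nabla) (f := fun y : Mb ↦ y) hT hY w
  have h3 : mfderiv 𝓘(ℝ, F) 𝓘(ℝ, F) (fun y : Mb ↦ y) x = ContinuousLinearMap.id ℝ _ :=
    mfderiv_id
  rw [covAlong_comp_field nabla (f := fun y : Mb ↦ y) mdifferentiableAt_id hY,
    covAlong_comp_field nabla (f := fun y : Mb ↦ y) (Y := fun z ↦ T z (Y z))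
      mdifferentiableAt_id (diffAlongAt_endo (f := fun y ↦ y) hT hY), h3] at h
  exact h

end

end TensorsAlong

/-! ### The algebraic core of the formula for the derivative of φ -/

/-- The linear algebra behind the formula for the covariant derivative of `φ` on an
`S`-manifold: `T` stands for `∇φ`, `D α` for `∇ξ_α` and `e` for `∑ ε_α η^α`. -/
lemma covariant_derivative_formula_of_normal {V : Type*} [AddCommGroup V] [Module ℝ V]
    (g : V →ₗ[ℝ] V →ₗ[ℝ] ℝ) (φ : V →ₗ[ℝ] V) {r : ℕ} (ξ : Fin r → V) (η : Fin r → V →ₗ[ℝ] ℝ)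
    (ε : Fin r → ℝ) (e : V →ₗ[ℝ] ℝ) (T : V →ₗ[ℝ] V →ₗ[ℝ] V) (D : Fin r → V → V)
    (symm : ∀ v w, g v w = g w v) (hφφ : ∀ v, φ (φ v) = -v + ∑ α, η α v • ξ α)
    (hφξ : ∀ α, φ (ξ α) = 0) (hskew : ∀ v w, g (φ v) w = -g v (φ w)) (heφ : ∀ v, e (φ v) = 0)
    (Tskew : ∀ X Y Z, g (T X Y) Z = -g (T X Z) Y)
    (Tcyc : ∀ X Y Z, g (T X Y) Z + g (T Y Z) X + g (T Z X) Y = 0)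
    (normal : ∀ X Y Z, g (T (φ X) Y) Z - g (T (φ Y) X) Z + g (T X Y) (φ Z) - g (T Y X) (φ Z)
      = -2 * g X (φ Y) * e Z)
    (Tξ : ∀ X α, T X (ξ α) = -φ (D α X))
    (Dext : ∀ α X Y, g (D α X) Y - g (D α Y) X = 2 * ε α * g X (φ Y))
    (Dmet : ∀ α β X, g (D α X) (ξ β) + g (ξ α) (D β X) = 0) (X Y Z : V) :
    g (T X Y) Z = g (φ X) (φ Y) * e Z - e Y * g (φ X) (φ Z) := by
  -- Normality for (X, Y, Z) and for (X, Z, Y), with the cyclic identity and skewness, isolates the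
  -- values of T whose first argument lies in the image of φ.
  have key (X Y Z : V) : g (T (φ X) Y) Z = -g X (φ Y) * e Z + g X (φ Z) * e Y := by
    linarith [normal X Y Z, normal X Z Y, Tcyc X Y (φ Z), Tcyc X Z (φ Y), Tskew Y (φ Z) X,
      Tskew Z (φ Y) X, Tskew (φ X) Z Y]
  -- It remains to kill T(ξ_α, ·). In the cyclic identity the two other terms have first argument in
  -- the image of φ, and by `key` they cancel.
  have h1 (α : Fin r) (Y Z : V) : g (T (ξ α) (φ Y)) (φ Z) = 0 := by
    have e1 := Tcyc (ξ α) (φ Y) (φ Z)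
    rw [key Y, key Z, hφξ, map_zero, map_zero, heφ] at e1
    have e2 : g Y (φ (φ Z)) = g Z (φ (φ Y)) := by
      rw [symm Y, hskew, hskew, neg_neg]
    rw [e2] at e1
    linarith
  have h2 (α β γ : Fin r) : g (T (ξ α) (ξ β)) (ξ γ) = 0 := by
    rw [Tξ, map_neg, LinearMap.neg_apply, hskew, hφξ]; simp
  -- This number is symmetric in α and β by the cyclic identity (`s1`). It also equals g(D_β(φ²Z),
  -- ξ_α) by `s2` and `s3`, which is antisymmetric in α and β by `Dmet`. Hence it vanishes.
  have h3 (α β : Fin r) (Z : V) : g (T (ξ α) (ξ β)) (φ Z) = 0 := by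
    have s1 : g (T (ξ α) (ξ β)) (φ Z) = g (T (ξ β) (ξ α)) (φ Z) := by
      have e1 := Tcyc (ξ α) (ξ β) (φ Z)
      rw [key Z, hφξ, hφξ, map_zero] at e1
      linarith [Tskew (ξ β) (φ Z) (ξ α)]
    have s2 (α β : Fin r) : g (T (ξ α) (ξ β)) (φ Z) = g (D β (ξ α)) (φ (φ Z)) := by
      rw [Tξ, map_neg, LinearMap.neg_apply, hskew, neg_neg]
    have s3 (α β : Fin r) : g (D β (ξ α)) (φ (φ Z)) = g (D β (φ (φ Z))) (ξ α) := by
      have e1 := Dext β (ξ α) (φ (φ Z))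
      have e2 := hskew (ξ α) (φ (φ Z))
      rw [hφξ, map_zero, LinearMap.zero_apply] at e2
      rw [← neg_eq_iff_eq_neg.2 e2] at e1
      linarith
    rw [s2, s2, s3 α β, s3 β α] at s1
    rw [s2, s3]
    linarith [Dmet β α (φ (φ Z)), symm (ξ β) (D α (φ (φ Z)))]
  have decomp (v : V) : v = -φ (φ v) + ∑ α, η α v • ξ α := by rw [hφφ]; abel
  have h4 (α : Fin r) (Y Z : V) : g (T (ξ α) Y) (φ Z) = 0 := by
    rw [decomp Y]
    simp only [map_add, map_neg, map_sum, map_smul, LinearMap.add_apply, LinearMap.neg_apply,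
      LinearMap.sum_apply, LinearMap.smul_apply, h1, h3]
    simp
  have h5 (α : Fin r) (Y Z : V) : g (T (ξ α) Y) Z = 0 := by
    have h6 (γ : Fin r) : g (T (ξ α) Y) (ξ γ) = 0 := by
      rw [Tskew, neg_eq_zero, decomp Y]
      simp only [map_add, map_neg, map_sum, map_smul, h4, h2]
      simp
    rw [decomp Z]
    simp only [map_add, map_neg, map_sum, map_smul, h4, h6]
    simp
  -- Only the component of X in the image of φ counts, and `key` applied to φX evaluates T on it.
  have h7 : g (T X Y) Z = -g (T (φ (φ X)) Y) Z := by
    conv_lhs => rw [decomp X]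
    simp only [map_add, map_neg, map_sum, map_smul, LinearMap.add_apply, LinearMap.neg_apply,
      LinearMap.sum_apply, LinearMap.smul_apply, h5]
    simp
  rw [h7, key]
  ring

/-! ### Pointwise identities of a metric framed f-structure -/

section SManifold

variable {F : Type*} [NormedAddCommGroup F] [NormedSpace ℝ F] [FiniteDimensional ℝ F]
  {Mb : Type*} [TopologicalSpace Mb] [ChartedSpace F Mb] [IsManifold 𝓘(ℝ, F) ∞ Mb]
  {nabla : CovariantDerivative 𝓘(ℝ, F) F (TangentSpace 𝓘(ℝ, F) : Mb → Type _)}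

namespace IndefiniteGFF

variable {r : ℕ} (A : IndefiniteGFF F Mb r)

lemma phi_xi (α : Fin r) (x : Mb) : A.phi x (A.xi α x) = 0 := by
  have h : A.xi α x ∈ (A.phi x).ker := by
    rw [A.ker_phi]; exact Submodule.subset_span ⟨α, rfl⟩
  exact h

/-- Computing φ³v as φ(φ²v) and as φ²(φv) leaves ∑ η^α(φv) ξ_α = 0, and the η^α are dual to the ξ_α.
-/
lemma eta_phi (α : Fin r) (x : Mb) (v : TangentSpace 𝓘(ℝ, F) x) : A.eta α x (A.phi x v) = 0 := by
  have h1 := congrArg (A.phi x) (A.phi_sq x v)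
  rw [A.phi_sq x (A.phi x v)] at h1
  simp only [map_add, map_neg, map_sum, map_smul, A.phi_xi, smul_zero, Finset.sum_const_zero,
    add_zero, add_eq_left] at h1
  have h2 := congrArg (A.eta α x) h1
  simpa [A.eta_xi] using h2

lemma inner_xi (α : Fin r) (x : Mb) (v : TangentSpace 𝓘(ℝ, F) x) :
    A.metric.inner x v (A.xi α x) = A.eps α * A.eta α x v := by
  have h := A.compat x v (A.xi α x)
  rw [A.phi_xi, map_zero] at h
  simp [A.eta_xi] at h
  linarith

lemma eps_mul_eps (α : Fin r) : A.eps α * A.eps α = 1 := by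
  rcases A.eps_spec α with h | h <;> rw [h.1] <;> norm_num

lemma eta_eq_inner (α : Fin r) (x : Mb) (v : TangentSpace 𝓘(ℝ, F) x) :
    A.eta α x v = A.eps α * A.metric.inner x (A.xi α x) v := by
  rw [A.metric.symm, A.inner_xi, ← mul_assoc, A.eps_mul_eps, one_mul]

lemma inner_phi_left (x : Mb) (v w : TangentSpace 𝓘(ℝ, F) x) :
    A.metric.inner x (A.phi x v) w = -A.metric.inner x v (A.phi x w) := by
  have h := A.compat x v (A.phi x w)
  simp only [A.eta_phi, mul_zero, Finset.sum_const_zero, sub_zero, A.phi_sq] at h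
  simp only [map_add, map_neg, map_sum, map_smul, A.inner_xi, A.eta_phi, smul_eq_mul, mul_zero,
    Finset.sum_const_zero, add_zero] at h
  linarith

lemma inner_phi_self (x : Mb) (v : TangentSpace 𝓘(ℝ, F) x) :
    A.metric.inner x v (A.phi x v) = 0 := by
  have h := A.inner_phi_left x v v
  rw [A.metric.symm] at h
  linarith

lemma etaSum_eq_inner (x : Mb) (v : TangentSpace 𝓘(ℝ, F) x) :
    A.etaSum x v = A.metric.inner x (A.xiSum x) v := by
  simp only [etaSum, xiSum, map_sum, sum_apply]
  exact Finset.sum_congr rfl fun α _ ↦ by rw [A.metric.symm, A.inner_xi]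

end IndefiniteGFF

end SManifold

/-! ### Chart frames commute; skewness of the derivative of φ -/

section Torsion

variable {F : Type*} [NormedAddCommGroup F] [NormedSpace ℝ F] [FiniteDimensional ℝ F]
  {Mb : Type*} [TopologicalSpace Mb] [ChartedSpace F Mb] [IsManifold 𝓘(ℝ, F) ∞ Mb]
  {nabla : CovariantDerivative 𝓘(ℝ, F) F (TangentSpace 𝓘(ℝ, F) : Mb → Type _)}
  {g : SemiRiemannianMetric F Mb}

lemma chartCoord_eq_mfderiv {x₀ x : Mb} (hx : x ∈ (chartAt F x₀).source) :
    (chartCoord x₀ x : TangentSpace 𝓘(ℝ, F) x →L[ℝ] F)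
      = mfderiv 𝓘(ℝ, F) 𝓘(ℝ, F) (extChartAt 𝓘(ℝ, F) x₀) x :=
  TangentBundle.continuousLinearMapAt_trivializationAt hx

/-- A constant vector field on a vector space. -/
def constField (a : F) (y : F) : TangentSpace 𝓘(ℝ, F) y := a

lemma chartFrame_eq_mpullback {x₀ x : Mb} (hx : x ∈ (chartAt F x₀).source) (a : F) :
    chartFrame x₀ a x = VectorField.mpullback 𝓘(ℝ, F) 𝓘(ℝ, F) (extChartAt 𝓘(ℝ, F) x₀)
      (constField a) x := by
  rw [VectorField.mpullback_apply]
  have h : (mfderiv 𝓘(ℝ, F) 𝓘(ℝ, F) (extChartAt 𝓘(ℝ, F) x₀) x).inverse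
      = (chartVec x₀ x : F →L[ℝ] TangentSpace 𝓘(ℝ, F) x) := by
    refine ContinuousLinearMap.inverse_eq ?_ ?_
    · rw [← chartCoord_eq_mfderiv hx]; ext v; exact chartCoord_chartVec hx v
    · rw [← chartCoord_eq_mfderiv hx]; ext v; exact chartVec_chartCoord hx v
  rw [h]; rfl

/-- Chart frames are pullbacks of constant fields under the chart, and the Lie bracket is natural
under pullback. -/
lemma mlieBracket_chartFrame {x₀ x : Mb} (hx : x ∈ (chartAt F x₀).source) (a b : F) :
    VectorField.mlieBracket 𝓘(ℝ, F) (chartFrame x₀ a) (chartFrame x₀ b) x = 0 := by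
  have : IsManifold 𝓘(ℝ, F) (minSmoothness ℝ 2) Mb := by
    rw [minSmoothness_of_isRCLikeNormedField]; infer_instance
  have e (a : F) : chartFrame x₀ a =ᶠ[𝓝 x] VectorField.mpullback 𝓘(ℝ, F) 𝓘(ℝ, F)
      (extChartAt 𝓘(ℝ, F) x₀) (constField a) := by
    filter_upwards [eventually_mem_source hx] with y hy
    exact chartFrame_eq_mpullback hy a
  have hc (a : F) : MDifferentiableAt 𝓘(ℝ, F) 𝓘(ℝ, F).tangent
      (fun y : F ↦ (⟨y, constField a y⟩ : TangentBundle 𝓘(ℝ, F) F)) (extChartAt 𝓘(ℝ, F) x₀ x) :=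
    (contMDiffAt_vectorSpace_iff_contDiffAt (n := 1) (V := constField a)
      |>.2 contDiffAt_const).mdifferentiableAt one_ne_zero
  rw [(e a).mlieBracket_vectorField_eq (e b), ← VectorField.mpullback_mlieBracket (n := 2)
    (hc a) (hc b) (contMDiffAt_extChartAt' (by simpa using hx)) (by simp)]
  have h0 : VectorField.mlieBracket 𝓘(ℝ, F) (constField a) (constField b) = 0 := by
    funext y
    rw [← VectorField.mlieBracketWithin_univ,
      VectorField.mlieBracketWithin_eq_lieBracketWithin]
    change VectorField.lieBracketWithin ℝ (fun _ : F ↦ a) (fun _ ↦ b) Set.univ y = 0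
    rw [VectorField.lieBracketWithin_univ]
    change fderiv ℝ (fun _ : F ↦ b) y a - fderiv ℝ (fun _ : F ↦ a) y b = 0
    simp
  rw [h0, VectorField.mpullback_zero]; rfl

lemma IsLeviCivita.mlieBracket_eq (h : IsLeviCivita g nabla) {X Y : Π x : Mb, TangentSpace 𝓘(ℝ, F) x}
    {x : Mb} (hX : DiffFieldAt X x) (hY : DiffFieldAt Y x) :
    VectorField.mlieBracket 𝓘(ℝ, F) X Y x = nabla Y x (X x) - nabla X x (Y x) :=
  ((CovariantDerivative.torsion_eq_zero_iff nabla).1 h.1 hX hY).symm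

lemma IsLeviCivita.chartFrame_comm (h : IsLeviCivita g nabla) {x₀ x : Mb}
    (hx : x ∈ (chartAt F x₀).source) (a b : F) :
    nabla (chartFrame x₀ a) x (chartFrame x₀ b x) = nabla (chartFrame x₀ b) x (chartFrame x₀ a x) := by
  have := h.mlieBracket_eq (diffFieldAt_chartFrame hx b) (diffFieldAt_chartFrame hx a)
  rw [mlieBracket_chartFrame hx] at this
  exact sub_eq_zero.1 this.symm

lemma IsLeviCivita.mvfderiv_inner (h : IsLeviCivita g nabla)
    {Y Z : Π x : Mb, TangentSpace 𝓘(ℝ, F) x} {x : Mb} (hY : DiffFieldAt Y x) (hZ : DiffFieldAt Z x)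
    (v : TangentSpace 𝓘(ℝ, F) x) :
    mvfderiv 𝓘(ℝ, F) (fun y ↦ g.inner y (Y y) (Z y)) x v
      = g.inner x (nabla Y x v) (Z x) + g.inner x (Y x) (nabla Z x v) := h.2 x v Y Z hY hZ

namespace IndefiniteGFF

variable {r : ℕ} {A : IndefiniteGFF F Mb r}

lemma diffFieldAt_xi (α : Fin r) (x : Mb) : DiffFieldAt (A.xi α) x :=
  (A.xi_smooth α).contMDiffAt (Filter.univ_mem) |>.mdifferentiableAt (by simp)

lemma diffFieldAt_phiField (A : IndefiniteGFF F Mb r) {X : Π x : Mb, TangentSpace 𝓘(ℝ, F) x} {x : Mb}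
    (hX : DiffFieldAt X x) : DiffFieldAt (A.phiField X) x :=
  diffAlongAt_endo (f := fun y ↦ y) A.phi_smooth hX

/-- `(∇_v φ) w`. -/
abbrev covPhi (A : IndefiniteGFF F Mb r)
    (nabla : CovariantDerivative 𝓘(ℝ, F) F (TangentSpace 𝓘(ℝ, F) : Mb → Type _)) (x : Mb)
    (v w : TangentSpace 𝓘(ℝ, F) x) : TangentSpace 𝓘(ℝ, F) x := covEndo nabla A.phi x v w

/-- Differentiate g(φY, Z) = -g(Y, φZ); the terms that differentiate Y and Z cancel by the skewness
of φ itself. -/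
lemma inner_covPhi_skew (h : IsLeviCivita A.metric nabla) (x : Mb)
    (v y z : TangentSpace 𝓘(ℝ, F) x) :
    A.metric.inner x (A.covPhi nabla x v y) z = -A.metric.inner x (A.covPhi nabla x v z) y := by
  have hx := mem_chart_source F x
  set Y := chartFrame x (chartCoord x x y)
  set Z := chartFrame x (chartCoord x x z)
  have hY : DiffFieldAt Y x := diffFieldAt_chartFrame hx _
  have hZ : DiffFieldAt Z x := diffFieldAt_chartFrame hx _
  have h1 := h.mvfderiv_inner (A.diffFieldAt_phiField hY) hZ v
  have h2 := h.mvfderiv_inner hY (A.diffFieldAt_phiField hZ) v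
  have e : (fun q ↦ A.metric.inner q (A.phiField Y q) (Z q))
      = -(fun q ↦ A.metric.inner q (Y q) (A.phiField Z q)) :=
    funext fun q ↦ A.inner_phi_left q _ _
  rw [e, mvfderiv_neg] at h1
  have e2 : -mvfderiv 𝓘(ℝ, F) (fun q ↦ A.metric.inner q (Y q) (A.phiField Z q)) x v = _ := h1
  rw [h2] at e2
  have e3 := nabla.endo_apply A.phi_smooth hY v
  have e4 := nabla.endo_apply A.phi_smooth hZ v
  rw [show (fun z ↦ A.phi z (Y z)) = A.phiField Y from rfl] at e3
  rw [show (fun z ↦ A.phi z (Z z)) = A.phiField Z from rfl] at e4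
  have hYx : Y x = y := chartFrame_self y
  have hZx : Z x = z := chartFrame_self z
  rw [e3, e4, hYx, hZx] at e2
  simp only [phiField, hYx, hZx, map_add, add_apply, A.inner_phi_left] at e2
  rw [A.metric.symm x y] at e2
  rw [A.metric.symm x y] at e2
  linarith [A.inner_phi_left x (nabla Z x v) y, A.metric.symm x y (A.phi x (nabla Z x v))]

end IndefiniteGFF

end Torsion

/-! ### The covariant derivative of φ on an indefinite S-manifold -/

section SManifoldFormula

variable {F : Type*} [NormedAddCommGroup F] [NormedSpace ℝ F] [FiniteDimensional ℝ F]
  {Mb : Type*} [TopologicalSpace Mb] [ChartedSpace F Mb] [IsManifold 𝓘(ℝ, F) ∞ Mb]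
  {nabla : CovariantDerivative 𝓘(ℝ, F) F (TangentSpace 𝓘(ℝ, F) : Mb → Type _)}
  {g : SemiRiemannianMetric F Mb}

lemma SemiRiemannianMetric.ext_inner (g : SemiRiemannianMetric F Mb) {x : Mb}
    {v w : TangentSpace 𝓘(ℝ, F) x} (h : ∀ z, g.inner x v z = g.inner x w z) : v = w :=
  sub_eq_zero.1 (g.nondegenerate x _ fun z ↦ by simp [h])

lemma mvfderiv_comp_extChartAt {G : Type*} [NormedAddCommGroup G] [NormedSpace ℝ G] {ψ : F → G}
    {x₀ x : Mb} (hx : x ∈ (chartAt F x₀).source)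
    (hψ : DifferentiableAt ℝ ψ (extChartAt 𝓘(ℝ, F) x₀ x)) (c : F) :
    mvfderiv 𝓘(ℝ, F) (fun y ↦ ψ (extChartAt 𝓘(ℝ, F) x₀ y)) x (chartFrame x₀ c x)
      = fderiv ℝ ψ (extChartAt 𝓘(ℝ, F) x₀ x) c := by
  rw [mvfderiv_fun_comp_apply hψ.mdifferentiableAt (mdifferentiableAt_extChartAt hx),
    ← chartCoord_eq_mfderiv hx]
  have : chartCoord x₀ x (chartFrame x₀ c x) = c := chartCoord_chartVec hx c
  erw [this]
  rw [mvfderiv, mfderiv_eq_fderiv]; rfl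

lemma contDiffAt_comp_extChartAt_symm {G : Type*} [NormedAddCommGroup G] [NormedSpace ℝ G]
    {u : Mb → G} {x₀ x : Mb} (hx : x ∈ (chartAt F x₀).source)
    (hu : ContMDiffAt 𝓘(ℝ, F) 𝓘(ℝ, G) ∞ u x) :
    ContDiffAt ℝ ∞ (fun z ↦ u ((extChartAt 𝓘(ℝ, F) x₀).symm z)) (extChartAt 𝓘(ℝ, F) x₀ x) := by
  have hx' : x ∈ (extChartAt 𝓘(ℝ, F) x₀).source := by simpa using hx
  have h1 : ContMDiffAt 𝓘(ℝ, F) 𝓘(ℝ, F) ∞ (extChartAt 𝓘(ℝ, F) x₀).symm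
      (extChartAt 𝓘(ℝ, F) x₀ x) :=
    (contMDiffOn_extChartAt_symm x₀).contMDiffAt
      ((isOpen_extChartAt_target x₀).mem_nhds ((extChartAt 𝓘(ℝ, F) x₀).map_source hx'))
  rw [← (extChartAt 𝓘(ℝ, F) x₀).left_inv hx'] at hu
  exact (hu.comp _ h1).contDiffAt

lemma mvfderiv_apply_chartFrame {G : Type*} [NormedAddCommGroup G] [NormedSpace ℝ G]
    {u : Mb → G} {x₀ x : Mb} (hx : x ∈ (chartAt F x₀).source)
    (hu : ContMDiffAt 𝓘(ℝ, F) 𝓘(ℝ, G) ∞ u x) (c : F) :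
    mvfderiv 𝓘(ℝ, F) u x (chartFrame x₀ c x)
      = fderiv ℝ (fun z ↦ u ((extChartAt 𝓘(ℝ, F) x₀).symm z)) (extChartAt 𝓘(ℝ, F) x₀ x) c := by
  rw [← mvfderiv_comp_extChartAt hx
    ((contDiffAt_comp_extChartAt_symm hx hu).differentiableAt (by simp))]
  refine Filter.EventuallyEq.mvfderiv_apply_eq ?_ _
  filter_upwards [eventually_mem_source hx] with y hy
  rw [(extChartAt 𝓘(ℝ, F) x₀).left_inv (by simpa using hy)]

namespace IndefiniteGFF

variable {r : ℕ} {A : IndefiniteGFF F Mb r}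

lemma contMDiffAt_eta_chartFrame (A : IndefiniteGFF F Mb r) (α : Fin r) {x₀ x : Mb}
    (hx : x ∈ (chartAt F x₀).source) (a : F) :
    ContMDiffAt 𝓘(ℝ, F) 𝓘(ℝ, ℝ) ∞ (fun y ↦ A.eta α y (chartFrame x₀ a y)) x := by
  have h : (fun y ↦ A.eta α y (chartFrame x₀ a y))
      = fun y ↦ A.eps α * A.metric.inner y (A.xi α y) (chartFrame x₀ a y) :=
    funext fun y ↦ A.eta_eq_inner α y _
  rw [h]
  exact contMDiffAt_const.mul (A.metric.contMDiffAt_inner (f := fun y ↦ y)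
    ((A.xi_smooth α).contMDiffAt Filter.univ_mem) (contMDiffAt_chartFrame hx a))

/-- The fundamental form of an `S`-manifold is closed. -/
lemma cyclic_sum_fundamental_form (hA : A.IsSManifold) (hr : 0 < r) (x : Mb) (a b c : F) :
    mvfderiv 𝓘(ℝ, F) (fun y ↦ A.metric.inner y (chartFrame x a y) (A.phi y (chartFrame x b y))) x
        (chartFrame x c x)
      + mvfderiv 𝓘(ℝ, F) (fun y ↦ A.metric.inner y (chartFrame x b y) (A.phi y (chartFrame x c y)))
        x (chartFrame x a x)
      + mvfderiv 𝓘(ℝ, F) (fun y ↦ A.metric.inner y (chartFrame x c y) (A.phi y (chartFrame x a y)))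
        x (chartFrame x b x) = 0 := by
  have hx := mem_chart_source F x
  -- Every dη^α equals Φ, so any single index exhibits Φ as an exact form; `hr` provides one.
  set α : Fin r := ⟨0, hr⟩
  let h (b : F) (z : F) : ℝ := A.eta α ((extChartAt 𝓘(ℝ, F) x).symm z)
    (chartFrame x b ((extChartAt 𝓘(ℝ, F) x).symm z))
  have hs (b : F) : ContDiffAt ℝ ∞ (h b) (extChartAt 𝓘(ℝ, F) x x) :=
    contDiffAt_comp_extChartAt_symm hx (A.contMDiffAt_eta_chartFrame α hx b)
  have hd (b : F) : DifferentiableAt ℝ (fderiv ℝ (h b)) (extChartAt 𝓘(ℝ, F) x x) :=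
    ((hs b).fderiv_right (m := 1) (by rw [one_add_one_eq_two]; exact ENat.LEInfty.out)).differentiableAt one_ne_zero
  have key (a b c : F) : mvfderiv 𝓘(ℝ, F) (fun y ↦ A.metric.inner y (chartFrame x a y)
      (A.phi y (chartFrame x b y))) x (chartFrame x c x)
      = (fderiv ℝ (fderiv ℝ (h b)) (extChartAt 𝓘(ℝ, F) x x) c a
        - fderiv ℝ (fderiv ℝ (h a)) (extChartAt 𝓘(ℝ, F) x x) c b) * 2⁻¹ := by
    -- Chart frames commute, so the bracket term of dη^α drops out and Φ on the frame is half the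
    -- antisymmetrized derivative of the coefficients of η^α. One more derivative turns the cyclic
    -- sum into second derivatives, which cancel by their symmetry.
    have e : (fun y ↦ A.metric.inner y (chartFrame x a y) (A.phi y (chartFrame x b y))) =ᶠ[𝓝 x]
        fun y ↦ (fun z ↦ (fderiv ℝ (h b) z a - fderiv ℝ (h a) z b) * 2⁻¹)
          (extChartAt 𝓘(ℝ, F) x y) := by
      filter_upwards [eventually_mem_source hx] with y hy
      have h1 := (hA (chartFrame x a) (chartFrame x b) y (diffFieldAt_chartFrame hy a)
        (diffFieldAt_chartFrame hy b)).2 α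
      rw [dEta, mlieBracket_chartFrame hy, map_zero,
        mvfderiv_apply_chartFrame hy (A.contMDiffAt_eta_chartFrame α hy b),
        mvfderiv_apply_chartFrame hy (A.contMDiffAt_eta_chartFrame α hy a), sub_zero] at h1
      rw [← h1, div_eq_mul_inv]
    have d1 := ((hd b).clm_apply (differentiableAt_const a))
    have d2 := ((hd a).clm_apply (differentiableAt_const b))
    have d3 := (d1.hasFDerivAt.fun_sub d2.hasFDerivAt).mul_const (2⁻¹ : ℝ)
    rw [e.mvfderiv_apply_eq, mvfderiv_comp_extChartAt (ψ := fun z ↦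
        (fderiv ℝ (h b) z a - fderiv ℝ (h a) z b) * 2⁻¹) hx d3.differentiableAt, d3.fderiv,
      fderiv_clm_apply (hd b) (differentiableAt_const a),
      fderiv_clm_apply (hd a) (differentiableAt_const b)]
    simp
    ring
  have symm (b : F) (v w : F) := (hs b).isSymmSndFDerivAt (by
    rw [minSmoothness_of_isRCLikeNormedField]; exact ENat.LEInfty.out) v w
  rw [key, key, key, symm a c b, symm b a c, symm c b a]
  ring

/-- This is dΦ = 0 expanded with the Levi-Civita connection. The derivatives of the frame fields
cancel in pairs, because ∇_a e_b = ∇_b e_a for chart frames and φ is skew. -/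
lemma covPhi_cyclic (h : IsLeviCivita A.metric nabla) (hA : A.IsSManifold) (hr : 0 < r) (x : Mb)
    (X Y Z : TangentSpace 𝓘(ℝ, F) x) :
    A.metric.inner x (A.covPhi nabla x X Y) Z + A.metric.inner x (A.covPhi nabla x Y Z) X
      + A.metric.inner x (A.covPhi nabla x Z X) Y = 0 := by
  have hx := mem_chart_source F x
  have h0 := cyclic_sum_fundamental_form hA hr x (chartCoord x x Z) (chartCoord x x Y)
    (chartCoord x x X)
  have key (a b c : F) : mvfderiv 𝓘(ℝ, F) (fun y ↦ A.metric.inner y (chartFrame x a y)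
      (A.phi y (chartFrame x b y))) x (chartFrame x c x)
      = A.metric.inner x (nabla (chartFrame x a) x (chartFrame x c x))
          (A.phi x (chartFrame x b x))
        + A.metric.inner x (chartFrame x a x)
          (A.covPhi nabla x (chartFrame x c x) (chartFrame x b x)
            + A.phi x (nabla (chartFrame x b) x (chartFrame x c x))) := by
    have hb := diffFieldAt_chartFrame hx b
    rw [← nabla.endo_apply A.phi_smooth hb]
    exact h.mvfderiv_inner (diffFieldAt_chartFrame hx a) (A.diffFieldAt_phiField hb) _
  rw [key, key, key, h.chartFrame_comm hx (chartCoord x x Z), h.chartFrame_comm hx (chartCoord x x Y)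
    (chartCoord x x Z), h.chartFrame_comm hx (chartCoord x x X) (chartCoord x x Y)] at h0
  simp only [chartFrame_self, map_add] at h0
  set n1 := nabla (chartFrame x (chartCoord x x X)) x Z
  set n2 := nabla (chartFrame x (chartCoord x x Z)) x Y
  set n3 := nabla (chartFrame x (chartCoord x x Y)) x X
  have s := A.metric.symm x
  have k := A.inner_phi_left x
  linarith [s Z (A.covPhi nabla x X Y), s X (A.covPhi nabla x Y Z), s Y (A.covPhi nabla x Z X),
    k n1 Y, k n2 X, k n3 Z, s (A.phi x n1) Y, s (A.phi x n2) X, s (A.phi x n3) Z]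

/-- Without torsion every bracket in the Nijenhuis tensor is a difference of covariant derivatives.
The derivatives of X and Y cancel, those of φ remain, and the common value of the dη^α factors out
of the sum against the ξ_α. -/
lemma covPhi_normal (h : IsLeviCivita A.metric nabla) (hA : A.IsSManifold) (x : Mb)
    (X Y Z : TangentSpace 𝓘(ℝ, F) x) :
    A.metric.inner x (A.covPhi nabla x (A.phi x X) Y) Z
      - A.metric.inner x (A.covPhi nabla x (A.phi x Y) X) Z
      + A.metric.inner x (A.covPhi nabla x X Y) (A.phi x Z)
      - A.metric.inner x (A.covPhi nabla x Y X) (A.phi x Z)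
      = -2 * A.metric.inner x X (A.phi x Y) * A.metric.inner x (A.xiSum x) Z := by
  have hx := mem_chart_source F x
  set X' := chartFrame x (chartCoord x x X)
  set Y' := chartFrame x (chartCoord x x Y)
  have hX : DiffFieldAt X' x := diffFieldAt_chartFrame hx _
  have hY : DiffFieldAt Y' x := diffFieldAt_chartFrame hx _
  have hX' := A.diffFieldAt_phiField hX
  have hY' := A.diffFieldAt_phiField hY
  have eX : X' x = X := chartFrame_self X
  have eY : Y' x = Y := chartFrame_self Y
  have h1 := (hA X' Y' x hX hY).1
  have h2 := (hA X' Y' x hX hY).2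
  have e1 (w) : nabla (A.phiField X') x w = A.covPhi nabla x w X + A.phi x (nabla X' x w) := by
    rw [← eX]; exact nabla.endo_apply A.phi_smooth hX w
  have e2 (w) : nabla (A.phiField Y') x w = A.covPhi nabla x w Y + A.phi x (nabla Y' x w) := by
    rw [← eY]; exact nabla.endo_apply A.phi_smooth hY w
  have p1 : A.phiField X' x = A.phi x X := by rw [← eX]; rfl
  have p2 : A.phiField Y' x = A.phi x Y := by rw [← eY]; rfl
  rw [nijenhuis, h.mlieBracket_eq hX hY, h.mlieBracket_eq hX' hY', h.mlieBracket_eq hX' hY,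
    h.mlieBracket_eq hX hY', e1, e2, e2, e1, p1, p2, eX, eY] at h1
  simp only [h2, eX, eY, ← Finset.smul_sum, map_add, map_sub] at h1
  have h3 := congrArg (fun v ↦ A.metric.inner x v Z) h1
  simp only [map_add, map_sub, map_smul, add_apply, sub_apply, smul_apply, smul_eq_mul, map_zero,
    zero_apply, A.inner_phi_left x (A.covPhi nabla x X Y),
    A.inner_phi_left x (A.covPhi nabla x Y X)] at h3
  rw [xiSum]
  linarith

/-- Since η^α = ε_α g(ξ_α, ·), its exterior derivative is ε_α times half the alternation of ∇ξ_α,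
and the contact condition gives its value. -/
lemma nabla_xi_ext (h : IsLeviCivita A.metric nabla) (hA : A.IsSManifold) (x : Mb) (α : Fin r)
    (X Y : TangentSpace 𝓘(ℝ, F) x) :
    A.metric.inner x (nabla (A.xi α) x X) Y - A.metric.inner x (nabla (A.xi α) x Y) X
      = 2 * A.eps α * A.metric.inner x X (A.phi x Y) := by
  have hx := mem_chart_source F x
  set X' := chartFrame x (chartCoord x x X)
  set Y' := chartFrame x (chartCoord x x Y)
  have hX : DiffFieldAt X' x := diffFieldAt_chartFrame hx _
  have hY : DiffFieldAt Y' x := diffFieldAt_chartFrame hx _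
  have eX : X' x = X := chartFrame_self X
  have eY : Y' x = Y := chartFrame_self Y
  have h2 := (hA X' Y' x hX hY).2 α
  have d {W : Π x : Mb, TangentSpace 𝓘(ℝ, F) x} (hW : DiffFieldAt W x) (v) :
      mvfderiv 𝓘(ℝ, F) (fun y ↦ A.eta α y (W y)) x v
        = A.eps α * (A.metric.inner x (nabla (A.xi α) x v) (W x)
          + A.metric.inner x (A.xi α x) (nabla W x v)) := by
    have e : (fun y ↦ A.eta α y (W y)) = A.eps α • fun y ↦ A.metric.inner y (A.xi α y) (W y) :=
      funext fun y ↦ A.eta_eq_inner α y _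
    have hd : MDifferentiableAt 𝓘(ℝ, F) 𝓘(ℝ, ℝ) (fun y ↦ A.metric.inner y (A.xi α y) (W y)) x :=
      A.metric.mdifferentiableAt_inner (f := fun y ↦ y) (diffFieldAt_xi α x) hW
    rw [← h.mvfderiv_inner (diffFieldAt_xi α x) hW, e]
    have := mvfderiv_smul (I := 𝓘(ℝ, F)) (mdifferentiableAt_const (c := A.eps α)) hd
    rw [mvfderiv_const] at this
    exact (congrArg (fun L : TangentSpace 𝓘(ℝ, F) x →L[ℝ] ℝ ↦ L v) this).trans (by simp)
  rw [dEta, d hX, d hY, h.mlieBracket_eq hX hY, A.eta_eq_inner, eX, eY, map_sub] at h2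
  have h3 := A.eps_mul_eps α
  linear_combination (2 * A.eps α) * h2 - (A.metric.inner x (nabla (A.xi α) x X) Y
    - A.metric.inner x (nabla (A.xi α) x Y) X) * h3

lemma inner_xi_xi (x : Mb) (α β : Fin r) :
    A.metric.inner x (A.xi α x) (A.xi β x) = if α = β then A.eps β else 0 := by
  rw [A.inner_xi, A.eta_xi]
  by_cases hab : α = β <;> simp [hab, eq_comm]

lemma nabla_xi_metric (h : IsLeviCivita A.metric nabla) (x : Mb) (α β : Fin r)
    (X : TangentSpace 𝓘(ℝ, F) x) :
    A.metric.inner x (nabla (A.xi α) x X) (A.xi β x)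
      + A.metric.inner x (A.xi α x) (nabla (A.xi β) x X) = 0 := by
  rw [← h.mvfderiv_inner (diffFieldAt_xi α x) (diffFieldAt_xi β x)]
  simp only [inner_xi_xi]
  rw [mvfderiv_const]; rfl

lemma covPhi_xi (x : Mb) (α : Fin r) (X : TangentSpace 𝓘(ℝ, F) x) :
    A.covPhi nabla x X (A.xi α x) = -A.phi x (nabla (A.xi α) x X) := by
  have h := nabla.endo_apply A.phi_smooth (diffFieldAt_xi (A := A) α x) X
  have e : (fun z ↦ A.phi z (A.xi α z)) = 0 := funext fun z ↦ A.phi_xi α z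
  rw [e, nabla.zero] at h
  exact eq_neg_of_add_eq_zero_left h.symm

lemma covPhi_add_left (x : Mb) (v w y : TangentSpace 𝓘(ℝ, F) x) :
    A.covPhi nabla x (v + w) y = A.covPhi nabla x v y + A.covPhi nabla x w y := by
  simp only [covPhi, covEndo, map_add]; abel

lemma covPhi_smul_left (x : Mb) (c : ℝ) (v y : TangentSpace 𝓘(ℝ, F) x) :
    A.covPhi nabla x (c • v) y = c • A.covPhi nabla x v y := by
  simp only [covPhi, covEndo, map_smul, smul_sub]

/-- `∇φ` as a bilinear map. -/
def covPhiBilin (h : IsLeviCivita A.metric nabla) (x : Mb) :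
    TangentSpace 𝓘(ℝ, F) x →ₗ[ℝ] TangentSpace 𝓘(ℝ, F) x →ₗ[ℝ] TangentSpace 𝓘(ℝ, F) x :=
  LinearMap.mk₂ ℝ (A.covPhi nabla x) (covPhi_add_left x) (covPhi_smul_left x)
    -- Skewness moves the second argument into the second slot of the metric, where linearity is
    -- plain; nondegeneracy does the rest.
    (fun v y z ↦ A.metric.ext_inner fun u ↦ by
      rw [map_add, add_apply, inner_covPhi_skew h, inner_covPhi_skew h x v y,
        inner_covPhi_skew h x v z, map_add, neg_add])
    (fun c v y ↦ A.metric.ext_inner fun u ↦ by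
      rw [map_smul, smul_apply, inner_covPhi_skew h, inner_covPhi_skew h x v y, map_smul, smul_neg])

/-- On an indefinite `S`-manifold, `(∇_X φ) Y = g(φX, φY) ξ + η(Y) φ² X`. -/
theorem covPhi_eq (h : IsLeviCivita A.metric nabla) (hA : A.IsSManifold) (hr : 0 < r) (x : Mb)
    (X Y : TangentSpace 𝓘(ℝ, F) x) :
    A.covPhi nabla x X Y = A.metric.inner x (A.phi x X) (A.phi x Y) • A.xiSum x
      + A.etaSum x Y • A.phi x (A.phi x X) := by
  refine A.metric.ext_inner fun Z ↦ ?_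
  have := covariant_derivative_formula_of_normal (A.metric.inner x).toLinearMap₁₂
    (A.phi x).toLinearMap (fun α ↦ A.xi α x) (fun α ↦ (A.eta α x).toLinearMap) A.eps
    (A.metric.inner x (A.xiSum x)).toLinearMap (covPhiBilin h x)
    (fun α X ↦ nabla (A.xi α) x X) (A.metric.symm x) (A.phi_sq x) (fun α ↦ A.phi_xi α x)
    (A.inner_phi_left x) (fun v ↦ by
      change A.metric.inner x (A.xiSum x) (A.phi x v) = 0
      rw [← A.etaSum_eq_inner, etaSum]; simp [A.eta_phi])
    (inner_covPhi_skew h x) (covPhi_cyclic h hA hr x) (covPhi_normal h hA x)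
    (fun X α ↦ covPhi_xi x α X) (nabla_xi_ext h hA x) (fun α β X ↦ nabla_xi_metric h x α β X) X Y Z
  change A.metric.inner x (A.covPhi nabla x X Y) Z = A.metric.inner x (A.phi x X) (A.phi x Y)
    * A.metric.inner x (A.xiSum x) Z - A.metric.inner x (A.xiSum x) Y
    * A.metric.inner x (A.phi x X) (A.phi x Z) at this
  rw [this, A.etaSum_eq_inner]
  simp only [map_add, map_smul, add_apply, smul_apply, smul_eq_mul,
    A.inner_phi_left x (A.phi x X) Z]
  ring

end IndefiniteGFF

end SManifoldFormula

/-! ### Linear algebra of a lightlike hypersurface with a null pair -/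

lemma projAlong_eq {V : Type*} [AddCommGroup V] [Module ℝ V] {p q : Submodule ℝ V}
    (h : IsCompl p q) {x y : V} (hx : x ∈ p) (hy : y ∈ q) : projAlong p q (x + y) = x := by
  rw [projAlong, dif_pos h, map_add, Submodule.projection_apply_of_mem_left h hx,
    Submodule.projection_apply_of_mem_right h hy, add_zero]

section Hypersurface

variable {F : Type*} [NormedAddCommGroup F] [NormedSpace ℝ F] [FiniteDimensional ℝ F]
  {Mb : Type*} [TopologicalSpace Mb] [ChartedSpace F Mb] [IsManifold 𝓘(ℝ, F) ∞ Mb]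
  {E : Type*} [NormedAddCommGroup E] [NormedSpace ℝ E] [FiniteDimensional ℝ E]
  {M : Type*} [TopologicalSpace M] [ChartedSpace E M] [IsManifold 𝓘(ℝ, E) ∞ M]

/-- In its normal form an immersion is u ↦ (u, 0), so the projection to the first factor, read in
the charts, is a differentiable local left inverse; the chain rule inverts the differential on the
left. -/
lemma Manifold.IsImmersionAt.mfderiv_injective {f : M → Mb} {p : M}
    (h : Manifold.IsImmersionAt 𝓘(ℝ, E) 𝓘(ℝ, F) ∞ f p) :
    Function.Injective (mfderiv 𝓘(ℝ, E) 𝓘(ℝ, F) f p) := by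
  set ρ : Mb → M := fun y ↦ h.domChart.symm (h.equiv.symm (h.codChart y)).1 with hρ
  have hf : MDifferentiableAt 𝓘(ℝ, E) 𝓘(ℝ, F) f p := h.contMDiffAt.mdifferentiableAt (by simp)
  have key : ∀ q ∈ h.domChart.source, h.equiv.symm (h.codChart (f q)) = (h.domChart q, 0) := by
    intro q hq
    have hq' : h.domChart q ∈ (h.domChart.extend 𝓘(ℝ, E)).target := by
      simpa using h.domChart.map_source hq
    have := h.writtenInCharts hq'
    simp only [Function.comp_apply, OpenPartialHomeomorph.extend_coe, modelWithCornersSelf_coe,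
      OpenPartialHomeomorph.extend_coe_symm, modelWithCornersSelf_coe_symm, id_eq,
      h.domChart.left_inv hq] at this
    rw [this, ContinuousLinearEquiv.symm_apply_apply]
  have hp := h.mem_domChart_source
  have hlin : MDifferentiableAt 𝓘(ℝ, F) 𝓘(ℝ, E) (fun y : F ↦ (h.equiv.symm y).1)
      (h.codChart (f p)) :=
    ((ContinuousLinearMap.fst ℝ E h.complement).comp
      (h.equiv.symm : F →L[ℝ] E × h.complement)).differentiableAt.mdifferentiableAt
  have hcod : MDifferentiableAt 𝓘(ℝ, F) 𝓘(ℝ, F) h.codChart (f p) :=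
    (contMDiffAt_of_mem_maximalAtlas h.codChart_mem_maximalAtlas
      h.mem_codChart_source).mdifferentiableAt (by simp)
  have hdom : MDifferentiableAt 𝓘(ℝ, E) 𝓘(ℝ, E) h.domChart.symm
      (h.equiv.symm (h.codChart (f p))).1 := by
    rw [key p hp]
    exact (contMDiffAt_symm_of_mem_maximalAtlas h.domChart_mem_maximalAtlas
      (h.domChart.map_source hp)).mdifferentiableAt (by simp)
  have hρd : MDifferentiableAt 𝓘(ℝ, F) 𝓘(ℝ, E) ρ (f p) :=
    hdom.comp (f p) (hlin.comp (f p) hcod)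
  have hid : ρ ∘ f =ᶠ[𝓝 p] id := by
    filter_upwards [h.domChart.open_source.mem_nhds hp] with q hq
    simp [hρ, key q hq, h.domChart.left_inv hq]
  have hcomp := mfderiv_comp p hρd hf
  rw [hid.mfderiv_eq, mfderiv_id] at hcomp
  intro v w hvw
  have hv := DFunLike.congr_fun hcomp v
  have hw := DFunLike.congr_fun hcomp w
  simp only [ContinuousLinearMap.comp_apply] at hv hw
  rw [hvw] at hv
  exact hv.trans hw.symm

namespace LightlikeHypersurface

variable {g : SemiRiemannianMetric F Mb} (L : LightlikeHypersurface E M g)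

lemma di_injective (p : M) : Function.Injective (L.di p) :=
  (L.immersion.isImmersionAt p).mfderiv_injective

lemma contMDiff_map : ContMDiff 𝓘(ℝ, E) 𝓘(ℝ, F) ∞ L.map := L.immersion.contMDiff

lemma lift_di (p : M) (v : TangentSpace 𝓘(ℝ, E) p) : L.lift p (L.di p v) = v := by
  have h : ∃ u, L.di p u = L.di p v := ⟨v, rfl⟩
  rw [lift, dif_pos h]
  exact L.di_injective p h.choose_spec

lemma lift_eq {p : M} {w : TangentSpace 𝓘(ℝ, F) (L.map p)} {v : TangentSpace 𝓘(ℝ, E) p}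
    (h : L.di p v = w) : L.lift p w = v := by rw [← h, L.lift_di]

variable {L} in
lemma mem_rad_iff {p : M} {e : TangentSpace 𝓘(ℝ, E) p} :
    e ∈ L.rad p ↔ ∀ v, g.inner (L.map p) (L.di p v) (L.di p e) = 0 :=
  ⟨fun h v ↦ h v trivial, fun h v _ ↦ h v⟩

namespace NullPair

variable {L} (P : L.NullPair) {p : M} (hp : p ∈ P.dom)

/-- The image of the radical section under the immersion. -/
def diE (p : M) : TangentSpace 𝓘(ℝ, F) (L.map p) := L.di p (P.secE p)

include hp

lemma inner_di_diE (v : TangentSpace 𝓘(ℝ, E) p) :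
    g.inner (L.map p) (L.di p v) (P.diE p) = 0 := mem_rad_iff.1 (P.E_mem p hp) v

lemma inner_secN_diE : g.inner (L.map p) (P.secN p) (P.diE p) = 1 := P.inner_N_E p hp

/-- The tangent hyperplane is all of the orthogonal complement of E: it lies in it, g(·, E) is
nonzero because g(N, E) = 1, and both have codimension one. -/
lemma exists_di_eq {w : TangentSpace 𝓘(ℝ, F) (L.map p)}
    (hw : g.inner (L.map p) w (P.diE p) = 0) : ∃ z, L.di p z = w := by
  set f : TangentSpace 𝓘(ℝ, F) (L.map p) →ₗ[ℝ] ℝ := (g.inner (L.map p) (P.diE p)).toLinearMap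
  have hle : (L.di p).range ≤ LinearMap.ker f := by
    rintro _ ⟨z, rfl⟩
    exact (g.symm _ _ _).trans (P.inner_di_diE hp z)
  have hf : f ≠ 0 := fun h ↦ by
    have := DFunLike.congr_fun h (P.secN p)
    have h2 := P.inner_secN_diE hp
    rw [g.symm] at h2
    exact one_ne_zero (h2.symm.trans this)
  have : FiniteDimensional ℝ (TangentSpace 𝓘(ℝ, F) (L.map p)) := ‹FiniteDimensional ℝ F›
  have h1 := Module.Dual.finrank_ker_add_one_of_ne_zero (f := f) hf
  have h2 : Module.finrank ℝ (L.di p).range = Module.finrank ℝ E :=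
    LinearMap.finrank_range_of_inj (f := (L.di p).toLinearMap) (L.di_injective p)
  have h3 : Module.finrank ℝ (TangentSpace 𝓘(ℝ, F) (L.map p)) = Module.finrank ℝ E + 1 :=
    L.codim_one
  have h4 := Submodule.eq_of_le_of_finrank_eq hle (by omega)
  have : w ∈ LinearMap.ker f := (g.symm _ _ _).trans hw
  rw [← h4] at this
  exact this

lemma exists_di_add (w : TangentSpace 𝓘(ℝ, F) (L.map p)) :
    ∃ z, w = L.di p z + g.inner (L.map p) w (P.diE p) • P.secN p := by
  obtain ⟨z, hz⟩ := P.exists_di_eq hp (w := w - g.inner (L.map p) w (P.diE p) • P.secN p)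
    (by simp [P.inner_secN_diE hp])
  exact ⟨z, by rw [hz]; abel⟩

lemma eq_of_inner {v w : TangentSpace 𝓘(ℝ, F) (L.map p)}
    (h1 : ∀ z, g.inner (L.map p) v (L.di p z) = g.inner (L.map p) w (L.di p z))
    (h2 : g.inner (L.map p) v (P.secN p) = g.inner (L.map p) w (P.secN p)) : v = w := by
  refine g.ext_inner fun z ↦ ?_
  obtain ⟨u, hu⟩ := P.exists_di_add hp z
  rw [hu, map_add, map_add, map_smul, map_smul, h1, h2]

/-- The radical is a line: both sides pair to zero with TM and equally with N, which together span
the ambient tangent space. -/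
lemma di_rad_eq {e : TangentSpace 𝓘(ℝ, E) p} (he : e ∈ L.rad p) :
    L.di p e = g.inner (L.map p) (L.di p e) (P.secN p) • P.diE p := by
  refine P.eq_of_inner hp (fun z ↦ ?_) ?_
  · have := P.inner_di_diE hp z
    rw [g.symm] at this
    rw [g.symm, mem_rad_iff.1 he z, map_smul]
    simp [this]
  · have := P.inner_secN_diE hp
    rw [g.symm] at this
    simp [this]

lemma rad_eq_smul {e : TangentSpace 𝓘(ℝ, E) p} (he : e ∈ L.rad p) :
    e = g.inner (L.map p) (L.di p e) (P.secN p) • P.secE p := by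
  refine L.di_injective p ?_
  rw [map_smul]
  exact P.di_rad_eq hp he

lemma exists_screen_add (z : TangentSpace 𝓘(ℝ, E) p) :
    ∃ s ∈ L.screen p, ∃ c : ℝ, z = c • P.secE p + s := by
  have : z ∈ radicalSpace (E := E) g L.map p ⊔ L.screen p := by
    rw [(L.screen_compl p).sup_eq_top]; trivial
  obtain ⟨e, he, s, hs, rfl⟩ := Submodule.mem_sup.1 this
  exact ⟨s, hs, _, by rw [P.rad_eq_smul hp he]⟩

lemma inner_secN_di_add {s : TangentSpace 𝓘(ℝ, E) p} (hs : s ∈ L.screen p) (c : ℝ) :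
    g.inner (L.map p) (P.secN p) (L.di p (c • P.secE p + s)) = c := by
  have := P.inner_secN_diE hp
  rw [map_add, map_add, P.inner_N_screen p hp s hs, map_smul, map_smul]
  rw [diE] at this
  simp [this]

lemma mem_screen_iff {z : TangentSpace 𝓘(ℝ, E) p} :
    z ∈ L.screen p ↔ g.inner (L.map p) (P.secN p) (L.di p z) = 0 := by
  refine ⟨P.inner_N_screen p hp z, fun h ↦ ?_⟩
  obtain ⟨s, hs, c, rfl⟩ := P.exists_screen_add hp z
  rw [P.inner_secN_di_add hp hs] at h
  simpa [h] using hs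

lemma ltr_eq : L.ltr p = Submodule.span ℝ {P.secN p} := by
  refine le_antisymm (Submodule.span_le.2 ?_) (Submodule.span_le.2 ?_)
  · rintro n ⟨h1, h2, e, he, h3⟩
    have hs (s) (hs : s ∈ L.screen p) := P.inner_N_screen p hp s hs
    set a := g.inner (L.map p) n (P.diE p)
    have ha : a ≠ 0 := by
      rw [P.di_rad_eq hp he, map_smul, smul_eq_mul] at h3
      exact right_ne_zero_of_mul_eq_one h3
    have hdi (z) : g.inner (L.map p) n (L.di p z) = g.inner (L.map p) (a • P.secN p) (L.di p z) := by
      obtain ⟨s, hs, c, rfl⟩ := P.exists_screen_add hp z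
      have h4 : g.inner (L.map p) n (L.di p (P.secE p)) = a := rfl
      rw [map_smul, smul_apply, P.inner_secN_di_add hp hs, map_add, map_add, h2 s hs, map_smul,
        map_smul, h4, smul_eq_mul, smul_eq_mul]
      ring
    -- Write n = z + aN with z tangent. As n and aN pair equally with tangent vectors, g(n, n) = 2a
    -- g(n, N), so nullity of n and a ≠ 0 force g(n, N) = 0.
    have hN : g.inner (L.map p) n (P.secN p) = g.inner (L.map p) (a • P.secN p) (P.secN p) := by
      obtain ⟨z, hz⟩ := P.exists_di_add hp n
      have h5 := h1
      nth_rw 2 [hz] at h5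
      rw [map_add, hdi, map_smul, map_smul, smul_apply] at h5
      have h6 : g.inner (L.map p) (P.secN p) n = g.inner (L.map p) (P.secN p) (L.di p z) := by
        nth_rw 1 [hz]
        rw [map_add, map_smul, P.inner_N_N p hp, smul_zero, add_zero]
      rw [← h6, g.symm _ (P.secN p)] at h5
      have h7 : a * g.inner (L.map p) n (P.secN p) = 0 := by
        simp only [smul_eq_mul] at h5
        linarith
      rw [map_smul, smul_apply, P.inner_N_N p hp, smul_zero]
      exact (mul_eq_zero.1 h7).resolve_left ha
    rw [P.eq_of_inner hp hdi hN]
    exact Submodule.smul_mem _ _ (Submodule.mem_span_singleton_self _)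
  · rintro _ rfl
    exact Submodule.subset_span ⟨P.inner_N_N p hp, P.inner_N_screen p hp, P.secE p, P.E_mem p hp,
      P.inner_N_E p hp⟩

lemma isCompl_range_ltr : IsCompl (L.di p).range (L.ltr p) := by
  rw [P.ltr_eq hp]
  refine IsCompl.of_eq ?_ ?_
  · refine (Submodule.eq_bot_iff _).2 fun w hw ↦ ?_
    obtain ⟨⟨z, hz⟩, hw⟩ := hw
    obtain ⟨c, rfl⟩ := Submodule.mem_span_singleton.1 hw
    have h := P.inner_di_diE hp z
    have h2 : L.di p z = c • P.secN p := hz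
    rw [h2, map_smul, smul_apply, P.inner_secN_diE hp, smul_eq_mul, mul_one] at h
    rw [h, zero_smul]
  · refine eq_top_iff.2 fun w _ ↦ ?_
    obtain ⟨z, hz⟩ := P.exists_di_add hp w
    rw [hz]
    exact Submodule.add_mem_sup ⟨z, rfl⟩
      (Submodule.smul_mem _ _ (Submodule.mem_span_singleton_self _))

lemma tangentPart_add (z : TangentSpace 𝓘(ℝ, E) p) (c : ℝ) :
    L.tangentPart p (L.di p z + c • P.secN p) = z := by
  have h1 : L.di p z ∈ (L.di p).range := ⟨z, rfl⟩
  have h2 : c • P.secN p ∈ L.ltr p := by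
    rw [P.ltr_eq hp]; exact Submodule.smul_mem _ _ (Submodule.mem_span_singleton_self _)
  rw [tangentPart, projAlong_eq (P.isCompl_range_ltr hp) h1 h2, L.lift_di]

lemma di_tangentPart (w : TangentSpace 𝓘(ℝ, F) (L.map p)) :
    L.di p (L.tangentPart p w) = w - g.inner (L.map p) w (P.diE p) • P.secN p := by
  obtain ⟨z, hz⟩ := P.exists_di_add hp w
  rw [eq_sub_iff_add_eq]
  nth_rw 1 [hz]
  rw [P.tangentPart_add hp]
  exact hz.symm

end NullPair

end LightlikeHypersurface

end Hypersurface

/-! ### The structure tensor on a characteristic hypersurface -/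

section Hypersurface

variable {F : Type*} [NormedAddCommGroup F] [NormedSpace ℝ F] [FiniteDimensional ℝ F]
  {Mb : Type*} [TopologicalSpace Mb] [ChartedSpace F Mb] [IsManifold 𝓘(ℝ, F) ∞ Mb]
  {E : Type*} [NormedAddCommGroup E] [NormedSpace ℝ E] [FiniteDimensional ℝ E]
  {M : Type*} [TopologicalSpace M] [ChartedSpace E M] [IsManifold 𝓘(ℝ, E) ∞ M]

namespace LightlikeHypersurface

variable {r : ℕ} {A : IndefiniteGFF F Mb r} {L : LightlikeHypersurface E M A.metric}

namespace NullPair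

variable (P : L.NullPair) {p : M}

/-- The image `φE` of the radical section under the structure tensor. -/
def phiE (p : M) : TangentSpace 𝓘(ℝ, F) (L.map p) := A.phi (L.map p) (P.diE p)

/-- The image `φN` of the transversal section under the structure tensor. -/
def phiN (p : M) : TangentSpace 𝓘(ℝ, F) (L.map p) := A.phi (L.map p) (P.secN p)

variable (hL : L.IsCharacteristic A) (hp : p ∈ P.dom)

include hL hp

/-- The fields ξ_α are tangent to M, hence orthogonal to E. -/
lemma eta_diE (α : Fin r) : A.eta α (L.map p) (P.diE p) = 0 := by
  obtain ⟨z, hz⟩ := hL.1 p α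
  rw [A.eta_eq_inner, ← hz]
  exact (congrArg _ (P.inner_di_diE hp z)).trans (mul_zero _)

/-- The kernel of φ lies in the screen, which is orthogonal to N. -/
lemma eta_secN (α : Fin r) : A.eta α (L.map p) (P.secN p) = 0 := by
  have h : A.xi α (L.map p) ∈ (A.phi (L.map p)).ker := A.phi_xi α _
  obtain ⟨z, hz, hz'⟩ := hL.2.1 p h
  have h2 : A.metric.inner (L.map p) (P.secN p) (A.xi α (L.map p)) = 0 := by
    rw [← hz']; exact P.inner_N_screen p hp z hz
  rw [A.eta_eq_inner, A.metric.symm, h2, mul_zero]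

lemma phi_phiN : A.phi (L.map p) (P.phiN p) = -P.secN p := by
  simp [phiN, A.phi_sq, P.eta_secN hL hp]

lemma exists_di_phiE : ∃ v, L.di p v = P.phiE p := by
  obtain ⟨z, _, hz⟩ := hL.2.2 p _ (P.E_mem p hp)
  exact ⟨z, hz⟩

lemma inner_secN_phiE : A.metric.inner (L.map p) (P.secN p) (P.phiE p) = 0 := by
  obtain ⟨z, hz, hz'⟩ := hL.2.2 p _ (P.E_mem p hp)
  rw [phiE, diE, ← hz']
  exact P.inner_N_screen p hp z hz

lemma inner_diE_phiN : A.metric.inner (L.map p) (P.diE p) (P.phiN p) = 0 := by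
  rw [A.metric.symm, phiN, A.inner_phi_left, ← phiE, P.inner_secN_phiE hL hp, neg_zero]

lemma inner_phiE_phiN : A.metric.inner (L.map p) (P.phiE p) (P.phiN p) = 1 := by
  rw [phiE, phiN, A.compat, A.metric.symm, P.inner_secN_diE hp]
  simp [P.eta_diE hL hp]

lemma inner_phiE_phiE : A.metric.inner (L.map p) (P.phiE p) (P.phiE p) = 0 := by
  rw [phiE, A.compat]
  simp only [P.eta_diE hL hp, mul_zero, Finset.sum_const_zero, sub_zero]
  exact P.inner_di_diE hp _

lemma di_fieldU : L.di p (L.fieldU A P p) = -P.phiN p := by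
  obtain ⟨z, hz⟩ := P.exists_di_eq hp (w := -P.phiN p) (by
    rw [map_neg, neg_apply, A.metric.symm, P.inner_diE_phiN hL hp, neg_zero])
  rw [fieldU, ← phiN, L.lift_eq hz, hz]

lemma mem_phiRad {z : TangentSpace 𝓘(ℝ, E) p} (hz : z ∈ L.phiRad A p) :
    ∃ a : ℝ, L.di p z = a • P.phiE p := by
  obtain ⟨_, ⟨e, he, rfl⟩, h⟩ := hz
  refine ⟨A.metric.inner (L.map p) (L.di p e) (P.secN p), ?_⟩
  have h2 : L.di p z = A.phi (L.map p) (L.di p e) := h.symm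
  rw [h2, phiE, ← map_smul, ← P.di_rad_eq hp he]

lemma mem_phiLtr {z : TangentSpace 𝓘(ℝ, E) p} (hz : z ∈ L.phiLtr A p) :
    ∃ a : ℝ, L.di p z = a • P.phiN p := by
  obtain ⟨n, hn, h⟩ := hz
  rw [SetLike.mem_coe, P.ltr_eq hp] at hn
  obtain ⟨a, rfl⟩ := Submodule.mem_span_singleton.1 hn
  exact ⟨a, h.symm.trans (map_smul _ _ _)⟩

/-- This replaces the threefold sum defining D by one linear equation. The vector φE is orthogonal
to D₀, to itself and to E; conversely, subtracting from y its components g(y, φN) φE and g(N, y) E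
leaves a vector of D₀. -/
lemma mem_distD_iff {y : TangentSpace 𝓘(ℝ, E) p} :
    y ∈ L.distD A p ↔ A.metric.inner (L.map p) (L.di p y) (P.phiE p) = 0 := by
  obtain ⟨v, hv⟩ := P.exists_di_phiE hL hp
  have hvmem : v ∈ L.phiRad A p := ⟨_, ⟨_, P.E_mem p hp, rfl⟩, hv.symm⟩
  constructor
  · intro hy
    obtain ⟨_, hy', e, he, rfl⟩ := Submodule.mem_sup.1 hy
    obtain ⟨y₀, hy₀, z, hz, rfl⟩ := Submodule.mem_sup.1 hy'
    obtain ⟨a, ha⟩ := P.mem_phiRad hL hp hz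
    have h0 : A.metric.inner (L.map p) (L.di p v) (L.di p y₀) = 0 :=
      hy₀.2 v (Submodule.mem_sup_left hvmem)
    rw [hv, A.metric.symm] at h0
    have h2 : A.metric.inner (L.map p) (P.diE p) (P.phiE p) = 0 := A.inner_phi_self _ _
    rw [map_add, map_add, map_add, map_add, add_apply, add_apply, h0, ha, P.di_rad_eq hp he,
      map_smul, map_smul, smul_apply, smul_apply, P.inner_phiE_phiE hL hp, h2]
    simp
  · intro hy
    set b := A.metric.inner (L.map p) (L.di p y) (P.phiN p) with hb
    set c := A.metric.inner (L.map p) (P.secN p) (L.di p y) with hc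
    have hE : L.di p (P.secE p) = P.diE p := rfl
    have hy₀ : y - b • v - c • P.secE p ∈ L.distD0 A p := by
      refine ⟨(P.mem_screen_iff hp).2 ?_, fun z hz ↦ ?_⟩
      · simp only [map_sub, map_smul, hv, hE, P.inner_secN_phiE hL hp, P.inner_secN_diE hp, ← hc]
        simp
      · obtain ⟨z₁, h₁, z₂, h₂, rfl⟩ := Submodule.mem_sup.1 hz
        obtain ⟨a₁, h₁⟩ := P.mem_phiRad hL hp h₁
        obtain ⟨a₂, h₂⟩ := P.mem_phiLtr hL hp h₂
        have e1 : A.metric.inner (L.map p) (P.phiE p) (L.di p y) = 0 := by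
          rw [A.metric.symm, hy]
        have e2 : A.metric.inner (L.map p) (P.phiE p) (P.diE p) = 0 := by
          rw [A.metric.symm]; exact A.inner_phi_self _ _
        have e3 : A.metric.inner (L.map p) (P.phiN p) (L.di p y) = b := by
          rw [A.metric.symm]
        have e4 : A.metric.inner (L.map p) (P.phiN p) (P.diE p) = 0 := by
          rw [A.metric.symm, P.inner_diE_phiN hL hp]
        have e5 : A.metric.inner (L.map p) (P.phiN p) (P.phiE p) = 1 := by
          rw [A.metric.symm, P.inner_phiE_phiN hL hp]
        change A.metric.inner (L.map p) (L.di p (z₁ + z₂))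
          (L.di p (y - b • v - c • P.secE p)) = 0
        simp only [map_sub, map_smul, map_add, hv, hE, h₁, h₂, add_apply, smul_apply, e1, e2, e3,
          e4, e5, P.inner_phiE_phiE hL hp, smul_eq_mul]
        ring
    have : y = y - b • v - c • P.secE p + b • v + c • P.secE p := by abel
    rw [this]
    exact Submodule.add_mem_sup (Submodule.add_mem_sup hy₀ (Submodule.smul_mem _ _ hvmem))
      (Submodule.smul_mem _ _ (P.E_mem p hp))

lemma fieldU_mem_phiLtr : L.fieldU A P p ∈ L.phiLtr A p := by
  refine ⟨-P.secN p, ?_, ?_⟩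
  · rw [P.ltr_eq hp]
    exact Submodule.neg_mem _ (Submodule.mem_span_singleton_self _)
  · have := P.di_fieldU hL hp
    rw [phiN, ← map_neg] at this
    exact this.symm

lemma inner_di_fieldU_phiE :
    A.metric.inner (L.map p) (L.di p (L.fieldU A P p)) (P.phiE p) = -1 := by
  rw [P.di_fieldU hL hp, map_neg, neg_apply, A.metric.symm, P.inner_phiE_phiN hL hp]

lemma add_smul_fieldU_mem_distD (y : TangentSpace 𝓘(ℝ, E) p) :
    y + A.metric.inner (L.map p) (L.di p y) (P.phiE p) • L.fieldU A P p ∈ L.distD A p := by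
  rw [P.mem_distD_iff hL hp, map_add, map_smul, map_add, map_smul, add_apply, smul_apply,
    P.inner_di_fieldU_phiE hL hp]
  simp

lemma isCompl_distD_phiLtr : IsCompl (L.distD A p) (L.phiLtr A p) := by
  refine IsCompl.of_eq ?_ ?_
  · refine (Submodule.eq_bot_iff _).2 fun y hy ↦ ?_
    obtain ⟨hD, hy⟩ := hy
    obtain ⟨a, ha⟩ := P.mem_phiLtr hL hp hy
    have h := (P.mem_distD_iff hL hp).1 hD
    rw [ha, map_smul, smul_apply, A.metric.symm, P.inner_phiE_phiN hL hp, smul_eq_mul,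
      mul_one] at h
    refine L.di_injective p ?_
    rw [ha, h, zero_smul, map_zero]
  · refine eq_top_iff.2 fun y _ ↦ ?_
    set b := A.metric.inner (L.map p) (L.di p y) (P.phiE p)
    have : y = (y + b • L.fieldU A P p) + (-b) • L.fieldU A P p := by
      rw [neg_smul]; abel
    rw [this]
    exact Submodule.add_mem_sup (P.add_smul_fieldU_mem_distD hL hp y)
      (Submodule.smul_mem _ _ (P.fieldU_mem_phiLtr hL hp))

/-- Since g(U, φE) = -1, the component of y in D is y + g(y, φE) U, and φU = N. -/
lemma di_phiM (y : TangentSpace 𝓘(ℝ, E) p) :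
    L.di p (L.phiM A p y) = A.phi (L.map p) (L.di p y)
      + A.metric.inner (L.map p) (L.di p y) (P.phiE p) • P.secN p := by
  set b := A.metric.inner (L.map p) (L.di p y) (P.phiE p) with hb
  have h : projAlong (L.distD A p) (L.phiLtr A p) y = y + b • L.fieldU A P p := by
    have : y = (y + b • L.fieldU A P p) + (-b) • L.fieldU A P p := by
      rw [neg_smul]; abel
    nth_rw 1 [this]
    exact projAlong_eq (P.isCompl_distD_phiLtr hL hp) (P.add_smul_fieldU_mem_distD hL hp y)
      (Submodule.smul_mem _ _ (P.fieldU_mem_phiLtr hL hp))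
  have h2 : A.phi (L.map p) (L.di p (y + b • L.fieldU A P p))
      = A.phi (L.map p) (L.di p y) + b • P.secN p := by
    rw [map_add, map_smul, P.di_fieldU hL hp, map_add, map_smul, map_neg, P.phi_phiN hL hp, neg_neg]
  obtain ⟨z, hz⟩ := P.exists_di_eq hp (w := A.phi (L.map p) (L.di p y) + b • P.secN p) (by
    rw [map_add, map_smul, add_apply, smul_apply, P.inner_secN_diE hp, A.inner_phi_left, ← phiE,
      ← hb]
    simp)
  rw [phiM, h, h2, L.lift_eq hz, hz]

lemma di_phiM_of_mem {y : TangentSpace 𝓘(ℝ, E) p} (hy : y ∈ L.distD A p) :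
    L.di p (L.phiM A p y) = A.phi (L.map p) (L.di p y) := by
  rw [P.di_phiM hL hp, (P.mem_distD_iff hL hp).1 hy, zero_smul, add_zero]

end NullPair

end LightlikeHypersurface

end Hypersurface

/-! ### The Hessian of a map into a manifold with connection -/

section MapHessian

variable {F : Type*} [NormedAddCommGroup F] [NormedSpace ℝ F] [FiniteDimensional ℝ F]
  {Mb : Type*} [TopologicalSpace Mb] [ChartedSpace F Mb] [IsManifold 𝓘(ℝ, F) ∞ Mb]
  {E : Type*} [NormedAddCommGroup E] [NormedSpace ℝ E] [FiniteDimensional ℝ E]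
  {M : Type*} [TopologicalSpace M] [ChartedSpace E M] [IsManifold 𝓘(ℝ, E) ∞ M]
  {H : Type*} [NormedAddCommGroup H] [NormedSpace ℝ H]
  {P : Type*} [TopologicalSpace P] [ChartedSpace H P]

variable (F E) in
/-- The differential of `f` at `q`, in the charts at `p` and at `y`. -/
def chartDeriv (f : M → Mb) (p : M) (y : Mb) (q : M) : E →L[ℝ] F :=
  (chartCoord y (f q)).comp ((mfderiv 𝓘(ℝ, E) 𝓘(ℝ, F) f q).comp (chartVec p q))

variable (F E) in
/-- The map `f` in the charts at `p` and at `y`. -/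
def chartRep (f : M → Mb) (p : M) (y : Mb) (z : E) : F :=
  extChartAt 𝓘(ℝ, F) y (f ((extChartAt 𝓘(ℝ, E) p).symm z))

lemma contMDiffAt_mfderiv_along {f : M → Mb} (hf : ContMDiff 𝓘(ℝ, E) 𝓘(ℝ, F) ∞ f) {c : P → M}
    {V : Π s : P, TangentSpace 𝓘(ℝ, E) (c s)} {s : P}
    (hV : ContMDiffAt 𝓘(ℝ, H) 𝓘(ℝ, E).tangent ∞ (fun s ↦ (⟨c s, V s⟩ : TangentBundle 𝓘(ℝ, E) M)) s) :
    ContMDiffAt 𝓘(ℝ, H) 𝓘(ℝ, F).tangent ∞ (fun s ↦ (⟨f (c s), mfderiv 𝓘(ℝ, E) 𝓘(ℝ, F) f (c s) (V s)⟩ :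
      TangentBundle 𝓘(ℝ, F) Mb)) s :=
  (hf.contMDiff_tangentMap (m := ∞) (by simp)).contMDiffAt.comp s hV

lemma diffAlongAt_mfderiv {f : M → Mb} (hf : ContMDiff 𝓘(ℝ, E) 𝓘(ℝ, F) ∞ f) {c : P → M}
    {V : Π s : P, TangentSpace 𝓘(ℝ, E) (c s)} {s : P} (hV : DiffAlongAt (E := H) c V s) :
    DiffAlongAt (E := H) (fun s ↦ f (c s)) (fun s ↦ mfderiv 𝓘(ℝ, E) 𝓘(ℝ, F) f (c s) (V s)) s :=
  MDifferentiableAt.comp s (g := tangentMap 𝓘(ℝ, E) 𝓘(ℝ, F) f)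
    ((hf.contMDiff_tangentMap (m := ∞) (by simp)).mdifferentiable (by simp) _) hV

lemma contMDiffAt_chartDeriv {f : M → Mb} (hf : ContMDiff 𝓘(ℝ, E) 𝓘(ℝ, F) ∞ f) {p q : M} {y : Mb}
    (hq : q ∈ (chartAt E p).source) (hy : f q ∈ (chartAt F y).source) :
    ContMDiffAt 𝓘(ℝ, E) 𝓘(ℝ, E →L[ℝ] F) ∞ (chartDeriv F E f p y) q := by
  have : IsManifold 𝓘(ℝ, F) (∞ + 1) Mb := ‹IsManifold 𝓘(ℝ, F) ∞ Mb›
  refine contMDiffAt_clm_of_apply fun a ↦ ?_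
  exact ((contMDiffAt_along_iff hy).1
    (contMDiffAt_mfderiv_along hf (c := fun q ↦ q) (contMDiffAt_chartFrame hq a))).2

lemma chartDeriv_eq_fderiv {f : M → Mb} (hf : ContMDiff 𝓘(ℝ, E) 𝓘(ℝ, F) ∞ f) {p q : M} {y : Mb}
    (hq : q ∈ (chartAt E p).source) (hy : f q ∈ (chartAt F y).source) :
    chartDeriv F E f p y q = fderiv ℝ (chartRep F E f p y) (extChartAt 𝓘(ℝ, E) p q) := by
  ext a
  have h1 : ContMDiffAt 𝓘(ℝ, F) 𝓘(ℝ, F) ∞ (extChartAt 𝓘(ℝ, F) y) (f q) :=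
    contMDiffAt_extChartAt' hy
  have h2 := mvfderiv_apply_chartFrame hq (h1.comp q hf.contMDiffAt) a
  have h3 : mfderiv 𝓘(ℝ, E) 𝓘(ℝ, F) (extChartAt 𝓘(ℝ, F) y ∘ f) q
      = (mfderiv 𝓘(ℝ, F) 𝓘(ℝ, F) (extChartAt 𝓘(ℝ, F) y) (f q)).comp
        (mfderiv 𝓘(ℝ, E) 𝓘(ℝ, F) f q) :=
    mfderiv_comp q (h1.mdifferentiableAt (by simp)) (hf.contMDiffAt.mdifferentiableAt (by simp))
  refine Eq.trans ?_ h2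
  rw [chartDeriv, chartCoord_eq_mfderiv hy]
  exact (DFunLike.congr_fun h3 (chartFrame p a q)).symm

lemma contDiffAt_chartRep {f : M → Mb} (hf : ContMDiff 𝓘(ℝ, E) 𝓘(ℝ, F) ∞ f) {p q : M} {y : Mb}
    (hq : q ∈ (chartAt E p).source) (hy : f q ∈ (chartAt F y).source) :
    ContDiffAt ℝ ∞ (chartRep F E f p y) (extChartAt 𝓘(ℝ, E) p q) :=
  contDiffAt_comp_extChartAt_symm hq
    ((contMDiffAt_extChartAt' hy).comp q hf.contMDiffAt)

lemma eventually_mem_chart {f : M → Mb} (hf : Continuous f) {p q : M} {y : Mb}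
    (hq : q ∈ (chartAt E p).source) (hy : f q ∈ (chartAt F y).source) :
    ∀ᶠ z in 𝓝 (extChartAt 𝓘(ℝ, E) p q), z ∈ (extChartAt 𝓘(ℝ, E) p).target ∧
      (extChartAt 𝓘(ℝ, E) p).symm z ∈ (chartAt E p).source ∧
      f ((extChartAt 𝓘(ℝ, E) p).symm z) ∈ (chartAt F y).source := by
  have hq' : q ∈ (extChartAt 𝓘(ℝ, E) p).source := by simpa using hq
  have h1 : ContinuousAt (extChartAt 𝓘(ℝ, E) p).symm (extChartAt 𝓘(ℝ, E) p q) :=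
    continuousAt_extChartAt_symm' hq'
  have e := (extChartAt 𝓘(ℝ, E) p).left_inv hq'
  have h2 := (hf.continuousAt.comp h1).eventually
    (eventually_mem_source (F := F) (x₀ := y) (by rw [Function.comp_apply, e]; exact hy))
  have h3 := h1.eventually (eventually_mem_source (F := E) (x₀ := p) (by rw [e]; exact hq))
  have h4 : ∀ᶠ z in 𝓝 (extChartAt 𝓘(ℝ, E) p q), z ∈ (extChartAt 𝓘(ℝ, E) p).target :=
    extChartAt_target_mem_nhds' ((extChartAt 𝓘(ℝ, E) p).map_source hq')
  filter_upwards [h2, h3, h4] with z a b c using ⟨c, b, a⟩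

lemma mvfderiv_chartDeriv {f : M → Mb} (hf : ContMDiff 𝓘(ℝ, E) 𝓘(ℝ, F) ∞ f) (p : M)
    (v : TangentSpace 𝓘(ℝ, E) p) :
    mvfderiv 𝓘(ℝ, E) (chartDeriv F E f p (f p)) p v
      = fderiv ℝ (fderiv ℝ (chartRep F E f p (f p))) (extChartAt 𝓘(ℝ, E) p p) v := by
  have h1 := mem_chart_source E p
  have h2 := mem_chart_source F (f p)
  rw [mvfderiv_eq_fderiv ((contMDiffAt_chartDeriv hf h1 h2).mdifferentiableAt (by simp))]
  refine congrArg (fun L : E →L[ℝ] E →L[ℝ] F ↦ L v) (Filter.EventuallyEq.fderiv_eq ?_)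
  filter_upwards [eventually_mem_chart hf.continuous h1 h2] with z hz
  rw [chartDeriv_eq_fderiv hf hz.2.1 hz.2.2, (extChartAt 𝓘(ℝ, E) p).right_inv hz.1]

/-- A tangent space is the model space itself, identified through the preferred chart at its base
point, so that chart acts there as the identity. -/
lemma chartCoord_self_apply (p : M) (v : TangentSpace 𝓘(ℝ, E) p) : chartCoord p p v = v := by
  rw [chartCoord_eq_mfderiv (mem_chart_source E p), mfderiv_extChartAt_self]
  rfl

end MapHessian

section MapHessian

variable {F : Type*} [NormedAddCommGroup F] [NormedSpace ℝ F] [FiniteDimensional ℝ F]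
  {Mb : Type*} [TopologicalSpace Mb] [ChartedSpace F Mb] [IsManifold 𝓘(ℝ, F) ∞ Mb]
  {E : Type*} [NormedAddCommGroup E] [NormedSpace ℝ E] [FiniteDimensional ℝ E]
  {M : Type*} [TopologicalSpace M] [ChartedSpace E M] [IsManifold 𝓘(ℝ, E) ∞ M]
  {H : Type*} [NormedAddCommGroup H] [NormedSpace ℝ H]
  {P : Type*} [TopologicalSpace P] [ChartedSpace H P]
  (nabla : CovariantDerivative 𝓘(ℝ, F) F (TangentSpace 𝓘(ℝ, F) : Mb → Type _))

/-- The derivative in the direction `v` of the image under `df` of the frame field of the chart at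
`p` extending `y`. -/
def mapHessian (f : M → Mb) (p : M) (v y : TangentSpace 𝓘(ℝ, E) p) :
    TangentSpace 𝓘(ℝ, F) (f p) :=
  chartVec (f p) (f p) (mvfderiv 𝓘(ℝ, E) (chartDeriv F E f p (f p)) p v (chartCoord p p y))
    + nabla (chartFrame (f p) (chartCoord (f p) (f p) (mfderiv 𝓘(ℝ, E) 𝓘(ℝ, F) f p y))) (f p)
      (mfderiv 𝓘(ℝ, E) 𝓘(ℝ, F) f p v)

lemma eventually_chartCoord_mfderiv {f : M → Mb} {c : P → M} {s : P} (hc : ContinuousAt c s)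
    (V : Π s : P, TangentSpace 𝓘(ℝ, E) (c s)) :
    (fun s' ↦ chartCoord (f (c s)) (f (c s')) (mfderiv 𝓘(ℝ, E) 𝓘(ℝ, F) f (c s') (V s')))
      =ᶠ[𝓝 s] fun s' ↦ chartDeriv F E f (c s) (f (c s)) (c s') (chartCoord (c s) (c s') (V s')) := by
  filter_upwards [hc (eventually_mem_source (mem_chart_source E (c s)))] with s' hs'
  simp [chartDeriv, chartVec_chartCoord hs']

lemma chartDeriv_self_apply (f : M → Mb) (p : M) (a : E) :
    chartVec (f p) (f p) (chartDeriv F E f p (f p) p a)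
      = mfderiv 𝓘(ℝ, E) 𝓘(ℝ, F) f p (chartVec p p a) :=
  chartVec_chartCoord (mem_chart_source F (f p)) _

/-- The derivative of the image under `df` of a vector field along a map into the source. -/
lemma covAlong_mfderiv {f : M → Mb} (hf : ContMDiff 𝓘(ℝ, E) 𝓘(ℝ, F) ∞ f) {c : P → M}
    {V : Π s : P, TangentSpace 𝓘(ℝ, E) (c s)} {s : P} (hV : DiffAlongAt (E := H) c V s)
    (v : TangentSpace 𝓘(ℝ, H) s) :
    covAlong (fun Y x w ↦ nabla Y x w) (fun s ↦ f (c s))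
        (fun s ↦ mfderiv 𝓘(ℝ, E) 𝓘(ℝ, F) f (c s) (V s)) s v
      = mfderiv 𝓘(ℝ, E) 𝓘(ℝ, F) f (c s) (chartVec (c s) (c s)
          (mvfderiv 𝓘(ℝ, H) (fun s' ↦ chartCoord (c s) (c s') (V s')) s v))
        + mapHessian nabla f (c s) (mfderiv 𝓘(ℝ, H) 𝓘(ℝ, E) c s v) (V s) := by
  have h1 := mem_chart_source E (c s)
  have h2 := mem_chart_source F (f (c s))
  obtain ⟨hc, hV'⟩ := (diffAlongAt_iff h1).1 hV
  have hJ := (contMDiffAt_chartDeriv hf h1 h2).mdifferentiableAt (by simp)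
  have hfc : mfderiv 𝓘(ℝ, H) 𝓘(ℝ, F) (fun s ↦ f (c s)) s
      = (mfderiv 𝓘(ℝ, E) 𝓘(ℝ, F) f (c s)).comp (mfderiv 𝓘(ℝ, H) 𝓘(ℝ, E) c s) :=
    mfderiv_comp s (hf.contMDiffAt.mdifferentiableAt (by simp)) hc
  rw [covAlong_eq_chart nabla (f := fun s ↦ f (c s)) h2 (diffAlongAt_mfderiv (c := c) hf hV),
    (eventually_chartCoord_mfderiv hc.continuousAt V).mvfderiv_apply_eq,
    mvfderiv_clm_apply (A := fun s' ↦ chartDeriv F E f (c s) (f (c s)) (c s')) (hJ.comp s hc) hV',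
    mvfderiv_fun_comp_apply hJ hc, map_add, chartDeriv_self_apply, mapHessian, hfc]
  simp only [ContinuousLinearMap.comp_apply]
  abel

lemma covAlong_mfderiv_field {f : M → Mb} (hf : ContMDiff 𝓘(ℝ, E) 𝓘(ℝ, F) ∞ f)
    {Y : Π q : M, TangentSpace 𝓘(ℝ, E) q} {p : M} (hY : DiffFieldAt Y p)
    (v : TangentSpace 𝓘(ℝ, E) p) :
    covAlong (fun Y x w ↦ nabla Y x w) f (fun q ↦ mfderiv 𝓘(ℝ, E) 𝓘(ℝ, F) f q (Y q)) p v
      = mfderiv 𝓘(ℝ, E) 𝓘(ℝ, F) f p (chartVec p p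
          (mvfderiv 𝓘(ℝ, E) (fun q ↦ chartCoord p q (Y q)) p v))
        + mapHessian nabla f p v (Y p) := by
  have h := covAlong_mfderiv nabla hf (c := fun q ↦ q) (V := Y) hY v
  have h3 : mfderiv 𝓘(ℝ, E) 𝓘(ℝ, E) (fun y : M ↦ y) p = ContinuousLinearMap.id ℝ _ :=
    mfderiv_id
  rw [h3] at h
  exact h

lemma covAlong_mfderiv_extend {f : M → Mb} (hf : ContMDiff 𝓘(ℝ, E) 𝓘(ℝ, F) ∞ f) {p : M}
    (v y : TangentSpace 𝓘(ℝ, E) p) :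
    covAlong (fun Y x w ↦ nabla Y x w) f
        (fun q ↦ mfderiv 𝓘(ℝ, E) 𝓘(ℝ, F) f q (FiberBundle.extend E y q)) p v
      = mapHessian nabla f p v y := by
  have h1 := mem_chart_source E p
  have h : (fun q ↦ chartCoord p q (FiberBundle.extend E y q))
      =ᶠ[𝓝 p] fun q ↦ chartCoord p q (chartFrame p (chartCoord p p y) q) := by
    filter_upwards [eventually_mem_source h1] with q hq
    rw [extend_apply_eq_chartFrame hq]
  rw [covAlong_mfderiv_field nabla hf (Y := FiberBundle.extend E y)
    (FiberBundle.mdifferentiableAt_extend 𝓘(ℝ, E) E y), h.mvfderiv_apply_eq,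
    mvfderiv_chartCoord_chartFrame h1, map_zero, map_zero, zero_add, FiberBundle.extend_apply_self]

lemma mapHessian_add_left (f : M → Mb) (p : M) (v w y : TangentSpace 𝓘(ℝ, E) p) :
    mapHessian nabla f p (v + w) y = mapHessian nabla f p v y + mapHessian nabla f p w y := by
  simp only [mapHessian, map_add, add_apply]
  abel

lemma mapHessian_smul_left (f : M → Mb) (p : M) (a : ℝ) (v y : TangentSpace 𝓘(ℝ, E) p) :
    mapHessian nabla f p (a • v) y = a • mapHessian nabla f p v y := by
  simp only [mapHessian, map_smul, smul_apply, smul_add]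

variable {nabla} {g : SemiRiemannianMetric F Mb}

/-- The first term is the second derivative of f in charts, symmetric by smoothness; the second is
symmetric because chart frames commute and the connection has no torsion. -/
lemma mapHessian_symm (h : IsLeviCivita g nabla) {f : M → Mb}
    (hf : ContMDiff 𝓘(ℝ, E) 𝓘(ℝ, F) ∞ f) (p : M) (v y : TangentSpace 𝓘(ℝ, E) p) :
    mapHessian nabla f p v y = mapHessian nabla f p y v := by
  have h1 := mem_chart_source E p
  have h2 := mem_chart_source F (f p)
  have hs := ((contDiffAt_chartRep hf h1 h2).isSymmSndFDerivAt (n := ∞)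
    (by rw [minSmoothness_of_isRCLikeNormedField]; exact ENat.LEInfty.out)).eq
  have h3 := h.chartFrame_comm h2 (chartCoord (f p) (f p) (mfderiv 𝓘(ℝ, E) 𝓘(ℝ, F) f p y))
    (chartCoord (f p) (f p) (mfderiv 𝓘(ℝ, E) 𝓘(ℝ, F) f p v))
  rw [chartFrame_self, chartFrame_self] at h3
  have h4 : mvfderiv 𝓘(ℝ, E) (chartDeriv F E f p (f p)) p v (chartCoord p p y)
      = mvfderiv 𝓘(ℝ, E) (chartDeriv F E f p (f p)) p y (chartCoord p p v) := by
    rw [mvfderiv_chartDeriv hf, mvfderiv_chartDeriv hf]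
    have e (v : TangentSpace 𝓘(ℝ, E) p) : chartCoord p p v = v := chartCoord_self_apply p v
    rw [e v, e y]
    exact hs _ _
  rw [mapHessian, mapHessian, h4, h3]

end MapHessian

/-! ### The local second fundamental form, and its place in the derivatives of φ and N -/

section SecondFundamentalForm

variable {F : Type*} [NormedAddCommGroup F] [NormedSpace ℝ F] [FiniteDimensional ℝ F]
  {Mb : Type*} [TopologicalSpace Mb] [ChartedSpace F Mb] [IsManifold 𝓘(ℝ, F) ∞ Mb]
  {E : Type*} [NormedAddCommGroup E] [NormedSpace ℝ E] [FiniteDimensional ℝ E]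
  {M : Type*} [TopologicalSpace M] [ChartedSpace E M] [IsManifold 𝓘(ℝ, E) ∞ M]
  {nabla : CovariantDerivative 𝓘(ℝ, F) F (TangentSpace 𝓘(ℝ, F) : Mb → Type _)}

lemma covAlong_neg (nabla : CovariantDerivative 𝓘(ℝ, F) F (TangentSpace 𝓘(ℝ, F) : Mb → Type _))
    {f : M → Mb} {V : Π q : M, TangentSpace 𝓘(ℝ, F) (f q)} {p : M}
    (hV : DiffAlongAt (E := E) f V p) (v : TangentSpace 𝓘(ℝ, E) p) :
    covAlong (fun Y x w ↦ nabla Y x w) f (fun q ↦ -V q) p v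
      = -covAlong (fun Y x w ↦ nabla Y x w) f V p v := by
  have hx := mem_chart_source F (f p)
  obtain ⟨h1, h2⟩ := (diffAlongAt_iff hx).1 hV
  have hneg : DiffAlongAt (E := E) f (fun q ↦ -V q) p := by
    refine (diffAlongAt_iff hx).2 ⟨h1, ?_⟩
    simp only [map_neg]
    exact h2.neg
  have e : (fun q ↦ chartCoord (f p) (f q) (-V q)) = -fun q ↦ chartCoord (f p) (f q) (V q) := by
    ext q; simp
  have e2 (a : F) : chartFrame (f p) (-a) = (-1 : ℝ) • chartFrame (f p) a := by
    ext q; simp [chartFrame]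
  rw [covAlong_eq_chart nabla hx hneg, covAlong_eq_chart nabla hx hV, e, mvfderiv_neg, map_neg, e2,
    nabla.isCovariantDerivativeOnUniv.smul_const _ (diffFieldAt_chartFrame hx _)]
  simp only [neg_apply, map_neg, neg_smul, one_smul]
  abel

namespace LightlikeHypersurface

namespace NullPair

section

variable {g : SemiRiemannianMetric F Mb} {L : LightlikeHypersurface E M g} (P : L.NullPair) {p : M}

variable (nabla) in
/-- The local second fundamental form `B(v, y) = g(∇_v y, E)`. -/
def sff (p : M) (v y : TangentSpace 𝓘(ℝ, E) p) : ℝ :=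
  g.inner (L.map p) (mapHessian nabla L.map p v y) (P.diE p)

lemma sff_symm (h : IsLeviCivita g nabla) (v y : TangentSpace 𝓘(ℝ, E) p) :
    P.sff nabla p v y = P.sff nabla p y v := by
  rw [sff, mapHessian_symm h L.contMDiff_map, sff]

/-- Additivity is immediate only in the direction of differentiation; symmetry transfers it. -/
lemma sff_add_right (h : IsLeviCivita g nabla) (v y z : TangentSpace 𝓘(ℝ, E) p) :
    P.sff nabla p v (y + z) = P.sff nabla p v y + P.sff nabla p v z := by
  rw [P.sff_symm h, P.sff_symm h v, P.sff_symm h v, sff, mapHessian_add_left, map_add, add_apply]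
  rfl

lemma sff_smul_right (h : IsLeviCivita g nabla) (a : ℝ) (v y : TangentSpace 𝓘(ℝ, E) p) :
    P.sff nabla p v (a • y) = a * P.sff nabla p v y := by
  rw [P.sff_symm h, P.sff_symm h v, sff, mapHessian_smul_left, map_smul, smul_apply]
  rfl

/-- Polarization: a second fundamental form that vanishes on the diagonal vanishes. -/
lemma sff_eq_zero_of_diag (h : IsLeviCivita g nabla) (h0 : ∀ v, P.sff nabla p v v = 0)
    (v y : TangentSpace 𝓘(ℝ, E) p) : P.sff nabla p v y = 0 := by
  have h1 := h0 (v + y)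
  rw [P.sff_add_right h, P.sff_symm h _ v, P.sff_symm h _ y, P.sff_add_right h,
    P.sff_add_right h, h0, h0, P.sff_symm h y v] at h1
  linarith

variable (hp : p ∈ P.dom)
include hp

lemma eventually_mem_dom : ∀ᶠ q in 𝓝 p, q ∈ P.dom := P.isOpen_dom.mem_nhds hp

lemma contMDiffAt_diE : ContMDiffAt 𝓘(ℝ, E) 𝓘(ℝ, F).tangent ∞
    (fun q ↦ (⟨L.map q, P.diE q⟩ : TangentBundle 𝓘(ℝ, F) Mb)) p :=
  contMDiffAt_mfderiv_along L.contMDiff_map (c := fun q ↦ q)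
    (P.smooth_E.contMDiffAt (P.isOpen_dom.mem_nhds hp))

lemma contMDiffAt_secN : ContMDiffAt 𝓘(ℝ, E) 𝓘(ℝ, F).tangent ∞
    (fun q ↦ (⟨L.map q, P.secN q⟩ : TangentBundle 𝓘(ℝ, F) Mb)) p :=
  P.smooth_N.contMDiffAt (P.isOpen_dom.mem_nhds hp)

lemma diffAlongAt_diE : DiffAlongAt (E := E) L.map P.diE p :=
  (P.contMDiffAt_diE hp).mdifferentiableAt (by simp)

lemma diffAlongAt_secN : DiffAlongAt (E := E) L.map P.secN p :=
  (P.contMDiffAt_secN hp).mdifferentiableAt (by simp)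

/-- Differentiating g(V, E) = 0 gives g(∇V, E) = -g(V, ∇E), which sees only the value of V at `p`;
so V may be exchanged for the image of a chart frame extending `z`. No differentiability of a
tangent lift of V is required, which suits U, defined pointwise through `lift`. -/
lemma inner_covAlong_diE (h : IsLeviCivita g nabla) {V : Π q : M, TangentSpace 𝓘(ℝ, F) (L.map q)}
    (hV : DiffAlongAt (E := E) L.map V p)
    (ht : ∀ᶠ q in 𝓝 p, g.inner (L.map q) (V q) (P.diE q) = 0) {z : TangentSpace 𝓘(ℝ, E) p}
    (hz : L.di p z = V p) (v : TangentSpace 𝓘(ℝ, E) p) :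
    g.inner (L.map p) (L.ambientCov nabla V p v) (P.diE p) = P.sff nabla p v z := by
  have key {V : Π q : M, TangentSpace 𝓘(ℝ, F) (L.map q)} (hV : DiffAlongAt (E := E) L.map V p)
      (ht : ∀ᶠ q in 𝓝 p, g.inner (L.map q) (V q) (P.diE q) = 0) :
      g.inner (L.map p) (L.ambientCov nabla V p v) (P.diE p)
        = -g.inner (L.map p) (V p) (L.ambientCov nabla P.diE p v) := by
    have h1 := h.mvfderiv_inner_along hV (P.diffAlongAt_diE hp) v
    have h2 : (fun q ↦ g.inner (L.map q) (V q) (P.diE q)) =ᶠ[𝓝 p] fun _ ↦ (0 : ℝ) := ht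
    rw [h2.mvfderiv_apply_eq, mvfderiv_const] at h1
    exact eq_neg_of_add_eq_zero_left h1.symm
  have hW : DiffAlongAt (E := E) L.map (fun q ↦ L.di q (FiberBundle.extend E z q)) p :=
    diffAlongAt_mfderiv L.contMDiff_map (c := fun q ↦ q)
      (FiberBundle.mdifferentiableAt_extend 𝓘(ℝ, E) E z)
  have h2 := key hW (by
    filter_upwards [P.eventually_mem_dom hp] with q hq using P.inner_di_diE hq _)
  rw [FiberBundle.extend_apply_self] at h2
  rw [key hV ht, ← hz, ← h2, sff, ← covAlong_mfderiv_extend nabla L.contMDiff_map]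
  rfl

lemma inner_ambientCov_di (h : IsLeviCivita g nabla) {Y : Π q : M, TangentSpace 𝓘(ℝ, E) q}
    (hY : DiffFieldAt Y p) (v : TangentSpace 𝓘(ℝ, E) p) :
    g.inner (L.map p) (L.ambientCov nabla (fun q ↦ L.di q (Y q)) p v) (P.diE p)
      = P.sff nabla p v (Y p) := by
  refine P.inner_covAlong_diE hp h (diffAlongAt_mfderiv L.contMDiff_map (c := fun q ↦ q) hY) ?_
    rfl v
  filter_upwards [P.eventually_mem_dom hp] with q hq using P.inner_di_diE hq _

end

variable {r : ℕ} {A : IndefiniteGFF F Mb r} {L : LightlikeHypersurface E M A.metric}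
  (P : L.NullPair) {p : M} (hL : L.IsCharacteristic A) (hp : p ∈ P.dom)

include hL hp

lemma phiN_ne_zero : P.phiN p ≠ 0 := fun h ↦ by
  have := P.inner_phiE_phiN hL hp
  rw [h, map_zero] at this
  exact zero_ne_one this

lemma etaSum_diE : A.etaSum (L.map p) (P.diE p) = 0 := by
  simp [IndefiniteGFF.etaSum, P.eta_diE hL hp]

/-- Both terms of the ambient formula are tangent to M: ξ is, and φ²X differs from -X by multiples
of the ξ_α. Hence ∇̄φ̄ contributes no transversal part. -/
lemma inner_covPhi_diE (h : IsLeviCivita A.metric nabla) (hA : A.IsSManifold) (hr : 0 < r)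
    (v : TangentSpace 𝓘(ℝ, E) p) (w : TangentSpace 𝓘(ℝ, F) (L.map p)) :
    A.metric.inner (L.map p) (A.covPhi nabla (L.map p) (L.di p v) w) (P.diE p) = 0 := by
  have h1 : A.metric.inner (L.map p) (A.phi (L.map p) (A.phi (L.map p) (L.di p v))) (P.diE p)
      = 0 := by
    rw [A.inner_phi_left, A.compat, P.inner_di_diE hp]
    simp [P.eta_diE hL hp]
  rw [A.covPhi_eq h hA hr, map_add, map_smul, map_smul, add_apply, smul_apply, smul_apply,
    ← A.etaSum_eq_inner, P.etaSum_diE hL hp, h1]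
  simp

/-- The derivative of the induced tensor field in terms of the second fundamental form. -/
lemma di_covPhiM (h : IsLeviCivita A.metric nabla) (hA : A.IsSManifold) (hr : 0 < r)
    {Y : Π q : M, TangentSpace 𝓘(ℝ, E) q} (hY : DiffFieldAt Y p)
    (hD : ∀ᶠ q in 𝓝 p, Y q ∈ L.distD A q) (v : TangentSpace 𝓘(ℝ, E) p) :
    L.di p (L.covPhiM A nabla Y p v)
      = A.covPhi nabla (L.map p) (L.di p v) (L.di p (Y p))
        + P.sff nabla p v (Y p) • P.phiN p := by
  have hdY : DiffAlongAt (E := E) L.map (fun q ↦ L.di q (Y q)) p :=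
    diffAlongAt_mfderiv L.contMDiff_map (c := fun q ↦ q) hY
  have h1 : L.ambientCov nabla (fun q ↦ L.di q (L.phiM A q (Y q))) p v
      = A.covPhi nabla (L.map p) (L.di p v) (L.di p (Y p))
        + A.phi (L.map p) (L.ambientCov nabla (fun q ↦ L.di q (Y q)) p v) := by
    have he : ∀ᶠ q in 𝓝 p, L.di q (L.phiM A q (Y q)) = A.phi (L.map q) (L.di q (Y q)) := by
      filter_upwards [hD, P.eventually_mem_dom hp] with q h1 h2 using P.di_phiM_of_mem hL h2 h1
    rw [ambientCov, covAlong_congr he, covAlong_endo A.phi_smooth hdY]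
    rfl
  set b := P.sff nabla p v (Y p) with hb
  set C := L.ambientCov nabla (fun q ↦ L.di q (Y q)) p v with hC
  have h2 : L.di p (L.inducedCov nabla Y p v) = C - b • P.secN p := by
    rw [inducedCov, P.di_tangentPart hp, P.inner_ambientCov_di hp h hY]
  -- With C = ∇_v Y + bN, the term φC is common to both halves of (∇φ)Y and cancels, as do the
  -- corrections along N. What survives besides ∇̄φ̄ is b φN, from applying φ to the transversal
  -- part of C.
  rw [covPhiM, map_sub, P.di_phiM hL hp, h2, inducedCov, P.di_tangentPart hp, h1]
  simp only [map_add, map_sub, map_smul, add_apply, sub_apply, smul_apply,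
    P.inner_covPhi_diE hL hp h hA hr, A.inner_phi_left, P.inner_secN_phiE hL hp]
  rw [← phiN, ← phiE, smul_zero, sub_zero, zero_add]
  rw [neg_smul]
  abel

/-- The formula for ∇̄φ̄ on ξ_α determines φ(∇ξ_α). That suffices here: N = -φ(φN), and skewness
moves the outer φ onto ∇ξ_α. -/
lemma inner_nabla_xi_secN (h : IsLeviCivita A.metric nabla) (hA : A.IsSManifold) (hr : 0 < r)
    (α : Fin r) (v : TangentSpace 𝓘(ℝ, F) (L.map p)) :
    A.metric.inner (L.map p) (nabla (A.xi α) (L.map p) v) (P.secN p)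
      = A.eps α * A.metric.inner (L.map p) v (P.phiN p) := by
  have h1 := A.covPhi_xi (nabla := nabla) (L.map p) α v
  have h3 : A.etaSum (L.map p) (A.xi α (L.map p)) = A.eps α := by
    simp [IndefiniteGFF.etaSum, A.eta_xi]
  rw [A.covPhi_eq h hA hr, A.phi_xi, map_zero, zero_smul, zero_add, h3] at h1
  have h2 : P.secN p = -A.phi (L.map p) (P.phiN p) := by rw [P.phi_phiN hL hp, neg_neg]
  nth_rw 1 [h2]
  rw [map_neg, ← A.inner_phi_left, ← neg_inj, ← neg_apply, ← map_neg, ← h1, map_smul, smul_apply,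
    phiN, A.compat, A.inner_phi_left]
  simp [A.eta_phi]

/-- The shape operator in terms of the second fundamental form. -/
lemma di_shape (h : IsLeviCivita A.metric nabla) (hA : A.IsSManifold) (hr : 0 < r)
    (v : TangentSpace 𝓘(ℝ, E) p) :
    L.di p (L.shape nabla P.secN p v)
      = -L.di p (L.phiM A p (L.inducedCov nabla (L.fieldU A P) p v))
        - A.metric.inner (L.map p) (L.di p v) (L.di p (L.fieldU A P p)) • A.xiSum (L.map p)
        - P.sff nabla p v (L.fieldU A P p) • P.phiN p := by
  have hN := P.diffAlongAt_secN hp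
  have hphiN : DiffAlongAt (E := E) L.map P.phiN p := diffAlongAt_endo A.phi_smooth hN
  have hneg : DiffAlongAt (E := E) L.map (fun q ↦ -P.phiN q) p := by
    obtain ⟨h1, h2⟩ := (diffAlongAt_iff (mem_chart_source F (L.map p))).1 hphiN
    refine (diffAlongAt_iff (mem_chart_source F (L.map p))).2 ⟨h1, ?_⟩
    simp only [map_neg]
    exact h2.neg
  set C := L.ambientCov nabla P.secN p v with hC
  set W := L.ambientCov nabla (fun q ↦ L.di q (L.fieldU A P q)) p v with hW
  set b := P.sff nabla p v (L.fieldU A P p) with hb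
  have hUeq : ∀ᶠ q in 𝓝 p, L.di q (L.fieldU A P q) = -P.phiN q := by
    filter_upwards [P.eventually_mem_dom hp] with q hq using P.di_fieldU hL hq
  have hWb : A.metric.inner (L.map p) W (P.diE p) = b := by
    rw [hW, ambientCov, covAlong_congr hUeq]
    refine P.inner_covAlong_diE hp h hneg ?_ (P.di_fieldU hL hp) v
    filter_upwards [P.eventually_mem_dom hp] with q hq
    rw [map_neg, neg_apply, A.metric.symm, P.inner_diE_phiN hL hq, neg_zero]
  have hWeq : W = -(A.covPhi nabla (L.map p) (L.di p v) (P.secN p) + A.phi (L.map p) C) := by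
    rw [hW, ambientCov, covAlong_congr hUeq, covAlong_neg nabla hphiN]
    exact congrArg Neg.neg (covAlong_endo A.phi_smooth hN v)
  -- Differentiate g(ξ_α, N) = 0. The answer g(X, U) is the same for every α, so these components
  -- assemble into g(X, U) ξ.
  have heta (α : Fin r) : A.eta α (L.map p) C
      = A.metric.inner (L.map p) (L.di p v) (L.di p (L.fieldU A P p)) := by
    have hxi : DiffAlongAt (E := E) L.map (fun q ↦ A.xi α (L.map q)) p :=
      MDifferentiableAt.comp p (A.diffFieldAt_xi α (L.map p))
        (L.contMDiff_map.contMDiffAt.mdifferentiableAt (by simp))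
    have h1 := h.mvfderiv_inner_along hxi hN v
    have h2 : (fun q ↦ A.metric.inner (L.map q) (A.xi α (L.map q)) (P.secN q))
        =ᶠ[𝓝 p] fun _ ↦ (0 : ℝ) := by
      filter_upwards [P.eventually_mem_dom hp] with q hq
      rw [A.metric.symm, A.inner_xi, P.eta_secN hL hq, mul_zero]
    rw [h2.mvfderiv_apply_eq, mvfderiv_const, covAlong_comp_field nabla
      (L.contMDiff_map.contMDiffAt.mdifferentiableAt (by simp)) (A.diffFieldAt_xi α (L.map p)),
      P.inner_nabla_xi_secN hL hp h hA hr] at h1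
    rw [A.eta_eq_inner, P.di_fieldU hL hp, map_neg]
    have h3 := A.eps_mul_eps α
    have h4 : A.metric.inner (L.map p) (A.xi α (L.map p)) C
        = -(A.eps α * A.metric.inner (L.map p) (L.di p v) (P.phiN p)) :=
      eq_neg_of_add_eq_zero_right h1.symm
    rw [h4]
    linear_combination -(A.metric.inner (L.map p) (L.di p v) (P.phiN p)) * h3
  set m := A.metric.inner (L.map p) (L.di p v) (L.di p (L.fieldU A P p)) with hm
  -- As η(N) = 0, the term ∇̄φ̄ in `hWeq` is a multiple of ξ and is killed by φ, leaving -φ²C. Thus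
  -- ∇̄N is recovered from φ(∇̄U), up to the ξ-component.
  have hphiW : A.phi (L.map p) W = C - m • A.xiSum (L.map p) := by
    have h0 : A.phi (L.map p) (A.xiSum (L.map p)) = 0 := by
      simp [IndefiniteGFF.xiSum, A.phi_xi]
    have h1 : A.etaSum (L.map p) (P.secN p) = 0 := by
      simp [IndefiniteGFF.etaSum, P.eta_secN hL hp]
    rw [hWeq, A.covPhi_eq h hA hr, h1, zero_smul, add_zero, map_neg, map_add, map_smul, h0,
      smul_zero, zero_add, A.phi_sq]
    simp only [heta, IndefiniteGFF.xiSum, Finset.smul_sum]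
    abel
  have hWE : A.metric.inner (L.map p) W (P.phiE p)
      = -A.metric.inner (L.map p) C (P.diE p) := by
    rw [phiE, ← neg_eq_iff_eq_neg, ← A.inner_phi_left, hphiW, map_sub, map_smul, sub_apply,
      smul_apply, ← A.etaSum_eq_inner, P.etaSum_diE hL hp, smul_zero, sub_zero]
  have h2 : L.di p (L.inducedCov nabla (L.fieldU A P) p v) = W - b • P.secN p := by
    rw [inducedCov, P.di_tangentPart hp, hWb]
  rw [shape, map_neg, P.di_tangentPart hp, P.di_phiM hL hp, h2]
  simp only [map_sub, map_smul, sub_apply, smul_apply, hphiW, hWE, P.inner_secN_phiE hL hp]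
  rw [← phiN, smul_zero, sub_zero, neg_smul]
  abel

end NullPair

end LightlikeHypersurface

end SecondFundamentalForm

/-! ### The two conditions say that the second fundamental form vanishes -/

section Conditions

variable {F : Type*} [NormedAddCommGroup F] [NormedSpace ℝ F] [FiniteDimensional ℝ F]
  {Mb : Type*} [TopologicalSpace Mb] [ChartedSpace F Mb] [IsManifold 𝓘(ℝ, F) ∞ Mb]
  {E : Type*} [NormedAddCommGroup E] [NormedSpace ℝ E] [FiniteDimensional ℝ E]
  {M : Type*} [TopologicalSpace M] [ChartedSpace E M] [IsManifold 𝓘(ℝ, E) ∞ M]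
  {nabla : CovariantDerivative 𝓘(ℝ, F) F (TangentSpace 𝓘(ℝ, F) : Mb → Type _)}

namespace LightlikeHypersurface

variable {r : ℕ} {A : IndefiniteGFF F Mb r} {L : LightlikeHypersurface E M A.metric}

namespace NullPair

variable (P : L.NullPair) {p : M} (hL : L.IsCharacteristic A) (hp : p ∈ P.dom)

include hL hp

/-- Vectors of `D` extend to smooth sections of `D`. -/
lemma exists_smooth_section_distD [T2Space M] {y : TangentSpace 𝓘(ℝ, E) p}
    (hy : y ∈ L.distD A p) :
    ∃ Y : Π q : M, TangentSpace 𝓘(ℝ, E) q, SmoothFieldOn Y Set.univ ∧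
      (∀ q, Y q ∈ L.distD A q) ∧ Y p = y := by
  set W := chartFrame p (chartCoord p p y) with hW
  set X := chartFrame p (chartCoord p p (L.fieldU A P p)) with hX
  set O : Set M := P.dom ∩ (chartAt E p).source with hO
  have hOo : IsOpen O := P.isOpen_dom.inter (chartAt E p).open_source
  have hsm {b : E} (q : M) (hq : q ∈ O) : ContMDiffAt 𝓘(ℝ, E) 𝓘(ℝ, ℝ) ∞
      (fun q ↦ A.metric.inner (L.map q) (L.di q (chartFrame p b q)) (P.phiE q)) q :=
    A.metric.contMDiffAt_inner
      (contMDiffAt_mfderiv_along L.contMDiff_map (c := fun q ↦ q) (contMDiffAt_chartFrame hq.2 _))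
      (contMDiffAt_endo_along A.phi_smooth (P.contMDiffAt_diE hq.1))
  set h : M → ℝ := fun q ↦ A.metric.inner (L.map q) (L.di q (X q)) (P.phiE q) with hh
  set k : M → ℝ := fun q ↦ A.metric.inner (L.map q) (L.di q (W q)) (P.phiE q) with hk
  obtain ⟨ψ, -, hψ⟩ := (SmoothBumpFunction.nhds_basis_tsupport (I := 𝓘(ℝ, E)) p).mem_iff.1
    (hOo.mem_nhds ⟨hp, mem_chart_source E p⟩)
  -- With h = g(X, φE) and k = g(W, φE), the field kX - hW pairs to kh - hk = 0 with φE, so it lies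
  -- in D without any division. At `p` one has k = 0, as y lies in D, and h = -1, as X is U there,
  -- so the value is y. The bump function makes the section global.
  refine ⟨(ψ : M → ℝ) • (k • X - h • W), ?_, fun q ↦ ?_, ?_⟩
  · refine ContMDiff.contMDiffOn (ContMDiffOn.smul_section_of_tsupport ψ.contMDiff.contMDiffOn hOo hψ
      fun q hq ↦ ContMDiffAt.contMDiffWithinAt ?_)
    exact ((hsm q hq).smul_section (contMDiffAt_chartFrame hq.2 _)).sub_section
      ((hsm q hq).smul_section (contMDiffAt_chartFrame hq.2 _))
  · by_cases hq : q ∈ tsupport ψ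
    · have hqd := (hψ hq).1
      refine Submodule.smul_mem _ _ ((P.mem_distD_iff hL hqd).2 ?_)
      have e : (k • X - h • W) q = k q • X q - h q • W q := rfl
      rw [e, map_sub, map_smul, map_smul, map_sub, map_smul, map_smul, sub_apply, smul_apply,
        smul_apply]
      change k q * h q - h q * k q = 0
      ring
    · have e : ((ψ : M → ℝ) • (k • X - h • W)) q = ψ q • (k • X - h • W) q := rfl
      rw [e, image_eq_zero_of_notMem_tsupport hq, zero_smul]
      exact Submodule.zero_mem _
  · have e : ((ψ : M → ℝ) • (k • X - h • W)) p = ψ p • (k p • X p - h p • W p) := rfl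
    have hk0 : k p = 0 := by
      simp only [hk, hW, chartFrame_self]
      exact (P.mem_distD_iff hL hp).1 hy
    have hh0 : h p = -1 := by
      simp only [hh, hX, chartFrame_self]
      exact P.inner_di_fieldU_phiE hL hp
    rw [e, hk0, hh0, ψ.eq_one, hW, chartFrame_self]
    simp

/-- Every tangent vector becomes a vector of D after adding a multiple of U. -/
lemma sff_eq_zero (h : IsLeviCivita A.metric nabla)
    {v : TangentSpace 𝓘(ℝ, E) p} (hD : ∀ y ∈ L.distD A p, P.sff nabla p v y = 0)
    (hU : P.sff nabla p v (L.fieldU A P p) = 0) (y : TangentSpace 𝓘(ℝ, E) p) :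
    P.sff nabla p v y = 0 := by
  have h1 := hD _ (P.add_smul_fieldU_mem_distD hL hp y)
  rwa [P.sff_add_right h, P.sff_smul_right h, hU, mul_zero, add_zero] at h1

end NullPair

/-- The two conditions on the induced tensor field and on the shape operators say that the second
fundamental forms vanish. -/
theorem conditions_iff_sff_eq_zero [T2Space M] (hr : 0 < r) (hA : A.IsSManifold)
    (h : IsLeviCivita A.metric nabla) (hL : L.IsCharacteristic A)
    {ι : Type*} (P : ι → L.NullPair) (hP : ∀ p : M, ∃ k, p ∈ (P k).dom) :
    ((∀ Y : Π p : M, TangentSpace 𝓘(ℝ, E) p, SmoothFieldOn Y Set.univ →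
        (∀ p, Y p ∈ L.distD A p) →
        ∀ (p : M) (X : TangentSpace 𝓘(ℝ, E) p),
          L.di p (L.covPhiM A nabla Y p X)
            = A.metric.inner (L.map p) (A.phi (L.map p) (L.di p X))
                (A.phi (L.map p) (L.di p (Y p))) • A.xiSum (L.map p)
              + A.etaSum (L.map p) (L.di p (Y p))
                • A.phi (L.map p) (A.phi (L.map p) (L.di p X))) ∧
      (∀ k, ∀ p ∈ (P k).dom, ∀ X : TangentSpace 𝓘(ℝ, E) p,
        L.di p (L.shape nabla (P k).secN p X)
          = -L.di p (L.phiM A p (L.inducedCov nabla (L.fieldU A (P k)) p X))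
            - A.metric.inner (L.map p) (L.di p X) (L.di p (L.fieldU A (P k) p))
                • A.xiSum (L.map p))) ↔
    ∀ k, ∀ p ∈ (P k).dom, ∀ v y, (P k).sff nabla p v y = 0 := by
  constructor
  · rintro ⟨h1, h2⟩ k p hp v y
    have hN := (P k).phiN_ne_zero hL hp
    refine (P k).sff_eq_zero hL hp h (fun y hy ↦ ?_) ?_ y
    · obtain ⟨Y, hY, hYD, rfl⟩ := (P k).exists_smooth_section_distD hL hp hy
      have h3 := h1 Y hY hYD p v
      -- The main terms of the condition and of the identity agree; only B(v, y) φN is left, and φN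
      -- ≠ 0.
      rw [(P k).di_covPhiM hL hp h hA hr
        ((hY.contMDiffAt Filter.univ_mem).mdifferentiableAt (by simp))
        (Filter.Eventually.of_forall hYD), A.covPhi_eq h hA hr, add_eq_left] at h3
      exact (smul_eq_zero.1 h3).resolve_right hN
    · have h3 := h2 k p hp v
      rw [(P k).di_shape hL hp h hA hr, sub_eq_self] at h3
      exact (smul_eq_zero.1 h3).resolve_right hN
  · intro hB
    refine ⟨fun Y hY hYD p v ↦ ?_, fun k p hp v ↦ ?_⟩
    · obtain ⟨k, hp⟩ := hP p
      rw [(P k).di_covPhiM hL hp h hA hr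
        ((hY.contMDiffAt Filter.univ_mem).mdifferentiableAt (by simp))
        (Filter.Eventually.of_forall hYD), A.covPhi_eq h hA hr, hB k p hp, zero_smul, add_zero]
    · rw [(P k).di_shape hL hp h hA hr, hB k p hp, zero_smul, sub_zero]

end LightlikeHypersurface

end Conditions

/-! ### Acceleration of curves and the Gauss formula -/

section Curves

variable {F : Type*} [NormedAddCommGroup F] [NormedSpace ℝ F] [FiniteDimensional ℝ F]
  {Mb : Type*} [TopologicalSpace Mb] [ChartedSpace F Mb] [IsManifold 𝓘(ℝ, F) ∞ Mb]
  {E : Type*} [NormedAddCommGroup E] [NormedSpace ℝ E] [FiniteDimensional ℝ E]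
  {M : Type*} [TopologicalSpace M] [ChartedSpace E M] [IsManifold 𝓘(ℝ, E) ∞ M]
  {nabla : CovariantDerivative 𝓘(ℝ, F) F (TangentSpace 𝓘(ℝ, F) : Mb → Type _)}

lemma chartCoord_velocity {c : ℝ → M} {t : ℝ} {x₀ : M}
    (hc : MDifferentiableAt 𝓘(ℝ, ℝ) 𝓘(ℝ, E) c t) (hx : c t ∈ (chartAt E x₀).source) :
    chartCoord x₀ (c t) (velocity (F := E) c t) = deriv (fun s ↦ extChartAt 𝓘(ℝ, E) x₀ (c s)) t := by
  have h := mfderiv_comp t ((contMDiffAt_extChartAt' (n := 1) hx).mdifferentiableAt (by simp)) hc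
  rw [chartCoord_eq_mfderiv hx, velocity, ← fderiv_apply_one_eq_deriv, ← mfderiv_eq_fderiv]
  exact (DFunLike.congr_fun h (1 : ℝ)).symm

lemma ContMDiffAt.eventually_mdifferentiableAt {c : ℝ → M} {t : ℝ}
    (hc : ContMDiffAt 𝓘(ℝ, ℝ) 𝓘(ℝ, E) ∞ c t) :
    ∀ᶠ s in 𝓝 t, MDifferentiableAt 𝓘(ℝ, ℝ) 𝓘(ℝ, E) c s := by
  have h : ContMDiffAt 𝓘(ℝ, ℝ) 𝓘(ℝ, E) 1 c t := hc.of_le (by simp)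
  filter_upwards [(contMDiffAt_iff_contMDiffAt_nhds (by simp)).1 h] with s hs
  exact hs.mdifferentiableAt (by simp)

lemma diffAlongAt_velocity {c : ℝ → M} {t : ℝ} (hc : ContMDiffAt 𝓘(ℝ, ℝ) 𝓘(ℝ, E) ∞ c t) :
    DiffAlongAt (E := ℝ) c (velocity (F := E) c) t := by
  have hx := mem_chart_source E (c t)
  refine (diffAlongAt_iff hx).2 ⟨hc.mdifferentiableAt (by simp), ?_⟩
  have h1 : ContDiffAt ℝ ∞ (fun s ↦ extChartAt 𝓘(ℝ, E) (c t) (c s)) t :=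
    ((contMDiffAt_extChartAt' hx).comp t hc).contDiffAt
  have h2 : DifferentiableAt ℝ (deriv (fun s ↦ extChartAt 𝓘(ℝ, E) (c t) (c s))) t := by
    have : DifferentiableAt ℝ (fderiv ℝ (fun s ↦ extChartAt 𝓘(ℝ, E) (c t) (c s))) t :=
      (h1.fderiv_right (m := 1) (by rw [one_add_one_eq_two]; exact ENat.LEInfty.out)).differentiableAt (by simp)
    exact this.clm_apply (differentiableAt_const (1 : ℝ))
  refine h2.mdifferentiableAt.congr_of_eventuallyEq ?_
  filter_upwards [hc.eventually_mdifferentiableAt,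
    hc.continuousAt (eventually_mem_source hx)] with s h3 h4 using chartCoord_velocity h3 h4

lemma velocity_comp {f : M → Mb} (hf : ContMDiff 𝓘(ℝ, E) 𝓘(ℝ, F) ∞ f) {c : ℝ → M} {t : ℝ}
    (hc : MDifferentiableAt 𝓘(ℝ, ℝ) 𝓘(ℝ, E) c t) :
    velocity (F := F) (f ∘ c) t = mfderiv 𝓘(ℝ, E) 𝓘(ℝ, F) f (c t) (velocity (F := E) c t) :=
  DFunLike.congr_fun (mfderiv_comp t (hf.contMDiffAt.mdifferentiableAt (by simp)) hc) (1 : ℝ)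

/-- The acceleration of a curve, computed with the flat connection of the chart at its point. -/
def chartAccel (c : ℝ → M) (t : ℝ) : TangentSpace 𝓘(ℝ, E) (c t) :=
  chartVec (c t) (c t) (mvfderiv 𝓘(ℝ, ℝ)
    (fun s ↦ chartCoord (c t) (c s) (velocity (F := E) c s)) t (1 : ℝ))

variable (nabla) in
lemma covAlong_velocity_comp {f : M → Mb} (hf : ContMDiff 𝓘(ℝ, E) 𝓘(ℝ, F) ∞ f) {c : ℝ → M} {t : ℝ}
    (hc : ContMDiffAt 𝓘(ℝ, ℝ) 𝓘(ℝ, E) ∞ c t) :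
    covAlong (fun Y x w ↦ nabla Y x w) (f ∘ c) (velocity (F := F) (f ∘ c)) t (1 : ℝ)
      = mfderiv 𝓘(ℝ, E) 𝓘(ℝ, F) f (c t) (chartAccel c t)
        + mapHessian nabla f (c t) (velocity (F := E) c t) (velocity (F := E) c t) := by
  have h : ∀ᶠ s in 𝓝 t, velocity (F := F) (f ∘ c) s
      = mfderiv 𝓘(ℝ, E) 𝓘(ℝ, F) f (c s) (velocity (F := E) c s) := by
    filter_upwards [hc.eventually_mdifferentiableAt] with s hs using velocity_comp hf hs
  exact (covAlong_congr h (1 : ℝ)).trans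
    (covAlong_mfderiv nabla hf (diffAlongAt_velocity hc) (1 : ℝ))

namespace LightlikeHypersurface

variable {g : SemiRiemannianMetric F Mb} (L : LightlikeHypersurface E M g)

variable (nabla) in
-- `covAlong` evaluates the induced connection on a chart frame, where the flat part is zero, so
-- only the tangential part of the Hessian of the immersion enters.
lemma covAlong_inducedCov_velocity {c : ℝ → M} {t : ℝ} (hc : ContinuousAt c t) :
    covAlong (L.inducedCov nabla) c (velocity (F := E) c) t (1 : ℝ)
      = chartAccel c t + L.tangentPart (c t)
        (mapHessian nabla L.map (c t) (velocity (F := E) c t) (velocity (F := E) c t)) := by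
  rw [← covAlong_mfderiv_extend nabla L.contMDiff_map]
  exact covAlong_eq _ hc (1 : ℝ)

variable {L}

namespace NullPair

variable (P : L.NullPair)

variable (nabla) in
/-- The Gauss formula along a curve. -/
lemma covAlong_velocity_eq {c : ℝ → M} {t : ℝ} (hc : ContMDiffAt 𝓘(ℝ, ℝ) 𝓘(ℝ, E) ∞ c t)
    (hp : c t ∈ P.dom) :
    covAlong (fun Y x w ↦ nabla Y x w) (L.map ∘ c) (velocity (F := F) (L.map ∘ c)) t (1 : ℝ)
      = L.di (c t) (covAlong (L.inducedCov nabla) c (velocity (F := E) c) t (1 : ℝ))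
        + P.sff nabla (c t) (velocity (F := E) c t) (velocity (F := E) c t) • P.secN (c t) := by
  rw [covAlong_velocity_comp nabla L.contMDiff_map hc,
    L.covAlong_inducedCov_velocity nabla hc.continuousAt, map_add, P.di_tangentPart hp, ← sff]
  rw [add_assoc, sub_add_cancel]
  rfl

end NullPair

lemma isTotallyGeodesic_of_sff_eq_zero {ι : Type*} (P : ι → L.NullPair)
    (hP : ∀ p : M, ∃ k, p ∈ (P k).dom)
    (hB : ∀ k, ∀ p ∈ (P k).dom, ∀ v y, (P k).sff nabla p v y = 0) : L.IsTotallyGeodesic nabla := by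
  intro c J hJ _ hc
  refine ⟨L.contMDiff_map.comp_contMDiffOn hc.1, fun t ht ↦ ?_⟩
  obtain ⟨k, hk⟩ := hP (c t)
  rw [(P k).covAlong_velocity_eq nabla (hc.1.contMDiffAt (hJ.mem_nhds ht)) hk, hc.2 t ht, hB k _ hk,
    map_zero, zero_smul, zero_add]

end LightlikeHypersurface

end Curves

/-! ### Smooth solutions of ordinary differential equations -/

/-- A smooth autonomous differential equation has a smooth solution through every point. -/
lemma exists_contDiffOn_integralCurve {V : Type*} [NormedAddCommGroup V] [NormedSpace ℝ V]
    [CompleteSpace V] {X : V → V} {O : Set V} (hO : IsOpen O) (hX : ContDiffOn ℝ ∞ X O) {z : V}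
    (hz : z ∈ O) :
    ∃ γ : ℝ → V, ∃ ε > 0, γ 0 = z ∧ ContDiffOn ℝ ∞ γ (Set.Ioo (-ε) ε) ∧
      ∀ t ∈ Set.Ioo (-ε) ε, γ t ∈ O ∧ HasDerivAt γ (X (γ t)) t := by
  have hXz : ContDiffAt ℝ 1 X z := (hX.contDiffAt (hO.mem_nhds hz)).of_le (by simp)
  obtain ⟨γ, h0, ε, hε, hγ⟩ := hXz.exists_forall_mem_closedBall_exists_eq_forall_mem_Ioo_hasDerivAt₀ 0
  rw [zero_sub, zero_add] at hγ
  have hc : ContinuousAt γ 0 := (hγ 0 ⟨by linarith, hε⟩).continuousAt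
  have hmem : ∀ᶠ t in 𝓝 (0 : ℝ), γ t ∈ O := hc.eventually_mem (by rw [h0]; exact hO.mem_nhds hz)
  obtain ⟨δ, hδ, hball⟩ := Metric.eventually_nhds_iff_ball.1 hmem
  -- Halving leaves room for a closed interval on which the solution exists and stays in `O`, as the
  -- regularity theorem below is stated on closed intervals.
  set ρ := min ε δ / 2 with hρ
  have hρ0 : 0 < ρ := half_pos (lt_min hε hδ)
  have hρε : ρ < ε := (half_lt_self (lt_min hε hδ)).trans_le (min_le_left _ _)
  have hρδ : ρ < δ := (half_lt_self (lt_min hε hδ)).trans_le (min_le_right _ _)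
  have hO' : ∀ t ∈ Set.Icc (-ρ) ρ, γ t ∈ O := fun t ht ↦ hball t (by
    rw [Metric.mem_ball, dist_zero_right, Real.norm_eq_abs]
    exact (abs_le.2 ht).trans_lt hρδ)
  have hd : ∀ t ∈ Set.Icc (-ρ) ρ, HasDerivAt γ (X (γ t)) t := fun t ht ↦
    hγ t ⟨by linarith [ht.1], by linarith [ht.2]⟩
  have hs := ODE.contDiffOn_enat_Icc_of_hasDerivWithinAt (n := ⊤) (f := fun _ ↦ X) (u := O)
    (hX.comp contDiff_snd.contDiffOn fun q hq ↦ hq.2) (fun t ht ↦ (hd t ht).hasDerivWithinAt) hO'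
  exact ⟨γ, ρ, hρ0, h0, hs.mono Set.Ioo_subset_Icc_self, fun t ht ↦
    ⟨hO' t (Set.Ioo_subset_Icc_self ht), hd t (Set.Ioo_subset_Icc_self ht)⟩⟩

/-! ### Ambient acceleration through Christoffel symbols -/

section Geodesics

variable {F : Type*} [NormedAddCommGroup F] [NormedSpace ℝ F] [FiniteDimensional ℝ F]
  {Mb : Type*} [TopologicalSpace Mb] [ChartedSpace F Mb] [IsManifold 𝓘(ℝ, F) ∞ Mb]
  {nabla : CovariantDerivative 𝓘(ℝ, F) F (TangentSpace 𝓘(ℝ, F) : Mb → Type _)}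
  (g : SemiRiemannianMetric F Mb)

namespace SemiRiemannianMetric

/-- The Gram form of the metric in the chart at `y₀`, as a function on the model space. -/
def gramRep (y₀ : Mb) (z : F) : F →L[ℝ] F →L[ℝ] ℝ :=
  g.gram y₀ ((extChartAt 𝓘(ℝ, F) y₀).symm z)

/-- The Christoffel symbols of the first kind in the chart at `y₀`, on the diagonal. -/
def christoffel (y₀ : Mb) (z u : F) : F →L[ℝ] ℝ :=
  fderiv ℝ (g.gramRep y₀) z u u - (1 / 2 : ℝ) • ((fderiv ℝ (g.gramRep y₀) z).flip u).flip u

lemma christoffel_apply (y₀ : Mb) (z u w : F) :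
    g.christoffel y₀ z u w
      = fderiv ℝ (g.gramRep y₀) z u u w - 1 / 2 * fderiv ℝ (g.gramRep y₀) z w u u := rfl

lemma contDiffAt_gramRep {y₀ y : Mb} (hy : y ∈ (chartAt F y₀).source) :
    ContDiffAt ℝ ∞ (g.gramRep y₀) (extChartAt 𝓘(ℝ, F) y₀ y) :=
  contDiffAt_comp_extChartAt_symm hy (g.contMDiffAt_gram hy)

end SemiRiemannianMetric

variable {g}

/-- The Koszul formula on the diagonal: g(∇_u u, w) = ∂_u g(u, w) - ½ ∂_w g(u, u), because ∇_u w =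
∇_w u for chart frames. It makes the smoothness of the geodesic equation visible, with only the
metric involved. -/
lemma IsLeviCivita.inner_chartFrame_self (h : IsLeviCivita g nabla) {y₀ y : Mb}
    (hy : y ∈ (chartAt F y₀).source) (u w : F) :
    g.inner y (nabla (chartFrame y₀ u) y (chartFrame y₀ u y)) (chartFrame y₀ w y)
      = g.christoffel y₀ (extChartAt 𝓘(ℝ, F) y₀ y) u w := by
  have key (a b c : F) : fderiv ℝ (g.gramRep y₀) (extChartAt 𝓘(ℝ, F) y₀ y) c a b
      = g.inner y (nabla (chartFrame y₀ a) y (chartFrame y₀ c y)) (chartFrame y₀ b y)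
        + g.inner y (chartFrame y₀ a y) (nabla (chartFrame y₀ b) y (chartFrame y₀ c y)) := by
    rw [← h.mvfderiv_inner (diffFieldAt_chartFrame hy a) (diffFieldAt_chartFrame hy b)]
    have hs : ContMDiffAt 𝓘(ℝ, F) 𝓘(ℝ, ℝ) ∞
        (fun y ↦ g.inner y (chartFrame y₀ a y) (chartFrame y₀ b y)) y :=
      g.contMDiffAt_inner (f := fun y ↦ y) (contMDiffAt_chartFrame hy a)
        (contMDiffAt_chartFrame hy b)
    rw [mvfderiv_apply_chartFrame hy hs]
    have hd := (g.contDiffAt_gramRep hy).differentiableAt (by simp)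
    have h1 := ((hd.hasFDerivAt.clm_apply (hasFDerivAt_const a _)).clm_apply
      (hasFDerivAt_const b _)).fderiv
    refine Eq.trans ?_ (congrArg (fun L : F →L[ℝ] ℝ ↦ L c) h1).symm
    simp
  rw [g.christoffel_apply, key, key, h.chartFrame_comm hy w u,
    g.symm y (chartFrame y₀ u y) (nabla (chartFrame y₀ u) y (chartFrame y₀ w y))]
  ring

/-- The acceleration of a curve in the chart at `y₀`. -/
lemma inner_covAlong_velocity (h : IsLeviCivita g nabla) {c : ℝ → Mb} {t : ℝ} {y₀ : Mb}
    (hc : ContMDiffAt 𝓘(ℝ, ℝ) 𝓘(ℝ, F) ∞ c t) (hy : c t ∈ (chartAt F y₀).source) (w : F) :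
    g.inner (c t) (covAlong (fun Y x w ↦ nabla Y x w) c (velocity (F := F) c) t (1 : ℝ))
        (chartFrame y₀ w (c t))
      = g.gramRep y₀ (extChartAt 𝓘(ℝ, F) y₀ (c t))
          (deriv (deriv (fun s ↦ extChartAt 𝓘(ℝ, F) y₀ (c s))) t) w
        + g.christoffel y₀ (extChartAt 𝓘(ℝ, F) y₀ (c t))
          (deriv (fun s ↦ extChartAt 𝓘(ℝ, F) y₀ (c s)) t) w := by
  set σ : ℝ → F := fun s ↦ extChartAt 𝓘(ℝ, F) y₀ (c s) with hσ
  have hcoord : ∀ᶠ s in 𝓝 t, chartCoord y₀ (c s) (velocity (F := F) c s) = deriv σ s := by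
    filter_upwards [hc.eventually_mdifferentiableAt,
      hc.continuousAt (eventually_mem_source hy)] with s h3 h4 using chartCoord_velocity h3 h4
  have h1 := covAlong_eq_chart nabla hy (diffAlongAt_velocity hc) (1 : ℝ)
  have h2 : mvfderiv 𝓘(ℝ, ℝ) (fun s ↦ chartCoord y₀ (c s) (velocity (F := F) c s)) t (1 : ℝ)
      = deriv (deriv σ) t := by
    refine (Filter.EventuallyEq.mvfderiv_apply_eq hcoord (1 : ℝ)).trans ?_
    rw [← fderiv_apply_one_eq_deriv]
    exact DFunLike.congr_fun mfderiv_eq_fderiv (1 : ℝ)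
  have h3 : mfderiv 𝓘(ℝ, ℝ) 𝓘(ℝ, F) c t (1 : ℝ) = chartFrame y₀ (deriv σ t) (c t) := by
    rw [← hcoord.self_of_nhds]
    exact (chartVec_chartCoord hy _).symm
  rw [hcoord.self_of_nhds, h3] at h1
  have e : covAlong (fun Y x w ↦ nabla Y x w) c (velocity (F := F) c) t (1 : ℝ)
      = chartVec y₀ (c t) (deriv (deriv σ) t)
        + nabla (chartFrame y₀ (deriv σ t)) (c t) (chartFrame y₀ (deriv σ t) (c t)) := by
    rw [← h2]; exact h1
  rw [e, map_add, add_apply, h.inner_chartFrame_self hy]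
  congr 1
  rw [SemiRiemannianMetric.gramRep, (extChartAt 𝓘(ℝ, F) y₀).left_inv (by simpa using hy)]
  rfl

end Geodesics

lemma contDiffAt_clm_of_apply {V G H : Type*} [NormedAddCommGroup V] [NormedSpace ℝ V]
    [NormedAddCommGroup G] [NormedSpace ℝ G] [FiniteDimensional ℝ G] [NormedAddCommGroup H]
    [NormedSpace ℝ H] {n : ℕ∞ω} {T : V → G →L[ℝ] H} {z : V}
    (h : ∀ a, ContDiffAt ℝ n (fun w ↦ T w a) z) : ContDiffAt ℝ n T z :=
  contMDiffAt_iff_contDiffAt.1 (contMDiffAt_clm_of_apply fun a ↦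
    contMDiffAt_iff_contDiffAt.2 (h a))

/-! ### The geodesic equation of the induced connection as a smooth equation -/

section GeodesicExistence

variable {F : Type*} [NormedAddCommGroup F] [NormedSpace ℝ F] [FiniteDimensional ℝ F]
  {Mb : Type*} [TopologicalSpace Mb] [ChartedSpace F Mb] [IsManifold 𝓘(ℝ, F) ∞ Mb]
  {E : Type*} [NormedAddCommGroup E] [NormedSpace ℝ E] [FiniteDimensional ℝ E]
  {M : Type*} [TopologicalSpace M] [ChartedSpace E M] [IsManifold 𝓘(ℝ, E) ∞ M]
  {nabla : CovariantDerivative 𝓘(ℝ, F) F (TangentSpace 𝓘(ℝ, F) : Mb → Type _)}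
  {g : SemiRiemannianMetric F Mb} {L : LightlikeHypersurface E M g}

namespace LightlikeHypersurface.NullPair

variable (P : L.NullPair)

/-- The transversal section in the charts at `p` and `L.map p`. -/
def secNRep (p : M) (z : E) : F :=
  chartCoord (L.map p) (L.map ((extChartAt 𝓘(ℝ, E) p).symm z))
    (P.secN ((extChartAt 𝓘(ℝ, E) p).symm z))

/-- The points of the chart at `p` over which the transversal section is defined. -/
def IsAdapted (p : M) (z : E) : Prop :=
  z ∈ (extChartAt 𝓘(ℝ, E) p).target ∧ (extChartAt 𝓘(ℝ, E) p).symm z ∈ P.dom ∧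
    (extChartAt 𝓘(ℝ, E) p).symm z ∈ (chartAt E p).source ∧
    L.map ((extChartAt 𝓘(ℝ, E) p).symm z) ∈ (chartAt F (L.map p)).source

/-- The map `(a, l) ↦ g(df(a) + l N, ·)` in charts. -/
def gaussMap (p : M) (z : E) : E × ℝ →L[ℝ] F →L[ℝ] ℝ :=
  (g.gramRep (L.map p) (chartRep F E L.map p (L.map p) z)).comp
    ((fderiv ℝ (chartRep F E L.map p (L.map p)) z).coprod
      ((1 : ℝ →L[ℝ] ℝ).smulRight (P.secNRep p z)))

lemma gaussMap_apply (p : M) (z : E) (a : E) (l : ℝ) :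
    P.gaussMap p z (a, l) = g.gramRep (L.map p) (chartRep F E L.map p (L.map p) z)
      (fderiv ℝ (chartRep F E L.map p (L.map p)) z a + l • P.secNRep p z) := by
  simp [gaussMap]

variable (g L) in
/-- The ambient acceleration of a curve with velocity `a` and no acceleration in the chart at `p`,
lowered with the metric. -/
def flatAccel (p : M) (z a : E) : F →L[ℝ] ℝ :=
  g.gramRep (L.map p) (chartRep F E L.map p (L.map p) z)
      (fderiv ℝ (fderiv ℝ (chartRep F E L.map p (L.map p))) z a a)
    + g.christoffel (L.map p) (chartRep F E L.map p (L.map p) z)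
      (fderiv ℝ (chartRep F E L.map p (L.map p)) z a)

/-- The tangential and transversal components of the acceleration `flatAccel`. -/
def accelParts (p : M) (z a : E) : E × ℝ :=
  (P.gaussMap p z).inverse (flatAccel g L p z a)

variable {p : M} {z : E}

lemma IsAdapted.contDiffAt_chartRep (hz : P.IsAdapted p z) :
    ContDiffAt ℝ ∞ (chartRep F E L.map p (L.map p)) z := by
  have := _root_.contDiffAt_chartRep L.contMDiff_map hz.2.2.1 hz.2.2.2
  rwa [(extChartAt 𝓘(ℝ, E) p).right_inv hz.1] at this

lemma IsAdapted.contDiffAt_secNRep (hz : P.IsAdapted p z) : ContDiffAt ℝ ∞ (P.secNRep p) z := by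
  have : IsManifold 𝓘(ℝ, F) (∞ + 1) Mb := ‹IsManifold 𝓘(ℝ, F) ∞ Mb›
  have h := contDiffAt_comp_extChartAt_symm hz.2.2.1
    ((contMDiffAt_along_iff hz.2.2.2).1 (P.contMDiffAt_secN hz.2.1)).2
  rwa [(extChartAt 𝓘(ℝ, E) p).right_inv hz.1] at h

lemma IsAdapted.contDiffAt_gramRep (hz : P.IsAdapted p z) :
    ContDiffAt ℝ ∞ (g.gramRep (L.map p)) (chartRep F E L.map p (L.map p) z) :=
  g.contDiffAt_gramRep hz.2.2.2

lemma IsAdapted.contDiffAt_gaussMap (hz : P.IsAdapted p z) : ContDiffAt ℝ ∞ (P.gaussMap p) z := by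
  have h1 := hz.contDiffAt_chartRep
  have h2 := hz.contDiffAt_secNRep
  have h3 := hz.contDiffAt_gramRep.comp z h1
  have h4 : ContDiffAt ℝ ∞ (fderiv ℝ (chartRep F E L.map p (L.map p))) z :=
    h1.fderiv_right (by simp)
  refine h3.clm_comp (contDiffAt_clm_of_apply fun b ↦ ?_)
  simp only [ContinuousLinearMap.coprod_apply, ContinuousLinearMap.smulRight_apply,
    one_apply_eq_self]
  exact (h4.clm_apply contDiffAt_const).add (contDiffAt_const.smul h2)

/-- If df(a) + lN is orthogonal to everything, it vanishes; pairing with E gives l = 0, and then a =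
0 as the immersion has injective differential. -/
lemma IsAdapted.gaussMap_injective (hz : P.IsAdapted p z) :
    Function.Injective (P.gaussMap p z) := by
  rw [injective_iff_map_eq_zero]
  rintro ⟨a, l⟩ h
  obtain ⟨h1, h2, h3, h4⟩ := hz
  rw [gaussMap_apply] at h
  set q := (extChartAt 𝓘(ℝ, E) p).symm z with hq
  have hJ := chartDeriv_eq_fderiv L.contMDiff_map h3 h4
  rw [(extChartAt 𝓘(ℝ, E) p).right_inv h1] at hJ
  rw [← hJ] at h
  have h5 : chartDeriv F E L.map p (L.map p) q a + l • P.secNRep p z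
      = chartCoord (L.map p) (L.map q) (L.di q (chartVec p q a) + l • P.secN q) := by
    rw [map_add, map_smul]; rfl
  have h6 : L.di q (chartVec p q a) + l • P.secN q = 0 := by
    refine g.nondegenerate _ _ fun w ↦ ?_
    have := DFunLike.congr_fun h (chartCoord (L.map p) (L.map q) w)
    rw [h5] at this
    rw [← g.gram_chartCoord h4]
    rw [SemiRiemannianMetric.gramRep, chartRep, ← hq,
      (extChartAt 𝓘(ℝ, F) (L.map p)).left_inv (by simpa using h4)] at this
    exact this
  have h7 := P.inner_di_diE h2 (chartVec p q a)
  rw [eq_neg_of_add_eq_zero_left h6, map_neg, neg_apply, map_smul, smul_apply,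
    P.inner_secN_diE h2] at h7
  have hl : l = 0 := by simpa using h7
  rw [hl, zero_smul, add_zero, ← map_zero (L.di q)] at h6
  have h8 := congrArg (chartCoord p q) (L.di_injective q h6)
  rw [chartCoord_chartVec h3, map_zero] at h8
  rw [h8, hl]
  rfl

/-- Injectivity suffices because the dimensions agree in codimension one. It guarantees that
`inverse` in `accelParts` is a genuine inverse at adapted points, not its default value. -/
lemma IsAdapted.isInvertible_gaussMap (hz : P.IsAdapted p z) : (P.gaussMap p z).IsInvertible := by
  have h1 : Module.finrank ℝ (E × ℝ) = Module.finrank ℝ (F →L[ℝ] ℝ) := by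
    rw [Module.finrank_prod, Module.finrank_self, ← L.codim_one,
      ← (LinearMap.toContinuousLinearMap (𝕜 := ℝ) (E := F) (F' := ℝ)).finrank_eq]
    exact Subspace.dual_finrank_eq.symm
  exact ⟨(LinearMap.linearEquivOfInjective (P.gaussMap p z).toLinearMap hz.gaussMap_injective
    h1).toContinuousLinearEquiv, rfl⟩

lemma IsAdapted.gaussMap_accelParts (hz : P.IsAdapted p z) (a : E) :
    P.gaussMap p z (P.accelParts p z a) = flatAccel g L p z a :=
  hz.isInvertible_gaussMap.self_apply_inverse _

-- Inversion is smooth at invertible operators, and `flatAccel` is built from derivatives of smooth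
-- functions; this is the regularity that the existence theorem needs.
set_option maxSynthPendingDepth 3 in
lemma IsAdapted.contDiffAt_accelParts (hz : P.IsAdapted p z) (a : E) :
    ContDiffAt ℝ ∞ (fun w : E × E ↦ P.accelParts p w.1 w.2) (z, a) := by
  have hf := hz.contDiffAt_chartRep
  have hg := hz.contDiffAt_gramRep
  have hf1 : ContDiffAt ℝ ∞ (fderiv ℝ (chartRep F E L.map p (L.map p))) z :=
    hf.fderiv_right (by simp)
  have hf2 : ContDiffAt ℝ ∞ (fderiv ℝ (fderiv ℝ (chartRep F E L.map p (L.map p)))) z :=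
    hf1.fderiv_right (by simp)
  have hg1 : ContDiffAt ℝ ∞ (fderiv ℝ (g.gramRep (L.map p)))
    (chartRep F E L.map p (L.map p) z) := hg.fderiv_right (by simp)
  have c1 : ContDiffAt ℝ ∞ (Prod.fst : E × E → E) (z, a) := contDiffAt_fst
  have c2 : ContDiffAt ℝ ∞ (Prod.snd : E × E → E) (z, a) := contDiffAt_snd
  have k0 := hf.comp (z, a) c1
  have k1 := (hf1.comp (z, a) c1).clm_apply c2
  have k2 := ((hf2.comp (z, a) c1).clm_apply c2).clm_apply c2
  have k3 := hg.comp (z, a) k0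
  have k4 := hg1.comp (z, a) k0
  have k5 := (hz.isInvertible_gaussMap.contDiffAt_map_inverse (n := ∞)).comp (z, a)
    (hz.contDiffAt_gaussMap.comp (z, a) c1)
  refine k5.clm_apply ((k3.clm_apply k2).add (((k4.clm_apply k1).clm_apply k1).sub ?_))
  -- The doubly flipped term of the Christoffel form is tested on a fixed vector b, where the flips
  -- disappear.
  exact ContDiffAt.const_smul _ (contDiffAt_clm_of_apply fun b ↦
    ((k4.clm_apply contDiffAt_const).clm_apply k1).clm_apply k1)

end LightlikeHypersurface.NullPair

end GeodesicExistence

/-! ### Second derivative of a composition with a curve -/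

section SecondDerivative

variable {E F : Type*} [NormedAddCommGroup E] [NormedSpace ℝ E] [NormedAddCommGroup F]
  [NormedSpace ℝ F] {f : E → F} {x y : ℝ → E} {t : ℝ}

lemma deriv_comp_of_hasDerivAt (hf : ContDiffAt ℝ ∞ f (x t)) (hx : HasDerivAt x (y t) t) :
    deriv (fun s ↦ f (x s)) t = fderiv ℝ f (x t) (y t) := by
  have h := (hf.differentiableAt (by simp)).hasFDerivAt.comp_hasDerivAt t hx
  exact h.deriv

lemma deriv_deriv_comp_of_hasDerivAt {a : E} (hf : ∀ᶠ s in 𝓝 t, ContDiffAt ℝ ∞ f (x s))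
    (hx : ∀ᶠ s in 𝓝 t, HasDerivAt x (y s) s) (hy : HasDerivAt y a t) :
    deriv (deriv fun s ↦ f (x s)) t
      = fderiv ℝ (fderiv ℝ f) (x t) (y t) (y t) + fderiv ℝ f (x t) a := by
  have e : deriv (fun s ↦ f (x s)) =ᶠ[𝓝 t] fun s ↦ fderiv ℝ f (x s) (y s) := by
    filter_upwards [hf, hx] with s h1 h2 using deriv_comp_of_hasDerivAt h1 h2
  have hff : DifferentiableAt ℝ (fderiv ℝ f) (x t) :=
    (hf.self_of_nhds.fderiv_right (m := ∞) (by simp)).differentiableAt (by simp)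
  have h := hff.hasFDerivAt.comp_hasDerivAt t hx.self_of_nhds
  rw [e.deriv_eq]
  exact (h.clm_apply hy).deriv

end SecondDerivative

/-! ### Existence of geodesics, and vanishing of the second fundamental form -/

section GeodesicExistence

variable {F : Type*} [NormedAddCommGroup F] [NormedSpace ℝ F] [FiniteDimensional ℝ F]
  {Mb : Type*} [TopologicalSpace Mb] [ChartedSpace F Mb] [IsManifold 𝓘(ℝ, F) ∞ Mb]
  {E : Type*} [NormedAddCommGroup E] [NormedSpace ℝ E] [FiniteDimensional ℝ E]
  {M : Type*} [TopologicalSpace M] [ChartedSpace E M] [IsManifold 𝓘(ℝ, E) ∞ M]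
  {nabla : CovariantDerivative 𝓘(ℝ, F) F (TangentSpace 𝓘(ℝ, F) : Mb → Type _)}
  {g : SemiRiemannianMetric F Mb} {L : LightlikeHypersurface E M g}

namespace LightlikeHypersurface.NullPair

variable (P : L.NullPair)

lemma eventually_isAdapted {p : M} (hp : p ∈ P.dom) :
    ∀ᶠ z in 𝓝 (extChartAt 𝓘(ℝ, E) p p), P.IsAdapted p z := by
  have h1 : ContinuousAt (extChartAt 𝓘(ℝ, E) p).symm (extChartAt 𝓘(ℝ, E) p p) :=
    continuousAt_extChartAt_symm p
  filter_upwards [eventually_mem_chart (F := F) L.contMDiff_map.continuous (mem_chart_source E p)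
    (mem_chart_source F (L.map p)), h1.eventually_mem (by
      rw [extChartAt_to_inv]; exact P.isOpen_dom.mem_nhds hp)] with z h2 h3
  exact ⟨h2.1, h3, h2.2.1, h2.2.2⟩

/-- A curve that solves the equation of the geodesics of the induced connection in a chart is a
geodesic of that connection. -/
lemma isGeodesicCurveOn_of_hasDerivAt (h : IsLeviCivita g nabla) {p : M} {γ : ℝ → E × E} {J : Set ℝ}
    (hJ : IsOpen J) (hγ : ContDiffOn ℝ ∞ γ J) (hO : ∀ t ∈ J, P.IsAdapted p (γ t).1)
    (hd : ∀ t ∈ J, HasDerivAt γ ((γ t).2, -(P.accelParts p (γ t).1 (γ t).2).1) t) :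
    IsGeodesicCurveOn (F := E) (L.inducedCov nabla)
      (fun t ↦ (extChartAt 𝓘(ℝ, E) p).symm (γ t).1) J := by
  set c : ℝ → M := fun t ↦ (extChartAt 𝓘(ℝ, E) p).symm (γ t).1 with hcdef
  have hd1 (t) (ht : t ∈ J) : HasDerivAt (fun s ↦ (γ s).1) (γ t).2 t := (hd t ht).fst
  have hd2 (t) (ht : t ∈ J) : HasDerivAt (fun s ↦ (γ s).2)
    (-(P.accelParts p (γ t).1 (γ t).2).1) t := (hd t ht).snd
  have hc : ContMDiffOn 𝓘(ℝ, ℝ) 𝓘(ℝ, E) ∞ c J :=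
    (contMDiffOn_extChartAt_symm p).comp hγ.fst.contMDiffOn fun t ht ↦ (hO t ht).1
  refine ⟨hc, fun t ht ↦ ?_⟩
  obtain ⟨h1, h2, h3, h4⟩ := hO t ht
  have hct := hc.contMDiffAt (hJ.mem_nhds ht)
  have hmc : ContMDiffAt 𝓘(ℝ, ℝ) 𝓘(ℝ, F) ∞ (L.map ∘ c) t := L.contMDiff_map.contMDiffAt.comp t hct
  set f := chartRep F E L.map p (L.map p) with hf
  have hJt : ∀ᶠ s in 𝓝 t, s ∈ J := hJ.mem_nhds ht
  have hσ1 : deriv (fun s ↦ f (γ s).1) t = fderiv ℝ f (γ t).1 (γ t).2 :=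
    deriv_comp_of_hasDerivAt (x := fun s ↦ (γ s).1) (y := fun s ↦ (γ s).2) (hO t ht).contDiffAt_chartRep (hd1 t ht)
  have hσ2 : deriv (deriv (fun s ↦ f (γ s).1)) t
      = fderiv ℝ (fderiv ℝ f) (γ t).1 (γ t).2 (γ t).2
        + fderiv ℝ f (γ t).1 (-(P.accelParts p (γ t).1 (γ t).2).1) :=
    deriv_deriv_comp_of_hasDerivAt (x := fun s ↦ (γ s).1) (y := fun s ↦ (γ s).2)
      (hJt.mono fun s hs ↦ (hO s hs).contDiffAt_chartRep)
      (hJt.mono hd1) (hd2 t ht)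
  set l := (P.accelParts p (γ t).1 (γ t).2).2 with hl
  -- The chart acceleration of the curve is minus the tangential part of `flatAccel`, so the two
  -- cancel and the ambient acceleration is purely transversal.
  have hN : covAlong (fun Y x w ↦ nabla Y x w) (L.map ∘ c) (velocity (F := F) (L.map ∘ c)) t (1 : ℝ)
      = l • P.secN (c t) := by
    refine g.ext_inner fun w ↦ ?_
    have key := inner_covAlong_velocity h (y₀ := L.map p) hmc h4 (chartCoord (L.map p) (L.map (c t)) w)
    have hw : chartFrame (L.map p) (chartCoord (L.map p) (L.map (c t)) w) (L.map (c t)) = w :=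
      chartVec_chartCoord h4 w
    have hT := (hO t ht).gaussMap_accelParts P (γ t).2
    rw [← Prod.mk.eta (p := P.accelParts p (γ t).1 (γ t).2), gaussMap_apply, flatAccel, ← hf] at hT
    have hgr : g.gramRep (L.map p) (f (γ t).1) = g.gram (L.map p) (L.map (c t)) := by
      rw [SemiRiemannianMetric.gramRep, hf, chartRep,
        (extChartAt 𝓘(ℝ, F) (L.map p)).left_inv (by simpa using h4)]
    have hT' := DFunLike.congr_fun hT (chartCoord (L.map p) (L.map (c t)) w)
    have hNw : g.gram (L.map p) (L.map (c t)) (P.secNRep p (γ t).1)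
        (chartCoord (L.map p) (L.map (c t)) w) = g.inner (L.map (c t)) (P.secN (c t)) w :=
      g.gram_chartCoord h4 _ _
    change g.inner (L.map (c t)) _ (chartFrame (L.map p) _ (L.map (c t))) =
      g.gramRep (L.map p) (f (γ t).1) (deriv (deriv (fun s ↦ f (γ s).1)) t) _
        + g.christoffel (L.map p) (f (γ t).1) (deriv (fun s ↦ f (γ s).1) t) _ at key
    rw [hw, hσ2, hσ1] at key
    refine key.trans ?_
    change _ = g.inner (L.map (c t)) (l • P.secN (c t)) w
    rw [← hl] at hT'
    simp only [hgr, map_add, map_smul, map_neg, add_apply, smul_apply, neg_apply, smul_eq_mul,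
      hNw] at hT' ⊢
    linarith
  replace h2 : c t ∈ P.dom := h2
  rw [P.covAlong_velocity_eq nabla hct h2] at hN
  -- Pairing the Gauss formula with E identifies l with B(c', c'); cancelling the transversal terms
  -- leaves no induced acceleration.
  have hE := congrArg (fun w ↦ g.inner (L.map (c t)) w (P.diE (c t))) hN
  simp only [map_add, map_smul, add_apply, smul_apply, P.inner_di_diE h2, P.inner_secN_diE h2,
    smul_eq_mul, mul_one, zero_add] at hE
  rw [hE, add_eq_right] at hN
  exact L.di_injective _ (hN.trans (map_zero _).symm)

/-- The induced connection has a geodesic with any given initial velocity. -/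
lemma exists_geodesic (h : IsLeviCivita g nabla) {p : M} (hp : p ∈ P.dom)
    (v : TangentSpace 𝓘(ℝ, E) p) :
    ∃ (c : ℝ → M) (J : Set ℝ), IsOpen J ∧ J.OrdConnected ∧ (0 : ℝ) ∈ J ∧ c 0 = p ∧
      (velocity (F := E) c 0 : E) = v ∧ IsGeodesicCurveOn (F := E) (L.inducedCov nabla) c J := by
  obtain ⟨O, hO, hOo, hpO⟩ := mem_nhds_iff.1 (P.eventually_isAdapted hp)
  -- The geodesic equation as a first-order system for position and velocity, restricted to
  -- positions in an open set of adapted points.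
  obtain ⟨γ, ε, hε, h0, hγ, hd⟩ := exists_contDiffOn_integralCurve
    (X := fun w : E × E ↦ (w.2, -(P.accelParts p w.1 w.2).1)) (O := O ×ˢ Set.univ)
    (hOo.prod isOpen_univ) (fun w hw ↦ (contDiff_snd.contDiffAt.prodMk
      ((hO hw.1).contDiffAt_accelParts P w.2).fst.neg).contDiffWithinAt)
    (z := (extChartAt 𝓘(ℝ, E) p p, v)) ⟨hpO, trivial⟩
  have h0J : (0 : ℝ) ∈ Set.Ioo (-ε) ε := ⟨by linarith, hε⟩
  have hgeo := P.isGeodesicCurveOn_of_hasDerivAt h isOpen_Ioo hγ (fun t ht ↦ hO (hd t ht).1.1)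
    (fun t ht ↦ (hd t ht).2)
  set c : ℝ → M := fun t ↦ (extChartAt 𝓘(ℝ, E) p).symm (γ t).1 with hc
  have hc0 : c 0 = p := by simp only [hc, h0, extChartAt_to_inv]
  refine ⟨c, _, isOpen_Ioo, Set.ordConnected_Ioo, h0J, hc0, ?_, hgeo⟩
  have hcs : c 0 ∈ (chartAt E p).source := by rw [hc0]; exact mem_chart_source E p
  have h1 := chartCoord_velocity
    ((hgeo.1.contMDiffAt (isOpen_Ioo.mem_nhds h0J)).mdifferentiableAt (by simp)) hcs
  have h2 : (fun s ↦ extChartAt 𝓘(ℝ, E) p (c s)) =ᶠ[𝓝 0] fun s ↦ (γ s).1 := by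
    filter_upwards [isOpen_Ioo.mem_nhds h0J] with s hs
    exact (extChartAt 𝓘(ℝ, E) p).right_inv (hO (hd s hs).1.1).1
  have hγ' : HasDerivAt (fun s ↦ (γ s).1) (γ 0).2 0 := (hd 0 h0J).2.fst
  rw [h2.deriv_eq, hγ'.deriv, h0] at h1
  have h3 : ∀ (q : M) (hq : q = p) (w : TangentSpace 𝓘(ℝ, E) q), chartCoord p q w = (w : E) := by
    rintro _ rfl w; exact chartCoord_self_apply _ w
  rw [h3 _ hc0] at h1
  exact h1

end LightlikeHypersurface.NullPair

namespace LightlikeHypersurface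

/-- A geodesic of ∇ with initial velocity v is also an ambient geodesic, so both accelerations in
the Gauss formula vanish at time 0 and B(v, v) N = 0 with N ≠ 0. Polarization then gives all of B.
-/
lemma sff_eq_zero_of_isTotallyGeodesic (h : IsLeviCivita g nabla)
    (hT : L.IsTotallyGeodesic nabla) (P : L.NullPair) {p : M} (hp : p ∈ P.dom)
    (v y : TangentSpace 𝓘(ℝ, E) p) : P.sff nabla p v y = 0 := by
  refine P.sff_eq_zero_of_diag h (fun v ↦ ?_) v y
  obtain ⟨c, J, hJ, hJ', h0, hc0, hv, hgeo⟩ := P.exists_geodesic h hp v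
  have h1 := P.covAlong_velocity_eq nabla (hgeo.1.contMDiffAt (hJ.mem_nhds h0)) (by rwa [hc0])
  rw [hgeo.2 0 h0, (hT c J hJ hJ' hgeo).2 0 h0, map_zero, zero_add] at h1
  have hp' : c 0 ∈ P.dom := by rwa [hc0]
  have hN : P.secN (c 0) ≠ 0 := fun hN ↦ by
    have := P.inner_secN_diE hp'
    rw [hN] at this
    simp at this
  have h2 := (smul_eq_zero.1 h1.symm).resolve_right hN
  subst hc0
  have hv' : velocity (F := E) c 0 = v := hv
  rwa [hv'] at h2

end LightlikeHypersurface

end GeodesicExistence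

end

/-! ### The equivalence, through the vanishing of the second fundamental forms -/

theorem mainTheorem6
    {F : Type*} [NormedAddCommGroup F] [NormedSpace ℝ F] [FiniteDimensional ℝ F]
    {Mb : Type*} [TopologicalSpace Mb] [T2Space Mb] [ChartedSpace F Mb]
    [IsManifold 𝓘(ℝ, F) ∞ Mb]
    {E : Type*} [NormedAddCommGroup E] [NormedSpace ℝ E] [FiniteDimensional ℝ E]
    {M : Type*} [TopologicalSpace M] [T2Space M] [ChartedSpace E M] [IsManifold 𝓘(ℝ, E) ∞ M]
    {r : ℕ} (hr : 0 < r) (A : IndefiniteGFF F Mb r) (hA : A.IsSManifold)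
    (nabla : CovariantDerivative 𝓘(ℝ, F) F (TangentSpace 𝓘(ℝ, F) : Mb → Type _))
    (hnabla : IsLeviCivita A.metric nabla)
    (L : LightlikeHypersurface E M A.metric) (hL : L.IsCharacteristic A)
    {ι : Type*} (P : ι → L.NullPair) (hP : ∀ p : M, ∃ k, p ∈ (P k).dom) :
    L.IsTotallyGeodesic nabla ↔
      (∀ Y : Π p : M, TangentSpace 𝓘(ℝ, E) p, SmoothFieldOn Y Set.univ →
        (∀ p, Y p ∈ L.distD A p) →
        ∀ (p : M) (X : TangentSpace 𝓘(ℝ, E) p),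
          L.di p (L.covPhiM A nabla Y p X)
            = A.metric.inner (L.map p) (A.phi (L.map p) (L.di p X))
                (A.phi (L.map p) (L.di p (Y p))) • A.xiSum (L.map p)
              + A.etaSum (L.map p) (L.di p (Y p))
                • A.phi (L.map p) (A.phi (L.map p) (L.di p X))) ∧
      (∀ k, ∀ p ∈ (P k).dom, ∀ X : TangentSpace 𝓘(ℝ, E) p,
        L.di p (L.shape nabla (P k).secN p X)
          = -L.di p (L.phiM A p (L.inducedCov nabla (L.fieldU A (P k)) p X))
            - A.metric.inner (L.map p) (L.di p X) (L.di p (L.fieldU A (P k) p))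
                • A.xiSum (L.map p)) := by
  rw [LightlikeHypersurface.conditions_iff_sff_eq_zero hr hA hnabla hL P hP]
  exact ⟨fun hT k _ hp ↦ LightlikeHypersurface.sff_eq_zero_of_isTotallyGeodesic hnabla hT (P k) hp,
    LightlikeHypersurface.isTotallyGeodesic_of_sff_eq_zero P hP⟩
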